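/- **Setting.** Let $c\in\{-1,0,1\}$, $n>1$, and let $\mathbb Q=\mathbb Q^{n+1}_c$ be the space form of dimension $n+1$ and curvature $c$: $\mathbb R^{n+1}$ if $c=0$, the unit sphere of $\mathbb R^{n+2}$ if $c=1$, and the upper sheet $\{\langle x,x\rangle=-1,\ x_{n+2}>0\}$ of the hyperboloid in Lorentzian $\mathbb R^{n+2}_1$ if $c=-1$. Put $(\mathrm{co},\mathrm{si})(t)=(\cos t,\sin t)$, $(1,t)$, $(\cosh t,\sinh t)$ for $c=1,0,-1$ respectively, and $\mathrm{ct}=\mathrm{co}/\mathrm{si}$. Let $I$ be an open interval, $w>0$ a smooth function on $I$, and $\mathbb Q\times_w I$ the product endowed with the metric $w(t)^2\langle\cdot,\cdot\rangle-dt^2$. For $t_0\in I$ put $\theta(t)=\int_{t_0}^t ds/w(s)$ and $$\Omega(t)=\frac{\theta''\,\mathrm{ct}(\theta)+c\,(\theta')^2}{\theta''-(\theta')^2\,\mathrm{ct}(\theta)}=\frac{\theta''\,\mathrm{co}(\theta)+c\,(\theta')^2\,\mathrm{si}(\theta)}{\theta''\,\mathrm{si}(\theta)-(\theta')^2\,\mathrm{co}(\theta)}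 ,$$ where the last expression extends $\Omega$ through the zeros of $\mathrm{si}(\theta)$; $\Omega$ is defined at $t$ if the last denominator is nonzero there. An immersion $\varphi:\mathcal M\to\mathbb Q$ of an $n$-manifold, with unit normal field (Gauss map) $\nu$, is totally umbilic with curvature $\kappa$ if $d\nu=-\kappa\,d\varphi$ (totally geodesic if $\kappa=0$). **Theorem.** Let $\Sigma$ be a connected, spacelike, immersed $C^2$ submanifold of $\mathbb Q\times_w I$ of dimension $n$ (hence of codimension two), with height function $t|_\Sigma$. Assume that its second fundamental form $h$ is null, i.e. $h(X,Y)$ is a null vector for all tangent vectors $X,Y$ at every point. Then: - either $\Sigma=\mathcal Q'\times\{T\}$ for some $T\in I$, where $\mathcal Q'$ is a totally umbilic (or totally geodesic) immersed hypersurface of $\mathbb Q$ with curvature $w'(T)$; - or the height function is not constant on $\Sigma$, and for every $t_0\in I$ for which $\Omega$ is defined at some height attained by $\Sigma$ (for instance any $t_0$ that is itself such a height), $\Omega$ is defined and equal to a constant $C_0$ on the whole interval of heights attained by $\Sigma$. Moreover, every point of a dense subset of $\Sigma$, and every point near which $h$ is collinear to one single continuous, nowhere vanishing null normal field, has a neighbourhood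 in $\Sigma$ that is parametrized as $$\overline\varphi=(\mathrm{co}(\theta\circ\tau)\,\varphi+\mathrm{si}(\theta\circ\tau)\,\nu,\ \tau),$$ where $\varphi$ is a totally umbilic (or totally geodesic) immersion into $\mathbb Q$ with Gauss map $\nu$ and curvature $C_0$, and $\tau$ is a real function of class $C^2$. Here $\tau$ is arbitrary: conversely, if $t_0\in I$, if $\varphi:\mathcal M\to\mathbb Q$ is a totally umbilic $C^2$ immersion of an $n$-manifold with Gauss map $\nu$ and constant curvature $C_0$, and if $\tau:\mathcal M\to I$ is any $C^2$ function such that $\Omega$ is defined and equal to $C_0$ at all values of $\tau$, then $\overline\varphi$ is a spacelike immersion whose second fundamental form is null, and collinear to one continuous, nowhere vanishing null normal field. -/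

import Mathlib

open scoped Manifold ContDiff Topology

noncomputable section

namespace RW

/-! ### The space form of curvature `c ∈ {-1, 0, 1}` -/

/-- The flat space `ℝ^{n+2}`, written `ℝ^{n+1} × ℝ` to single out the last coordinate. -/
abbrev Flat (n : ℕ) : Type := EuclideanSpace ℝ (Fin (n + 1)) × ℝ

/-- The flat scalar product of `ℝ^{n+2}`: Lorentzian (last coordinate negative) for `c = -1`,
Euclidean otherwise. -/
def flatInner {n : ℕ} : SignType → Flat n → Flat n → ℝ
  | .neg, u, v => inner ℝ u.1 v.1 - u.2 * v.2
  | .zero, u, v => inner ℝ u.1 v.1 + u.2 * v.2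
  | .pos, u, v => inner ℝ u.1 v.1 + u.2 * v.2

/-- The space form of dimension `n + 1` and curvature `c`: the upper sheet of the hyperboloid,
the Euclidean space (as the hyperplane `ℝ^{n+1} × {0}`), or the unit sphere. -/
def spaceForm (n : ℕ) : SignType → Set (Flat n)
  | .neg => {p | flatInner .neg p p = -1 ∧ 0 < p.2}
  | .zero => {p | p.2 = 0}
  | .pos => {p | flatInner .pos p p = 1}

/-- The tangent space of the space form at `p`. -/
def spaceFormTangent {n : ℕ} : SignType → Flat n → Set (Flat n)
  | .neg, p => {v | flatInner .neg p v = 0}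
  | .zero, _ => {v | v.2 = 0}
  | .pos, p => {v | flatInner .pos p v = 0}

/-- The generalized cosine. -/
def co : SignType → ℝ → ℝ
  | .neg, t => Real.cosh t
  | .zero, _ => 1
  | .pos, t => Real.cos t

/-- The generalized sine. -/
def si : SignType → ℝ → ℝ
  | .neg, t => Real.sinh t
  | .zero, t => t
  | .pos, t => Real.sin t

/-- The generalized cotangent. -/
def ct (c : SignType) (t : ℝ) : ℝ := co c t / si c t

/-! ### The warping function and the quantities built from it -/

/-- `θ(t) = ∫_{t₀}^t ds / w(s)`. -/
def theta (w : ℝ → ℝ) (t₀ t : ℝ) : ℝ := ∫ s in t₀..t, (w s)⁻¹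

/-- The numerator of `Ω`, multiplied by `si(θ)`. -/
def OmegaNum (c : SignType) (w : ℝ → ℝ) (t₀ t : ℝ) : ℝ :=
  deriv (deriv (theta w t₀)) t * co c (theta w t₀ t)
    + (c : ℝ) * deriv (theta w t₀) t ^ 2 * si c (theta w t₀ t)

/-- The denominator of `Ω`, multiplied by `si(θ)`. -/
def OmegaDen (c : SignType) (w : ℝ → ℝ) (t₀ t : ℝ) : ℝ :=
  deriv (deriv (theta w t₀)) t * si c (theta w t₀ t)
    - deriv (theta w t₀) t ^ 2 * co c (theta w t₀ t)

/-- The function `Ω = (θ'' ct(θ) + c θ'²) / (θ'' - θ'² ct(θ))`. Both terms of the fraction are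
multiplied by `si(θ)`, which extends `Ω` continuously through the zeros of `si(θ)`
(such as `t = t₀`). -/
def Omega (c : SignType) (w : ℝ → ℝ) (t₀ t : ℝ) : ℝ :=
  OmegaNum c w t₀ t / OmegaDen c w t₀ t

theorem Omega_eq (c : SignType) (w : ℝ → ℝ) (t₀ t : ℝ) (h : si c (theta w t₀ t) ≠ 0) :
    Omega c w t₀ t =
      (deriv (deriv (theta w t₀)) t * ct c (theta w t₀ t)
        + (c : ℝ) * deriv (theta w t₀) t ^ 2) /
      (deriv (deriv (theta w t₀)) t
        - deriv (theta w t₀) t ^ 2 * ct c (theta w t₀ t)) := by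
  unfold Omega OmegaNum OmegaDen ct
  rw [← mul_div_mul_right _ (deriv (deriv (theta w t₀)) t
        - deriv (theta w t₀) t ^ 2 * (co c (theta w t₀ t) / si c (theta w t₀ t))) h]
  congr 1 <;> field_simp

/-! ### Calculus of maps from a manifold to a vector space -/

section calculus

variable {n : ℕ} {M : Type*} [TopologicalSpace M] [ChartedSpace (EuclideanSpace ℝ (Fin n)) M]
  {E : Type*} [NormedAddCommGroup E] [NormedSpace ℝ E]

/-- The map `f` read in the preferred chart at `x`. -/
def inChart (f : M → E) (x : M) : EuclideanSpace ℝ (Fin n) → E :=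
  f ∘ (chartAt (EuclideanSpace ℝ (Fin n)) x).symm

/-- The differential of `f` at `x`, tangent vectors at `x` being read in the preferred chart. -/
def D1 (f : M → E) (x : M) : EuclideanSpace ℝ (Fin n) →L[ℝ] E :=
  fderiv ℝ (inChart (n := n) f x) (chartAt (EuclideanSpace ℝ (Fin n)) x x)

/-- The second derivatives of `f` at `x` in the preferred chart at `x`. -/
def D2 (f : M → E) (x : M) :
    EuclideanSpace ℝ (Fin n) →L[ℝ] EuclideanSpace ℝ (Fin n) →L[ℝ] E :=
  fderiv ℝ (fderiv ℝ (inChart (n := n) f x)) (chartAt (EuclideanSpace ℝ (Fin n)) x x)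

/-- The Christoffel symbols (of the first kind) of a pseudo-Riemannian metric `g` on an open
subset of a vector space: `g (Γ(X, Y), Z)`, by the Koszul formula for constant vector fields. -/
def christoffel (g : E → E → E → ℝ) (p X Y Z : E) : ℝ :=
  (fderiv ℝ (fun q => g q Y Z) p X + fderiv ℝ (fun q => g q X Z) p Y
    - fderiv ℝ (fun q => g q X Y) p Z) / 2

/-- `g (∇_X df(Y), Z)`, where `∇` is the Levi-Civita connection of `g` and `X`, `Y` are coordinate
vector fields of the preferred chart at `x`. -/
def covDerivInner (g : E → E → E → ℝ) (f : M → E) (x : M) (X Y : EuclideanSpace ℝ (Fin n))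
    (Z : E) : ℝ :=
  g (f x) (D2 f x X Y) Z + christoffel g (f x) (D1 f x X) (D1 f x Y) Z

end calculus

/-! ### Hypersurfaces of the space form -/

section hypersurface

variable {n : ℕ} {M : Type*} [TopologicalSpace M] [ChartedSpace (EuclideanSpace ℝ (Fin n)) M]

/-- On the open set `U`, the map `φ` is a `C²` immersion into the space form, `ν` is a unit normal
field (Gauss map) of it, and the shape operator `A`, defined by `dν = -dφ ∘ A`, is `κ` times the
identity: `φ` is totally umbilic (totally geodesic if `κ = 0`) with curvature `κ`. -/
structure IsUmbilicOn (c : SignType) (κ : ℝ) (φ ν : M → Flat n) (U : Set M) : Prop where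
  contMDiffOn : ContMDiffOn 𝓘(ℝ, EuclideanSpace ℝ (Fin n)) 𝓘(ℝ, Flat n) 2 φ U
  mem : ∀ x ∈ U, φ x ∈ spaceForm n c
  immersion : ∀ x ∈ U, Function.Injective (D1 (n := n) φ x)
  normal_contMDiffOn : ContMDiffOn 𝓘(ℝ, EuclideanSpace ℝ (Fin n)) 𝓘(ℝ, Flat n) 1 ν U
  normal_mem : ∀ x ∈ U, ν x ∈ spaceFormTangent c (φ x)
  normal_unit : ∀ x ∈ U, flatInner c (ν x) (ν x) = 1
  normal_orthogonal : ∀ x ∈ U, ∀ X : EuclideanSpace ℝ (Fin n),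
    flatInner c (D1 φ x X) (ν x) = 0
  shape : ∀ x ∈ U, ∀ X : EuclideanSpace ℝ (Fin n), D1 ν x X = -(κ • D1 φ x X)

end hypersurface

/-! ### Codimension two submanifolds of the warped product -/

/-- The warped metric `w(t)² ⟨·,·⟩ - dt²` on `ℝ^{n+2} × I`, which contains the product of the
space form with `I`. -/
def warpedMetric {n : ℕ} (c : SignType) (w : ℝ → ℝ) (p X Y : Flat n × ℝ) : ℝ :=
  w p.2 ^ 2 * flatInner c X.1 Y.1 - X.2 * Y.2

section submanifold

variable {n : ℕ} {M : Type*} [TopologicalSpace M] [ChartedSpace (EuclideanSpace ℝ (Fin n)) M]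

/-- `f` is a `C²` spacelike immersion into the warped product of the space form of curvature `c`
and `I`: the induced metric is positive definite. -/
structure IsSpacelikeImmersion (c : SignType) (I : Set ℝ) (w : ℝ → ℝ) (f : M → Flat n × ℝ) :
    Prop where
  contMDiff : ContMDiff 𝓘(ℝ, EuclideanSpace ℝ (Fin n)) 𝓘(ℝ, Flat n × ℝ) 2 f
  mem_spaceForm : ∀ x, (f x).1 ∈ spaceForm n c
  mem_interval : ∀ x, (f x).2 ∈ I
  spacelike : ∀ x, ∀ X : EuclideanSpace ℝ (Fin n), X ≠ 0 →
    0 < warpedMetric c w (f x) (D1 f x X) (D1 f x X)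

/-- The normal space of `f` at `x` in the warped product: the vectors that are tangent to the
product of the space form and `I` and orthogonal to the image of the differential of `f`. -/
def normalSpace (c : SignType) (w : ℝ → ℝ) (f : M → Flat n × ℝ) (x : M) : Set (Flat n × ℝ) :=
  {Z | Z.1 ∈ spaceFormTangent c (f x).1 ∧
    ∀ X : EuclideanSpace ℝ (Fin n), warpedMetric c w (f x) (D1 f x X) Z = 0}

/-- `η` is the value `h(X, Y)` at `x` of the second fundamental form of `f` in the warped product:
the normal component of the covariant derivative of `df(Y)` in the direction `X`. The Levi-Civita
connection of the warped product is the tangential part of the connection of the ambient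
`ℝ^{n+2} × I`, so both have the same scalar product with a vector `Z` tangent to the
warped product. -/
def IsSecondFF (c : SignType) (w : ℝ → ℝ) (f : M → Flat n × ℝ) (x : M)
    (X Y : EuclideanSpace ℝ (Fin n)) (η : Flat n × ℝ) : Prop :=
  η ∈ normalSpace c w f x ∧ ∀ Z ∈ normalSpace c w f x,
    warpedMetric c w (f x) η Z = covDerivInner (warpedMetric c w) f x X Y Z

/-- The second fundamental form of `f` is null: all the vectors `h(X, Y)` are null. -/
def HasNullSecondFF (c : SignType) (w : ℝ → ℝ) (f : M → Flat n × ℝ) : Prop :=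
  ∀ x, ∀ X Y : EuclideanSpace ℝ (Fin n), ∃ η, IsSecondFF c w f x X Y η ∧
    warpedMetric c w (f x) η η = 0

/-- On `U`, the second fundamental form of `f` is collinear to one continuous, nowhere vanishing
null normal field `ξ`. -/
structure SecondFFCollinearOn (c : SignType) (w : ℝ → ℝ) (f : M → Flat n × ℝ)
    (ξ : M → Flat n × ℝ) (U : Set M) : Prop where
  continuousOn : ContinuousOn ξ U
  ne_zero : ∀ x ∈ U, ξ x ≠ 0
  normal : ∀ x ∈ U, ξ x ∈ normalSpace c w f x
  null : ∀ x ∈ U, warpedMetric c w (f x) (ξ x) (ξ x) = 0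
  collinear : ∀ x ∈ U, ∀ X Y : EuclideanSpace ℝ (Fin n),
    ∃ a : ℝ, IsSecondFF c w f x X Y (a • ξ x)

/-- The map `(co(θ ∘ τ) φ + si(θ ∘ τ) ν, τ)`. -/
def nullShift (c : SignType) (w : ℝ → ℝ) (t₀ : ℝ) (φ ν : M → Flat n) (τ : M → ℝ) (x : M) :
    Flat n × ℝ :=
  (co c (theta w t₀ (τ x)) • φ x + si c (theta w t₀ (τ x)) • ν x, τ x)

/-- On a neighbourhood `U` of `x`, `f` is `(co(θ ∘ τ) φ + si(θ ∘ τ) ν, τ)`, with `φ` a totally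
umbilic immersion of `U` of curvature `κ`, with Gauss map `ν`, and `τ` of class `C²`. -/
def HasLocalForm (c : SignType) (w : ℝ → ℝ) (t₀ κ : ℝ) (f : M → Flat n × ℝ) (x : M) : Prop :=
  ∃ U : Set M, IsOpen U ∧ x ∈ U ∧ ∃ (φ ν : M → Flat n) (τ : M → ℝ),
    IsUmbilicOn c κ φ ν U ∧ ContMDiffOn 𝓘(ℝ, EuclideanSpace ℝ (Fin n)) 𝓘(ℝ, ℝ) 2 τ U ∧
    ∀ y ∈ U, f y = nullShift c w t₀ φ ν τ y

end submanifold

end RW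

end

/-! Write `f = (ψ, τ)`. The normal plane of `f` is Lorentzian, so it contains exactly two null
lines, each spanned by a unique vector `(N, w(τ))` with `N` unit and tangent to the space form. The
pairings of `h` with these two vectors are bilinear forms. For a null `h` one of them vanishes on
each pair `(X, Y)`, hence one of them vanishes identically (`SpacelikeAt.nullAlong_or`), and `h` is
collinear to that null vector.

The implicit function theorem extends each null direction to a local `C¹` field. Differentiating `w
⟨dψ, N⟩ = dτ` turns collinearity of `h` to `(N, w)` into the equation `dN = -w' dψ + dτ ((w'/w) N -
(c/w) ψ)` (`NullFieldAt.nullAlong_iff`). Its right side is `C¹`, so `N` is `C²`, and the symmetry of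
its second derivatives reads `(w w'' - w'² - c) (dτ(Y) dψ(X) - dτ(X) dψ(Y)) = 0`. As `n > 1`, some
`X ≠ 0` has `dτ(X) = 0`, while `dψ` is injective; so `dτ = 0` wherever `w w'' - w'² ≠ c`. By density
and connectedness, either the height is constant or `w w'' - w'² = c` at all heights attained
(`IsSpacelikeImmersion.warping_equation`).

Put `P = co θ + w' si θ` and `R = w' co θ - c si θ`; then `Ω = R / P`. The equation on `w` says that
`P/w` and `R/w` are constant, hence so is `Ω`. Moving back by the distance `θ` along the geodesics
of direction `N` gives `φ = co θ ψ - si θ N` and `ν = c si θ ψ + co θ N`, for which `dφ = P (dψ - dτ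
N/w)` and `dν = -R (dψ - dτ N/w)`; so `φ` is umbilic with curvature `Ω`
(`NullFrameAt.hasLocalForm`). The null line may change from point to point, but failure of
collinearity to a given field is an open condition, so a single field works near the points of a
dense set.

At constant height `N` is a Gauss map of `ψ`, and the equation is `dN = -w'(T) dψ`; what remains is
a coherent global choice of sign. The converse runs the same computation backwards. -/

noncomputable section

namespace RW

/-! ### Flat scalar product, tangent spaces and rotations, uniformly in `c` -/

section algebra

variable {n : ℕ}

/-- The sign of the last coordinate in the flat scalar product. -/
def lastSign : SignType → ℝ
  | .neg => -1
  | .zero => 1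
  | .pos => 1

theorem flatInner_eq (c : SignType) (u v : Flat n) :
    flatInner c u v = inner ℝ u.1 v.1 + lastSign c * (u.2 * v.2) := by
  cases c
  · simp [flatInner, lastSign]
  · simp [flatInner, lastSign]
    ring
  · simp [flatInner, lastSign]

/-- The flat scalar product as a continuous bilinear form. -/
def flatForm (c : SignType) : Flat n →L[ℝ] Flat n →L[ℝ] ℝ :=
  (innerSL ℝ).bilinearComp (.fst ℝ _ _) (.fst ℝ _ _) +
    lastSign c • (ContinuousLinearMap.mul ℝ ℝ).bilinearComp (.snd ℝ _ _) (.snd ℝ _ _)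

theorem flatForm_apply (c : SignType) (u v : Flat n) : flatForm c u v = flatInner c u v := by
  simp [flatForm, flatInner_eq]

theorem flatInner_comm (c : SignType) (u v : Flat n) : flatInner c u v = flatInner c v u := by
  simp only [flatInner_eq, real_inner_comm, mul_comm]

theorem flatInner_add_left (c : SignType) (u v z : Flat n) :
    flatInner c (u + v) z = flatInner c u z + flatInner c v z := by
  simp [← flatForm_apply]

theorem flatInner_add_right (c : SignType) (u v z : Flat n) :
    flatInner c z (u + v) = flatInner c z u + flatInner c z v := by
  simp [← flatForm_apply]

theorem flatInner_sub_left (c : SignType) (u v z : Flat n) :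
    flatInner c (u - v) z = flatInner c u z - flatInner c v z := by
  simp [← flatForm_apply]

theorem flatInner_sub_right (c : SignType) (u v z : Flat n) :
    flatInner c z (u - v) = flatInner c z u - flatInner c z v := by
  simp [← flatForm_apply]

theorem flatInner_smul_left (c : SignType) (a : ℝ) (u z : Flat n) :
    flatInner c (a • u) z = a * flatInner c u z := by
  simp [← flatForm_apply]

theorem flatInner_smul_right (c : SignType) (a : ℝ) (u z : Flat n) :
    flatInner c z (a • u) = a * flatInner c z u := by
  simp [← flatForm_apply]

theorem flatInner_neg_left (c : SignType) (u z : Flat n) :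
    flatInner c (-u) z = -flatInner c u z := by
  simp [← flatForm_apply]

theorem flatInner_neg_right (c : SignType) (u z : Flat n) :
    flatInner c z (-u) = -flatInner c z u := by
  simp [← flatForm_apply]

theorem flatInner_zero_left (c : SignType) (z : Flat n) : flatInner c 0 z = 0 := by
  simp [← flatForm_apply]

theorem flatInner_zero_right (c : SignType) (z : Flat n) : flatInner c z 0 = 0 := by
  simp [← flatForm_apply]

theorem eq_zero_of_flatInner_eq_zero {c : SignType} {v : Flat n}
    (h : ∀ u, flatInner c u v = 0) : v = 0 := by
  have h1 := h (v.1, 0)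
  have h2 := h (0, v.2)
  simp only [flatInner_eq] at h1 h2
  refine Prod.ext ?_ ?_
  · simpa using h1
  · cases c <;> simpa [lastSign] using h2

/-- A vector normal to the space form at `p`. -/
def conormal (c : SignType) (p : Flat n) : Flat n :=
  (c : ℝ) ^ 2 • p + (1 - (c : ℝ) ^ 2) • ((0, 1) : Flat n)

/-- As `c ^ 2` is 0 or 1, the conormal is the position vector on the sphere and the hyperboloid and
the last basis vector in the flat case. Tangency is thus one linear equation for all three
geometries. -/
theorem mem_spaceFormTangent_iff {c : SignType} {p v : Flat n} :
    v ∈ spaceFormTangent c p ↔ flatInner c (conormal c p) v = 0 := by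
  cases c <;> simp [spaceFormTangent, conormal, flatInner]

theorem sign_mul_flatInner_conormal {c : SignType} {p : Flat n} (hp : p ∈ spaceForm n c) :
    (c : ℝ) * flatInner c (conormal c p) p = (c : ℝ) ^ 2 := by
  cases c <;> simp_all [spaceForm, conormal, flatInner]

theorem flatInner_conormal_self_ne_zero {c : SignType} {p : Flat n} (hp : p ∈ spaceForm n c) :
    flatInner c (conormal c p) (conormal c p) ≠ 0 := by
  cases c <;> simp_all [spaceForm, conormal, flatInner]

/-- The factor `c` absorbs the flat case, where the position vector is not normal. Computations
uniform in `c` need only this product. -/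
theorem flatInner_conormal_left {c : SignType} {p v : Flat n} (h : v ∈ spaceFormTangent c p) :
    (c : ℝ) * flatInner c p v = 0 := by
  cases c <;> simp_all [spaceFormTangent]

theorem sign_mul_flatInner_self {c : SignType} {p : Flat n} (hp : p ∈ spaceForm n c) :
    (c : ℝ) * flatInner c p p = (c : ℝ) ^ 2 := by
  cases c <;> simp_all [spaceForm]

/-- Only the hyperbolic case has content: Cauchy–Schwarz for the Euclidean parts, with `|p₁|² = p₂²
- 1` and `⟨p₁, v₁⟩ = p₂ v₂`, gives `p₂² (|v₁|² - v₂²) ≥ |v₁|²`. -/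
theorem flatInner_self_pos {c : SignType} {p v : Flat n} (hp : p ∈ spaceForm n c)
    (hv : v ∈ spaceFormTangent c p) (h0 : v ≠ 0) : 0 < flatInner c v v := by
  have hcase : v.1 = 0 → v.2 ≠ 0 := fun h1 h2 => h0 (Prod.ext h1 h2)
  have hpos : v.1 ≠ 0 → 0 < inner ℝ v.1 v.1 := fun h => real_inner_self_pos.2 h
  cases c with
  | zero =>
    have hv2 : v.2 = 0 := hv
    have : v.1 ≠ 0 := fun h => hcase h hv2
    simpa [flatInner, hv2] using hpos this
  | pos =>
    by_cases h1 : v.1 = 0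
    · have := hcase h1
      simp only [flatInner, h1, inner_zero_left, zero_add]
      exact mul_self_pos.2 this
    · exact add_pos_of_pos_of_nonneg (hpos h1) (mul_self_nonneg _)
  | neg =>
    obtain ⟨hp1, hp2⟩ := hp
    have hv' : inner ℝ p.1 v.1 - p.2 * v.2 = 0 := hv
    have hp1' : inner ℝ p.1 p.1 - p.2 * p.2 = -1 := hp1
    by_cases h1 : v.1 = 0
    · have := hcase h1
      simp [h1, hp2.ne', this] at hv'
    · have hq := hpos h1
      have hcs := real_inner_mul_inner_self_le p.1 v.1
      change 0 < inner ℝ v.1 v.1 - v.2 * v.2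
      have e1 : inner ℝ p.1 v.1 = p.2 * v.2 := by linarith
      have e2 : inner ℝ p.1 p.1 = p.2 * p.2 - 1 := by linarith
      rw [e1, e2] at hcs
      have : 0 < p.2 ^ 2 * (inner ℝ v.1 v.1 - v.2 * v.2) := by nlinarith
      exact pos_of_mul_pos_right this (sq_nonneg _)

theorem co_sq_add_si_sq (c : SignType) (t : ℝ) : co c t ^ 2 + (c : ℝ) * si c t ^ 2 = 1 := by
  cases c
  · simp [co, si]
  · simp only [co, si, SignType.neg_eq_neg_one, SignType.coe_neg, SignType.coe_one]
    linarith [Real.cosh_sq t]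
  · simp [co, si]

/-- Rotating a point of the space form in the direction of a unit tangent vector. -/
theorem rotate_mem_spaceForm {c : SignType} {p v : Flat n} (hp : p ∈ spaceForm n c)
    (hv : v ∈ spaceFormTangent c p) (h1 : flatInner c v v = 1) (t : ℝ) :
    co c t • p + si c t • v ∈ spaceForm n c := by
  have hcs := co_sq_add_si_sq c t
  cases c with
  | zero =>
    have hp2 : p.2 = 0 := hp
    have hv2 : v.2 = 0 := hv
    simp [spaceForm, hp2, hv2]
  | pos =>
    have hp' : flatInner .pos p p = 1 := hp
    have hv' : flatInner .pos p v = 0 := hv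
    change flatInner .pos _ _ = 1
    simp only [flatInner_add_left, flatInner_add_right, flatInner_smul_left, flatInner_smul_right,
      flatInner_comm _ v p, hp', hv', h1]
    rw [SignType.pos_eq_one, SignType.coe_one] at hcs
    rw [SignType.pos_eq_one]
    linarith
  | neg =>
    obtain ⟨hp1, hp2⟩ := hp
    have hv' : flatInner .neg p v = 0 := hv
    refine ⟨?_, ?_⟩
    · simp only [flatInner_add_left, flatInner_add_right, flatInner_smul_left,
        flatInner_smul_right, flatInner_comm _ v p, hp1, hv', h1]
      rw [SignType.neg_eq_neg_one, SignType.coe_neg, SignType.coe_one] at hcs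
      rw [SignType.neg_eq_neg_one]
      linarith
    -- To stay on the upper sheet: Cauchy–Schwarz with `|v₁|² = v₂² + 1` gives `v₂² ≤ p₂² - 1`, and
    -- `|sinh| < cosh`.
    · have hlt : |v.2| < p.2 := by
        have hcs' := real_inner_mul_inner_self_le p.1 v.1
        have e1 : inner ℝ p.1 v.1 = p.2 * v.2 := by
          have : inner ℝ p.1 v.1 - p.2 * v.2 = 0 := hv'
          linarith
        have e2 : inner ℝ p.1 p.1 = p.2 * p.2 - 1 := by
          have : inner ℝ p.1 p.1 - p.2 * p.2 = -1 := hp1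
          linarith
        have e3 : inner ℝ v.1 v.1 = v.2 * v.2 + 1 := by
          have : inner ℝ v.1 v.1 - v.2 * v.2 = 1 := h1
          linarith
        rw [e1, e2, e3] at hcs'
        refine abs_lt_of_sq_lt_sq ?_ hp2.le
        nlinarith
      have hs : |Real.sinh t| < Real.cosh t :=
        abs_lt_of_sq_lt_sq (by linarith [Real.cosh_sq t]) (Real.cosh_pos t).le
      have h2 : |Real.sinh t * v.2| < Real.cosh t * p.2 := by
        rw [abs_mul]
        exact mul_lt_mul'' hs hlt (abs_nonneg _) (abs_nonneg _)
      have h3 := (abs_lt.1 h2).1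
      simp only [co, si, Prod.snd_add, Prod.smul_snd, smul_eq_mul]
      linarith

/-- The vector is the velocity at time `t` of the geodesic `t ↦ co(t) p + si(t) v`, which stays in
the space form. -/
theorem rotate_mem_spaceFormTangent {c : SignType} {p v : Flat n} (hp : p ∈ spaceForm n c)
    (hv : v ∈ spaceFormTangent c p) (h1 : flatInner c v v = 1) (t : ℝ) :
    -((c : ℝ) * si c t) • p + co c t • v ∈
      spaceFormTangent c (co c t • p + si c t • v) := by
  cases c with
  | zero =>
    have hv2 : v.2 = 0 := hv
    simp [spaceFormTangent, hv2]
  | pos =>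
    have hp' : flatInner .pos p p = 1 := hp
    have hv' : flatInner .pos p v = 0 := hv
    change flatInner .pos _ _ = 0
    simp only [flatInner_add_left, flatInner_add_right, flatInner_smul_left, flatInner_smul_right,
      flatInner_comm _ v p, hp', hv', h1]
    simp
    ring
  | neg =>
    have hp' : flatInner .neg p p = -1 := hp.1
    have hv' : flatInner .neg p v = 0 := hv
    change flatInner .neg _ _ = 0
    simp only [flatInner_add_left, flatInner_add_right, flatInner_smul_left, flatInner_smul_right,
      flatInner_comm _ v p, hp', hv', h1]
    simp
    ring

theorem flatInner_rotate_self {c : SignType} {p v : Flat n} (hp : p ∈ spaceForm n c)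
    (hv : v ∈ spaceFormTangent c p) (h1 : flatInner c v v = 1) (t : ℝ) :
    flatInner c (-((c : ℝ) * si c t) • p + co c t • v)
      (-((c : ℝ) * si c t) • p + co c t • v) = 1 := by
  have e1 := sign_mul_flatInner_self hp
  have e2 := flatInner_conormal_left hv
  have e3 := co_sq_add_si_sq c t
  have e4 : (c : ℝ) ^ 3 = c := by cases c <;> norm_num
  simp only [flatInner_add_left, flatInner_add_right, flatInner_smul_left, flatInner_smul_right,
    flatInner_comm _ v p, h1]
  linear_combination (c : ℝ) * si c t ^ 2 * e1 - 2 * si c t * co c t * e2 + e3 +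
    si c t ^ 2 * e4

end algebra

/-! ### Linear algebra of the normal plane at one point -/

section frame

variable {n : ℕ} {c : SignType} {W : ℝ} {p : Flat n}
  {A : EuclideanSpace ℝ (Fin n) →L[ℝ] Flat n × ℝ} {N : Flat n}

/-- `A` is the differential of a spacelike immersion of codimension two, at a point whose first
component is `p` and at which the warping function takes the value `W`. -/
structure SpacelikeAt (c : SignType) (W : ℝ) (p : Flat n)
    (A : EuclideanSpace ℝ (Fin n) →L[ℝ] Flat n × ℝ) : Prop where
  mem : p ∈ spaceForm n c
  pos : 0 < W
  tangent : ∀ X, flatInner c (conormal c p) (A X).1 = 0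
  spacelike : ∀ X, X ≠ 0 → 0 < W ^ 2 * flatInner c (A X).1 (A X).1 - (A X).2 * (A X).2

/-- `(N, W)` is a null vector normal to the image of `A`. -/
structure IsNullDir (c : SignType) (W : ℝ) (p : Flat n)
    (A : EuclideanSpace ℝ (Fin n) →L[ℝ] Flat n × ℝ) (N : Flat n) : Prop where
  tangent : flatInner c (conormal c p) N = 0
  unit : flatInner c N N = 1
  normal : ∀ X, W * flatInner c (A X).1 N = (A X).2

/-- A tangent vector without component along the space form has nonpositive square; so the first
component of the differential is injective. -/
theorem SpacelikeAt.ne_zero (hA : SpacelikeAt c W p A) {X : EuclideanSpace ℝ (Fin n)}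
    (hX : X ≠ 0) : (A X).1 ≠ 0 := by
  intro h
  have := hA.spacelike X hX
  rw [h, flatInner_zero_left] at this
  nlinarith

/-- Dimension count: the image of `dψ`, the conormal and `b` are independent, of total dimension `n
+ 2`, so they span the flat space, whose scalar product is nondegenerate. -/
theorem SpacelikeAt.eq_zero_of_orthogonal (hA : SpacelikeAt c W p A) {b x : Flat n}
    (hb : flatInner c (conormal c p) b = 0) (hbA : ∀ X, (A X).1 ≠ b)
    (h1 : flatInner c (conormal c p) x = 0) (h2 : ∀ X, flatInner c (A X).1 x = 0)
    (h3 : flatInner c b x = 0) : x = 0 := by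
  let L : EuclideanSpace ℝ (Fin n) × ℝ × ℝ →ₗ[ℝ] Flat n :=
    (LinearMap.fst ℝ (Flat n) ℝ ∘ₗ A.toLinearMap).coprod
      ((LinearMap.toSpanSingleton ℝ (Flat n) (conormal c p)).coprod
        (LinearMap.toSpanSingleton ℝ (Flat n) b))
  have hL : ∀ X a t, L (X, a, t) = (A X).1 + (a • conormal c p + t • b) := fun X a t => rfl
  have hinj : Function.Injective L := by
    rw [injective_iff_map_eq_zero]
    rintro ⟨X, a, t⟩ h
    rw [hL] at h
    have ha : a = 0 := by
      have := congrArg (flatInner c (conormal c p)) h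
      simp only [flatInner_add_right, flatInner_smul_right, hb, hA.tangent,
        flatInner_zero_right] at this
      have h4 := flatInner_conormal_self_ne_zero hA.mem
      simpa [h4] using this
    subst ha
    have ht : t = 0 := by
      by_contra ht
      refine hbA ((-t⁻¹) • X) ?_
      have : (A X).1 = -(t • b) := by
        rw [zero_smul, zero_add] at h
        exact eq_neg_of_add_eq_zero_left h
      rw [map_smul, Prod.smul_fst, this, smul_neg, neg_smul, neg_neg, smul_smul,
        inv_mul_cancel₀ ht, one_smul]
    subst ht
    have hX : X = 0 := by
      by_contra hX
      refine hA.ne_zero hX ?_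
      simpa using h
    simp [hX]
  have hsurj : Function.Surjective L := by
    refine (LinearMap.injective_iff_surjective_of_finrank_eq_finrank ?_).1 hinj
    simp
  refine eq_zero_of_flatInner_eq_zero (c := c) fun u => ?_
  obtain ⟨⟨X, a, t⟩, rfl⟩ := hsurj u
  rw [hL]
  simp only [flatInner_add_left, flatInner_smul_left, h1, h2, h3]
  ring

/-- A tangent vector with first component `N` would have height component `W`, hence be null. -/
theorem SpacelikeAt.nullDir_notMem_range (hA : SpacelikeAt c W p A) (hN : IsNullDir c W p A N)
    (X : EuclideanSpace ℝ (Fin n)) : (A X).1 ≠ N := by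
  rintro h
  have h1 := hN.normal X
  have hu := hN.unit
  by_cases hX : X = 0
  · subst hX
    rw [map_zero, Prod.fst_zero] at h
    rw [← h, flatInner_zero_left] at hu
    exact zero_ne_one hu
  · have := hA.spacelike X hX
    rw [h, hu, mul_one] at h1
    rw [h, hu, ← h1] at this
    nlinarith

theorem SpacelikeAt.normal_notMem_range (hA : SpacelikeAt c W p A) {m : Flat n}
    (h1 : flatInner c (conormal c p) m = 0) (h2 : ∀ X, flatInner c (A X).1 m = 0) (h0 : m ≠ 0)
    (X : EuclideanSpace ℝ (Fin n)) : (A X).1 ≠ m := by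
  rintro h
  have h3 := h2 X
  rw [h] at h3
  exact (flatInner_self_pos hA.mem (mem_spaceFormTangent_iff.2 h1) h0).ne' h3

/-- This rigidity serves twice: it determines the derivative of a null field from its scalar
products, and it makes the equations of a null direction nondegenerate for the implicit function
theorem. -/
theorem SpacelikeAt.eq_zero_of_orthogonal_nullDir (hA : SpacelikeAt c W p A)
    (hN : IsNullDir c W p A N) {x : Flat n} (h1 : flatInner c (conormal c p) x = 0)
    (h2 : ∀ X, flatInner c (A X).1 x = 0) (h3 : flatInner c N x = 0) : x = 0 :=
  hA.eq_zero_of_orthogonal hN.tangent (hA.nullDir_notMem_range hN) h1 h2 h3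

/-- The vectors of the space form normal to the hypersurface form a line. -/
theorem SpacelikeAt.eq_smul_normal (hA : SpacelikeAt c W p A) {m x : Flat n}
    (h1 : flatInner c (conormal c p) m = 0) (h2 : ∀ X, flatInner c (A X).1 m = 0) (h0 : m ≠ 0)
    (hx1 : flatInner c (conormal c p) x = 0) (hx2 : ∀ X, flatInner c (A X).1 x = 0) :
    x = (flatInner c m x / flatInner c m m) • m := by
  have hm := (flatInner_self_pos hA.mem (mem_spaceFormTangent_iff.2 h1) h0).ne'
  refine sub_eq_zero.1 (hA.eq_zero_of_orthogonal h1 (hA.normal_notMem_range h1 h2 h0) ?_ ?_ ?_)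
  · simp only [flatInner_sub_right, flatInner_smul_right, h1, hx1]
    ring
  · intro X
    simp only [flatInner_sub_right, flatInner_smul_right, h2, hx2]
    ring
  · simp only [flatInner_sub_right, flatInner_smul_right]
    field_simp
    ring

/-- These are `n + 1` linear conditions on a space of dimension `n + 2`; a nonzero solution is
tangent to the space form, hence of positive square, and can be normalized. -/
theorem SpacelikeAt.exists_unit_normal (hA : SpacelikeAt c W p A) :
    ∃ m : Flat n, flatInner c (conormal c p) m = 0 ∧ (∀ X, flatInner c (A X).1 m = 0) ∧
      flatInner c m m = 1 := by
  let L : Flat n →ₗ[ℝ] (EuclideanSpace ℝ (Fin n) →ₗ[ℝ] ℝ) × ℝ :=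
    LinearMap.prod
      (LinearMap.mk₂ ℝ (fun v X => flatInner c (A X).1 v)
        (fun _ _ _ => flatInner_add_right _ _ _ _) (fun _ _ _ => flatInner_smul_right _ _ _ _)
        (fun _ _ _ => by simp [flatInner_add_left]) (fun _ _ _ => by simp [flatInner_smul_left]))
      (flatForm c (conormal c p)).toLinearMap
  have hker : LinearMap.ker L ≠ ⊥ := by
    apply LinearMap.ker_ne_bot_of_finrank_lt
    simp
  obtain ⟨v, hv, hv0⟩ := (Submodule.ne_bot_iff _).1 hker
  have hv' : L v = 0 := hv
  have h1 : flatInner c (conormal c p) v = 0 := by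
    rw [← flatForm_apply]
    exact congrArg Prod.snd hv'
  have h2 : ∀ X, flatInner c (A X).1 v = 0 := fun X =>
    LinearMap.congr_fun (congrArg Prod.fst hv') X
  have hpos := flatInner_self_pos hA.mem (mem_spaceFormTangent_iff.2 h1) hv0
  refine ⟨(√(flatInner c v v))⁻¹ • v, ?_, fun X => ?_, ?_⟩
  · rw [flatInner_smul_right, h1, mul_zero]
  · rw [flatInner_smul_right, h2, mul_zero]
  · rw [flatInner_smul_left, flatInner_smul_right]
    have : √(flatInner c v v) ≠ 0 := (Real.sqrt_pos.2 hpos).ne'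
    field_simp
    exact (Real.sq_sqrt hpos.le).symm

/-- The metric pulled back by `ψ` is positive definite, so it represents `dτ / W`. The vector
`dψ(X₀)` is the part tangent to the hypersurface of any null direction. -/
theorem SpacelikeAt.exists_gradient (hA : SpacelikeAt c W p A) :
    ∃ X₀, ∀ X, W ^ 2 * flatInner c (A X).1 (A X₀).1 = W * (A X).2 := by
  let L : EuclideanSpace ℝ (Fin n) →ₗ[ℝ] (EuclideanSpace ℝ (Fin n) →ₗ[ℝ] ℝ) :=
    LinearMap.mk₂ ℝ (fun Y X => flatInner c (A X).1 (A Y).1)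
      (fun _ _ _ => by simp [flatInner_add_right]) (fun _ _ _ => by simp [flatInner_smul_right])
      (fun _ _ _ => by simp [flatInner_add_left]) (fun _ _ _ => by simp [flatInner_smul_left])
  have hinj : Function.Injective L := by
    rw [injective_iff_map_eq_zero]
    intro X hX
    by_contra h0
    have h1 : flatInner c (A X).1 (A X).1 = 0 := LinearMap.congr_fun hX X
    have := hA.spacelike X h0
    rw [h1] at this
    nlinarith
  have hsurj : Function.Surjective L := by
    refine (LinearMap.injective_iff_surjective_of_finrank_eq_finrank ?_).1 hinj
    simp
  obtain ⟨X₀, hX₀⟩ := hsurj (W⁻¹ • (LinearMap.snd ℝ (Flat n) ℝ ∘ₗ A.toLinearMap))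
  refine ⟨X₀, fun X => ?_⟩
  have h1 : flatInner c (A X).1 (A X₀).1 = W⁻¹ * (A X).2 := LinearMap.congr_fun hX₀ X
  have := hA.pos.ne'
  rw [h1]
  field_simp

/-- There are exactly two null normal directions. -/
theorem SpacelikeAt.exists_nullDir_pair (hA : SpacelikeAt c W p A) :
    ∃ N₁ N₂, IsNullDir c W p A N₁ ∧ IsNullDir c W p A N₂ ∧ N₁ ≠ N₂ := by
  obtain ⟨m, hm1, hm2, hm3⟩ := hA.exists_unit_normal
  obtain ⟨X₀, hX₀⟩ := hA.exists_gradient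
  have hW := hA.pos
  set q := flatInner c (A X₀).1 (A X₀).1 with hq
  -- Here `dτ(X₀) = W q`, so spacelikeness of `X₀ ≠ 0` reads `W² q (1 - q) > 0`.
  have hq1 : q < 1 := by
    have h1 : W * q = (A X₀).2 := by
      refine mul_left_cancel₀ hW.ne' ?_
      linarith [hX₀ X₀]
    by_cases h0 : X₀ = 0
    · rw [hq, h0, map_zero, Prod.fst_zero, flatInner_zero_left]
      exact zero_lt_one
    · have h2 := hA.spacelike X₀ h0
      rw [← hq, ← h1] at h2
      have h3 : 0 < q := by
        by_contra h3
        have : W ^ 2 * q ≤ 0 := mul_nonpos_of_nonneg_of_nonpos (sq_nonneg W) (not_lt.1 h3)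
        nlinarith [mul_self_nonneg (W * q)]
      have h4 : 0 < (W ^ 2 * q) * (1 - q) := by nlinarith
      linarith [pos_of_mul_pos_right h4 (by positivity)]
  -- With tangential part fixed, unit length leaves only the normal coefficient `b = ±√(1 - q)`.
  have key : ∀ b : ℝ, b ^ 2 = 1 - q → IsNullDir c W p A ((A X₀).1 + b • m) := by
    intro b hb
    refine ⟨?_, ?_, fun X => ?_⟩
    · rw [flatInner_add_right, flatInner_smul_right, hA.tangent, hm1]
      ring
    · simp only [flatInner_add_right, flatInner_add_left, flatInner_smul_right,
        flatInner_smul_left, hm2, hm3, flatInner_comm _ m]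
      rw [← hq]
      linarith
    · rw [flatInner_add_right, flatInner_smul_right, hm2]
      refine mul_left_cancel₀ hW.ne' ?_
      linarith [hX₀ X]
  have hb : √(1 - q) ^ 2 = 1 - q := Real.sq_sqrt (by linarith)
  have hb0 : 0 < √(1 - q) := Real.sqrt_pos.2 (by linarith)
  refine ⟨_, _, key _ hb, key (-√(1 - q)) (by rw [neg_sq, hb]), fun h => ?_⟩
  have h1 := congrArg (flatInner c m) h
  simp only [flatInner_add_right, flatInner_smul_right, hm3] at h1
  linarith

/-- Differences of null directions lie on the normal line, so `N = N₁ + a (N₂ - N₁)`. Unit length is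
a quadratic equation for `a` with roots 0 and 1. -/
theorem SpacelikeAt.eq_or_eq (hA : SpacelikeAt c W p A) {N₁ N₂ : Flat n}
    (h₁ : IsNullDir c W p A N₁) (h₂ : IsNullDir c W p A N₂) (hne : N₁ ≠ N₂)
    (hN : IsNullDir c W p A N) : N = N₁ ∨ N = N₂ := by
  have hW := hA.pos
  have hd : ∀ {N N'}, IsNullDir c W p A N → IsNullDir c W p A N' →
      ∀ X, flatInner c (A X).1 (N - N') = 0 := by
    intro N N' h h' X
    refine mul_left_cancel₀ hW.ne' ?_
    rw [flatInner_sub_right, mul_sub, h.normal, h'.normal]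
    ring
  have ht : ∀ {N N'}, IsNullDir c W p A N → IsNullDir c W p A N' →
      flatInner c (conormal c p) (N - N') = 0 := by
    intro N N' h h'
    rw [flatInner_sub_right, h.tangent, h'.tangent, sub_zero]
  have h0 : N₂ - N₁ ≠ 0 := sub_ne_zero.2 hne.symm
  have hpos := flatInner_self_pos hA.mem (mem_spaceFormTangent_iff.2 (ht h₂ h₁)) h0
  have h3 := hA.eq_smul_normal (ht h₂ h₁) (hd h₂ h₁) h0 (ht hN h₁) (hd hN h₁)
  set a := flatInner c (N₂ - N₁) (N - N₁) / flatInner c (N₂ - N₁) (N₂ - N₁)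
  have hNa : N = N₁ + a • (N₂ - N₁) := by rw [← h3]; abel
  have hu := hN.unit
  have hu1 := h₁.unit
  have hu2 := h₂.unit
  have e2 : flatInner c N₁ N₁ + 2 * flatInner c N₁ (N₂ - N₁) +
      flatInner c (N₂ - N₁) (N₂ - N₁) = 1 := by
    rw [← hu2]
    simp only [flatInner_sub_right, flatInner_sub_left, flatInner_comm _ N₂ N₁]
    ring
  have e3 : flatInner c N₁ N₁ + 2 * a * flatInner c N₁ (N₂ - N₁) +
      a ^ 2 * flatInner c (N₂ - N₁) (N₂ - N₁) = 1 := by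
    rw [← hu, hNa]
    simp only [flatInner_add_right, flatInner_add_left, flatInner_smul_right,
      flatInner_smul_left, flatInner_comm _ (N₂ - N₁) N₁]
    ring
  have e4 : a * (a - 1) * flatInner c (N₂ - N₁) (N₂ - N₁) = 0 := by
    linear_combination e3 - a * e2 - (1 - a) * hu1
  rcases mul_eq_zero.1 ((mul_eq_zero.1 e4).resolve_right hpos.ne') with h | h
  · left
    rw [hNa, h, zero_smul, add_zero]
  · right
    rw [hNa, sub_eq_zero.1 h, one_smul]
    abel

end frame

/-! ### Derivatives in the preferred charts and change of chart -/

section charts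

variable {n : ℕ} {M : Type*} [TopologicalSpace M] [ChartedSpace (EuclideanSpace ℝ (Fin n)) M]

theorem inChart_apply {E : Type*} [NormedAddCommGroup E] (k : M → E) {x y : M}
    (hy : y ∈ (chartAt (EuclideanSpace ℝ (Fin n)) x).source) :
    inChart (n := n) k x (chartAt (EuclideanSpace ℝ (Fin n)) x y) = k y := by
  simp [inChart, OpenPartialHomeomorph.left_inv _ hy]

theorem eventually_inChart_comp {E : Type*} [NormedAddCommGroup E] (k : M → E) {x y z : M}
    (hx : z ∈ (chartAt (EuclideanSpace ℝ (Fin n)) x).source)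
    (hy : z ∈ (chartAt (EuclideanSpace ℝ (Fin n)) y).source) :
    inChart (n := n) k y =ᶠ[𝓝 (chartAt (EuclideanSpace ℝ (Fin n)) y z)]
      inChart (n := n) k x ∘ inChart (n := n) (chartAt (EuclideanSpace ℝ (Fin n)) x) y := by
  have h1 := (chartAt (EuclideanSpace ℝ (Fin n)) y).eventually_nhds'
    (fun u => u ∈ (chartAt (EuclideanSpace ℝ (Fin n)) x).source) hy |>.2
    ((chartAt (EuclideanSpace ℝ (Fin n)) x).open_source.mem_nhds hx)
  filter_upwards [h1] with q hq
  simp [inChart, OpenPartialHomeomorph.left_inv _ hq]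

variable [IsManifold 𝓘(ℝ, EuclideanSpace ℝ (Fin n)) 2 M]
  {E : Type*} [NormedAddCommGroup E] [NormedSpace ℝ E]

theorem contMDiffAt_iff_inChart {k : M → E} {m : ℕ∞ω} (hm : m ≤ 2) {x y : M}
    (hy : y ∈ (chartAt (EuclideanSpace ℝ (Fin n)) x).source) :
    ContMDiffAt 𝓘(ℝ, EuclideanSpace ℝ (Fin n)) 𝓘(ℝ, E) m k y ↔
      ContDiffAt ℝ m (inChart (n := n) k x) (chartAt (EuclideanSpace ℝ (Fin n)) x y) := by
  have : IsManifold 𝓘(ℝ, EuclideanSpace ℝ (Fin n)) m M := IsManifold.of_le hm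
  rw [contMDiffAt_iff_source_of_mem_source hy]
  simp only [mfld_simps, contMDiffWithinAt_univ, contMDiffAt_iff_contDiffAt]
  rfl

/-- The differential at `y` of the transition from the preferred chart at `y` to that at `x`. -/
def coordChange (x y : M) : EuclideanSpace ℝ (Fin n) →L[ℝ] EuclideanSpace ℝ (Fin n) :=
  fderiv ℝ (inChart (n := n) (chartAt (EuclideanSpace ℝ (Fin n)) x) y)
    (chartAt (EuclideanSpace ℝ (Fin n)) y y)

theorem differentiableAt_transition {x y z : M}
    (hx : z ∈ (chartAt (EuclideanSpace ℝ (Fin n)) x).source)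
    (hy : z ∈ (chartAt (EuclideanSpace ℝ (Fin n)) y).source) :
    DifferentiableAt ℝ (inChart (n := n) (chartAt (EuclideanSpace ℝ (Fin n)) x) y)
      (chartAt (EuclideanSpace ℝ (Fin n)) y z) := by
  have h : ContMDiffAt 𝓘(ℝ, EuclideanSpace ℝ (Fin n)) 𝓘(ℝ, EuclideanSpace ℝ (Fin n)) 2
      (chartAt (EuclideanSpace ℝ (Fin n)) x) z :=
    contMDiffOn_chart.contMDiffAt ((chartAt _ x).open_source.mem_nhds hx)
  exact ((contMDiffAt_iff_inChart le_rfl hy).1 h).differentiableAt two_ne_zero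

/-- `D1 k y` is read in the chart at `y`, which may jump with `y`. The lemma reads it in one fixed
chart, up to a linear map independent of `k`, so that equations between differentials can be
differentiated or passed to the limit. -/
theorem D1_eq_comp_coordChange {k : M → E} {x y : M}
    (hy : y ∈ (chartAt (EuclideanSpace ℝ (Fin n)) x).source)
    (hk : DifferentiableAt ℝ (inChart (n := n) k x) (chartAt (EuclideanSpace ℝ (Fin n)) x y)) :
    D1 (n := n) k y = (fderiv ℝ (inChart (n := n) k x)
      (chartAt (EuclideanSpace ℝ (Fin n)) x y)).comp (coordChange x y) := by
  have hyy := mem_chart_source (EuclideanSpace ℝ (Fin n)) y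
  rw [D1, (eventually_inChart_comp k hy hyy).fderiv_eq]
  have e := inChart_apply (n := n) (chartAt (EuclideanSpace ℝ (Fin n)) x) hyy
  rw [fderiv_comp]
  · rw [e]; rfl
  · rwa [e]
  · exact differentiableAt_transition hy hyy

/-- By the chain rule the derivative of the reverse transition is a left inverse, and dimensions
agree. -/
theorem coordChange_bijective {x y : M}
    (hy : y ∈ (chartAt (EuclideanSpace ℝ (Fin n)) x).source) :
    Function.Bijective (coordChange (n := n) x y) := by
  have hyy := mem_chart_source (EuclideanSpace ℝ (Fin n)) y
  have hinj : Function.Injective (coordChange (n := n) x y) := by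
    have h := D1_eq_comp_coordChange (k := chartAt (EuclideanSpace ℝ (Fin n)) y) hy
      (differentiableAt_transition hyy hy)
    have hid : D1 (n := n) (chartAt (EuclideanSpace ℝ (Fin n)) y) y = .id ℝ _ := by
      have : inChart (n := n) (chartAt (EuclideanSpace ℝ (Fin n)) y) y
          =ᶠ[𝓝 (chartAt (EuclideanSpace ℝ (Fin n)) y y)] id := by
        filter_upwards [(chartAt (EuclideanSpace ℝ (Fin n)) y).open_target.mem_nhds
          (mem_chart_target _ y)] with q hq
        simp [inChart, OpenPartialHomeomorph.right_inv _ hq]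
      rw [D1, this.fderiv_eq, fderiv_id]
    intro u v huv
    have h2 := congrArg (fun L => L (u - v)) (h.symm.trans hid)
    simpa [huv, sub_eq_zero, eq_comm] using h2
  exact ⟨hinj, (LinearMap.injective_iff_surjective
    (f := (coordChange (n := n) x y).toLinearMap)).1 hinj⟩

end charts

/-! ### The warped metric and the equation of a null field -/

section metric

variable {n : ℕ} {c : SignType} {w : ℝ → ℝ}

theorem christoffel_warpedMetric {p : Flat n × ℝ} (hw : DifferentiableAt ℝ w p.2)
    (X Y Z : Flat n × ℝ) :
    christoffel (warpedMetric c w) p X Y Z = w p.2 * deriv w p.2 *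
      (X.2 * flatInner c Y.1 Z.1 + Y.2 * flatInner c X.1 Z.1 - Z.2 * flatInner c X.1 Y.1) := by
  have key : ∀ U V T : Flat n × ℝ, fderiv ℝ (fun q => warpedMetric c w q U V) p T =
      2 * w p.2 * deriv w p.2 * T.2 * flatInner c U.1 V.1 := by
    intro U V T
    have h1 : HasFDerivAt (fun q : Flat n × ℝ => w q.2)
        (deriv w p.2 • ContinuousLinearMap.snd ℝ (Flat n) ℝ) p :=
      hw.hasDerivAt.comp_hasFDerivAt p hasFDerivAt_snd
    have h2 := ((h1.pow 2).mul_const (flatInner c U.1 V.1)).sub_const (U.2 * V.2)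
    have h3 : fderiv ℝ (fun q => warpedMetric c w q U V) p = _ := h2.fderiv
    rw [h3]
    simp
    ring
  rw [christoffel, key, key, key]
  ring

theorem hasFDerivAt_flatInner {E : Type*} [NormedAddCommGroup E] [NormedSpace ℝ E]
    {u v : E → Flat n} {u' v' : E →L[ℝ] Flat n} {p : E} (hu : HasFDerivAt u u' p)
    (hv : HasFDerivAt v v' p) :
    HasFDerivAt (fun q => flatInner c (u q) (v q))
      ((flatForm c (u p)).comp v' + ((flatForm c).flip (v p)).comp u') p := by
  have h := ((flatForm c).hasFDerivAt.comp p hu).clm_apply hv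
  have e : (fun q => flatInner c (u q) (v q)) = fun q => ((flatForm c ∘ u) q) (v q) := by
    ext q
    rw [← flatForm_apply]
    rfl
  rw [e]
  refine h.congr_fderiv ?_
  ext X
  simp

theorem fderiv_flatInner_apply {E : Type*} [NormedAddCommGroup E] [NormedSpace ℝ E]
    {u v : E → Flat n} {p : E} (hu : DifferentiableAt ℝ u p)
    (hv : DifferentiableAt ℝ v p) (X : E) :
    fderiv ℝ (fun q => flatInner c (u q) (v q)) p X =
      flatInner c (fderiv ℝ u p X) (v p) + flatInner c (u p) (fderiv ℝ v p X) := by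
  rw [(hasFDerivAt_flatInner hu.hasFDerivAt hv.hasFDerivAt).fderiv]
  simp [flatForm_apply, add_comm]

/-- The covariant derivative paired with a null normal field, in terms of the derivative of the
field. -/
theorem secondDeriv_nullDir {E : Type*} [NormedAddCommGroup E] [NormedSpace ℝ E]
    {F : E → Flat n × ℝ} {N : E → Flat n} {p : E} (hF : ContDiffAt ℝ 2 F p)
    (hN : DifferentiableAt ℝ N p) (hw : DifferentiableAt ℝ w (F p).2)
    (h : ∀ᶠ q in 𝓝 p, ∀ X, w (F q).2 * flatInner c (fderiv ℝ F q X).1 (N q) =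
      (fderiv ℝ F q X).2) (X Y : E) :
    warpedMetric c w (F p) (fderiv ℝ (fderiv ℝ F) p X Y) (N p, w (F p).2) +
      christoffel (warpedMetric c w) (F p) (fderiv ℝ F p X) (fderiv ℝ F p Y) (N p, w (F p).2) =
    -(w (F p).2 ^ 2 * flatInner c (fderiv ℝ F p Y).1 (fderiv ℝ N p X) + deriv w (F p).2 *
      (w (F p).2 ^ 2 * flatInner c (fderiv ℝ F p X).1 (fderiv ℝ F p Y).1 -
        (fderiv ℝ F p X).2 * (fderiv ℝ F p Y).2)) := by
  have hF1 : HasFDerivAt F (fderiv ℝ F p) p := (hF.differentiableAt two_ne_zero).hasFDerivAt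
  have hF2 : HasFDerivAt (fderiv ℝ F) (fderiv ℝ (fderiv ℝ F) p) p :=
    ((hF.fderiv_right (m := 1) (by norm_num)).differentiableAt one_ne_zero).hasFDerivAt
  have hFY : HasFDerivAt (fun q => fderiv ℝ F q Y) ((fderiv ℝ (fderiv ℝ F) p).flip Y) p := by
    refine (hF2.clm_apply (hasFDerivAt_const Y p)).congr_fderiv ?_
    ext <;> simp
  have hw1 : HasFDerivAt (fun q => w (F q).2)
      (deriv w (F p).2 • (ContinuousLinearMap.snd ℝ (Flat n) ℝ).comp (fderiv ℝ F p)) p :=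
    hw.hasDerivAt.comp_hasFDerivAt p hF1.snd
  -- The relation `w ⟨dψ(Y), N⟩ = dτ(Y)` is differentiated in the direction `X` with `Y` constant:
  -- this trades the second derivatives of `F` for the first derivative of `N`.
  have hl := hw1.mul (hasFDerivAt_flatInner (c := c) hFY.fst hN.hasFDerivAt)
  have hr := hFY.snd
  have he : (fun q => (fderiv ℝ F q Y).2) =ᶠ[𝓝 p]
      (fun q => w (F q).2) * fun q => flatInner c (fderiv ℝ F q Y).1 (N q) :=
    h.mono fun q hq => (hq Y).symm
  have hd := DFunLike.congr_fun ((hl.congr_of_eventuallyEq he).unique hr) X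
  simp only [add_apply, smul_apply,
    ContinuousLinearMap.comp_apply, ContinuousLinearMap.flip_apply, flatForm_apply,
    ContinuousLinearMap.coe_fst', ContinuousLinearMap.coe_snd', smul_eq_mul] at hd
  have hX := h.self_of_nhds X
  rw [christoffel_warpedMetric hw, warpedMetric]
  simp only
  linear_combination w (F p).2 * hd + deriv w (F p).2 * (fderiv ℝ F p Y).2 * hX

/-- The derivative that a null normal field must have for the second fundamental form to be
collinear to it. -/
def nullShape (c : SignType) (W W' : ℝ) (p : Flat n)
    (A : EuclideanSpace ℝ (Fin n) →L[ℝ] Flat n × ℝ) (N : Flat n) :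
    EuclideanSpace ℝ (Fin n) →L[ℝ] Flat n :=
  (-W') • (ContinuousLinearMap.fst ℝ (Flat n) ℝ).comp A +
    ((ContinuousLinearMap.snd ℝ (Flat n) ℝ).comp A).smulRight ((W' / W) • N - (c / W : ℝ) • p)

theorem nullShape_apply (c : SignType) (W W' : ℝ) (p : Flat n)
    (A : EuclideanSpace ℝ (Fin n) →L[ℝ] Flat n × ℝ) (N : Flat n)
    (X : EuclideanSpace ℝ (Fin n)) : nullShape c W W' p A N X =
      (-W') • (A X).1 + (A X).2 • ((W' / W) • N - (c / W : ℝ) • p) := rfl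

/-- A vector is determined by its products with `N`, the conormal and the image of `dψ`. For `B =
dN` the first two are forced by `|N| = 1` and by tangency of `N`; the vanishing of `h` along `(N,
W)` prescribes the third. `nullShape` has all three products. -/
theorem SpacelikeAt.eq_nullShape_iff {W W' : ℝ} {p N : Flat n}
    {A : EuclideanSpace ℝ (Fin n) →L[ℝ] Flat n × ℝ} (hA : SpacelikeAt c W p A)
    (hN : IsNullDir c W p A N) {B : EuclideanSpace ℝ (Fin n) →L[ℝ] Flat n}
    (hB : ∀ X, flatInner c N (B X) = 0)
    (hBc : ∀ X, flatInner c (conormal c p) (B X) = -((c : ℝ) ^ 2 * flatInner c (A X).1 N)) :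
    (∀ X Y, W ^ 2 * flatInner c (A Y).1 (B X) +
      W' * (W ^ 2 * flatInner c (A X).1 (A Y).1 - (A X).2 * (A Y).2) = 0) ↔
      B = nullShape c W W' p A N := by
  have hW := hA.pos.ne'
  have hcA : ∀ X, (c : ℝ) * flatInner c (A X).1 p = 0 := fun X => by
    rw [flatInner_comm]
    exact flatInner_conormal_left (mem_spaceFormTangent_iff.2 (hA.tangent X))
  have hcN : (c : ℝ) * flatInner c N p = 0 := by
    rw [flatInner_comm]
    exact flatInner_conormal_left (mem_spaceFormTangent_iff.2 hN.tangent)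
  have hcp := sign_mul_flatInner_conormal hA.mem
  have hS : ∀ X Y, W ^ 2 * flatInner c (A Y).1 (nullShape c W W' p A N X) +
      W' * (W ^ 2 * flatInner c (A X).1 (A Y).1 - (A X).2 * (A Y).2) = 0 := by
    intro X Y
    simp only [nullShape_apply, flatInner_add_right, flatInner_smul_right, flatInner_sub_right,
      flatInner_comm c (A Y).1 (A X).1]
    field_simp
    linear_combination W' * (A X).2 * hN.normal Y - W * (A X).2 * hcA Y
  constructor
  · intro h
    ext1 X
    refine sub_eq_zero.1 (hA.eq_zero_of_orthogonal_nullDir hN ?_ ?_ ?_)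
    · rw [flatInner_sub_right, hBc]
      simp only [nullShape_apply, flatInner_add_right, flatInner_smul_right,
        flatInner_sub_right, hA.tangent, hN.tangent]
      rw [← hN.normal X]
      field_simp
      linear_combination flatInner c (A X).1 N * hcp
    · intro Y
      rw [flatInner_sub_right]
      have := (h X Y).trans (hS X Y).symm
      have h2 : W ^ 2 * (flatInner c (A Y).1 (B X) -
          flatInner c (A Y).1 (nullShape c W W' p A N X)) = 0 := by linarith
      simpa [hW] using h2
    · rw [flatInner_sub_right, hB]
      simp only [nullShape_apply, flatInner_add_right, flatInner_smul_right,
        flatInner_sub_right, hN.unit, flatInner_comm c N (A X).1]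
      rw [← hN.normal X]
      field_simp
      linear_combination flatInner c (A X).1 N * hcN
  · rintro rfl
    exact hS

end metric

/-! ### Differentiated constraints, and null fields from the implicit function theorem -/

section implicit

variable {n : ℕ} {c : SignType} {w : ℝ → ℝ}

theorem differentiable_conormal : Differentiable ℝ (conormal c : Flat n → Flat n) := by
  unfold conormal
  fun_prop

theorem contDiff_conormal {m : ℕ∞ω} : ContDiff ℝ m (conormal c : Flat n → Flat n) := by
  unfold conormal
  fun_prop

theorem fderiv_conormal {E : Type*} [NormedAddCommGroup E] [NormedSpace ℝ E] {u : E → Flat n}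
    {p : E} (hu : DifferentiableAt ℝ u p) (X : E) :
    fderiv ℝ (fun q => conormal c (u q)) p X = (c : ℝ) ^ 2 • fderiv ℝ u p X := by
  unfold conormal
  rw [fderiv_add_const, fderiv_fun_const_smul hu]
  rfl

/-- For `c ≠ 0` this is the derivative of `⟨u, u⟩ = c`; for `c = 0`, that of the vanishing last
coordinate. -/
theorem flatInner_conormal_fderiv {E : Type*} [NormedAddCommGroup E] [NormedSpace ℝ E]
    {u : E → Flat n} {p : E} (hu : DifferentiableAt ℝ u p)
    (h : ∀ᶠ q in 𝓝 p, u q ∈ spaceForm n c) (X : E) :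
    flatInner c (conormal c (u p)) (fderiv ℝ u p X) = 0 := by
  by_cases hc : c = 0
  · subst hc
    have h1 : (fun q => (u q).2) =ᶠ[𝓝 p] fun _ => (0 : ℝ) := h.mono fun q hq => hq
    have h2 := hu.hasFDerivAt.snd.fderiv
    rw [h1.fderiv_eq, fderiv_fun_const] at h2
    have h3 := DFunLike.congr_fun h2 X
    simpa [conormal, flatInner_eq, lastSign, eq_comm] using h3
  · have h1 : (fun q => flatInner c (u q) (u q)) =ᶠ[𝓝 p] fun _ => (c : ℝ) := by
      filter_upwards [h] with q hq
      have := sign_mul_flatInner_self hq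
      have hc' : (c : ℝ) ≠ 0 := by cases c <;> simp_all
      refine mul_left_cancel₀ hc' ?_
      rw [this, sq]
    have h2 := fderiv_flatInner_apply (c := c) hu hu X
    rw [h1.fderiv_eq, fderiv_fun_const, flatInner_comm] at h2
    have h3 : (c : ℝ) ^ 2 = 1 := by cases c <;> simp_all
    rw [conormal, h3, sub_self, zero_smul, add_zero, one_smul]
    simp only [Pi.zero_apply, zero_apply] at h2
    linarith

theorem flatInner_conormal_fderiv_nullDir {E : Type*} [NormedAddCommGroup E] [NormedSpace ℝ E]
    {u N : E → Flat n} {p : E} (hu : DifferentiableAt ℝ u p) (hN : DifferentiableAt ℝ N p)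
    (h : ∀ᶠ q in 𝓝 p, flatInner c (conormal c (u q)) (N q) = 0) (X : E) :
    flatInner c (conormal c (u p)) (fderiv ℝ N p X) =
      -((c : ℝ) ^ 2 * flatInner c (fderiv ℝ u p X) (N p)) := by
  have h1 : (fun q => flatInner c (conormal c (u q)) (N q)) =ᶠ[𝓝 p] fun _ => (0 : ℝ) := h
  have h2 := fderiv_flatInner_apply (c := c) (u := fun q => conormal c (u q))
    (differentiable_conormal.differentiableAt.comp p hu) hN X
  rw [h1.fderiv_eq, fderiv_fun_const, fderiv_conormal hu, flatInner_smul_left] at h2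
  simp only [Pi.zero_apply, zero_apply] at h2
  linarith

theorem flatInner_fderiv_unit {E : Type*} [NormedAddCommGroup E] [NormedSpace ℝ E]
    {N : E → Flat n} {p : E} (hN : DifferentiableAt ℝ N p)
    (h : ∀ᶠ q in 𝓝 p, flatInner c (N q) (N q) = 1) (X : E) :
    flatInner c (N p) (fderiv ℝ N p X) = 0 := by
  have h1 : (fun q => flatInner c (N q) (N q)) =ᶠ[𝓝 p] fun _ => (1 : ℝ) := h
  have h2 := fderiv_flatInner_apply (c := c) hN hN X
  rw [h1.fderiv_eq, fderiv_fun_const, flatInner_comm] at h2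
  simp only [Pi.zero_apply, zero_apply] at h2
  linarith

theorem contDiffAt_flatInner {E : Type*} [NormedAddCommGroup E] [NormedSpace ℝ E]
    {u v : E → Flat n} {p : E} {m : ℕ∞ω} (hu : ContDiffAt ℝ m u p) (hv : ContDiffAt ℝ m v p) :
    ContDiffAt ℝ m (fun q => flatInner c (u q) (v q)) p := by
  simp only [← flatForm_apply]
  fun_prop

/-- The equations of a null normal direction. -/
def nullEquation (c : SignType) (W : ℝ) (p : Flat n)
    (A : EuclideanSpace ℝ (Fin n) →L[ℝ] Flat n × ℝ) (v : Flat n) :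
    (EuclideanSpace ℝ (Fin n) →L[ℝ] ℝ) × ℝ × ℝ :=
  (W • ((flatForm c).flip v ∘L (.fst ℝ (Flat n) ℝ ∘L A)) - .snd ℝ (Flat n) ℝ ∘L A,
    flatInner c (conormal c p) v, flatInner c v v)

theorem nullEquation_iff {W : ℝ} {p N : Flat n}
    {A : EuclideanSpace ℝ (Fin n) →L[ℝ] Flat n × ℝ} :
    nullEquation c W p A N = (0, 0, 1) ↔ IsNullDir c W p A N := by
  simp only [nullEquation, Prod.mk.injEq]
  constructor
  · rintro ⟨h1, h2, h3⟩
    refine ⟨h2, h3, fun X => ?_⟩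
    have := DFunLike.congr_fun h1 X
    simpa [flatForm_apply, sub_eq_zero] using this
  · rintro ⟨h1, h2, h3⟩
    refine ⟨?_, h1, h2⟩
    ext1 X
    simpa [flatForm_apply, sub_eq_zero] using h3 X

/-- The three components exhibit the kernel, when `W ≠ 0`, as the vectors orthogonal to the image of
`dψ`, to the conormal and to `N`, which is trivial at a spacelike point. -/
theorem hasFDerivAt_nullEquation (W : ℝ) (p N : Flat n)
    (A : EuclideanSpace ℝ (Fin n) →L[ℝ] Flat n × ℝ) :
    ∃ L : Flat n →L[ℝ] (EuclideanSpace ℝ (Fin n) →L[ℝ] ℝ) × ℝ × ℝ,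
      HasFDerivAt (nullEquation c W p A) L N ∧
      ∀ v, (∀ X, (L v).1 X = W * flatInner c (A X).1 v) ∧
        (L v).2.1 = flatInner c (conormal c p) v ∧ (L v).2.2 = 2 * flatInner c N v := by
  have hdiff : ∀ v, DifferentiableAt ℝ (fun v : Flat n =>
      W • ((flatForm c).flip v ∘L (.fst ℝ (Flat n) ℝ ∘L A)) - .snd ℝ (Flat n) ℝ ∘L A) v := by
    intro v
    fun_prop
  have hu : DifferentiableAt ℝ (fun v : Flat n => v) N := differentiableAt_id
  have hk : DifferentiableAt ℝ (fun _ : Flat n => conormal c p) N := differentiableAt_const _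
  refine ⟨_, ((hdiff N).hasFDerivAt.prodMk ((hasFDerivAt_flatInner hk.hasFDerivAt
    hu.hasFDerivAt).prodMk (hasFDerivAt_flatInner hu.hasFDerivAt hu.hasFDerivAt))),
    fun v => ⟨fun X => ?_, ?_, ?_⟩⟩
  · have h1 : HasFDerivAt (fun v : Flat n =>
        (W • ((flatForm c).flip v ∘L (.fst ℝ (Flat n) ℝ ∘L A)) - .snd ℝ (Flat n) ℝ ∘L A) X)
        (W • flatForm c (A X).1) N := by
      have := ((flatForm c (A X).1).hasFDerivAt (x := N)).const_smul W |>.sub_const (A X).2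
      simpa using this
    have h2 := (hdiff N).hasFDerivAt.clm_apply (hasFDerivAt_const X N)
    have h3 := DFunLike.congr_fun (h2.unique h1) v
    simpa [flatForm_apply] using h3
  · simp [flatForm_apply]
  · simp [flatForm_apply, flatInner_comm c v N]
    ring

/-- Null directions solve `n + 2` equations in `n + 2` unknowns with invertible derivative in the
unknowns. The coefficients involve `dF`, hence are only `C¹`. The uniqueness clause says that every
continuous branch of null directions through `N₀` is the `C¹` one. -/
theorem SpacelikeAt.exists_nullField {F : EuclideanSpace ℝ (Fin n) → Flat n × ℝ}
    {p : EuclideanSpace ℝ (Fin n)} (hF : ContDiffAt ℝ 2 F p) (hw : ContDiffAt ℝ 1 w (F p).2)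
    (hA : SpacelikeAt c (w (F p).2) (F p).1 (fderiv ℝ F p)) {N₀ : Flat n}
    (hN : IsNullDir c (w (F p).2) (F p).1 (fderiv ℝ F p) N₀) :
    ∃ N : EuclideanSpace ℝ (Fin n) → Flat n, ContDiffAt ℝ 1 N p ∧ N p = N₀ ∧
      (∀ᶠ q in 𝓝 p, IsNullDir c (w (F q).2) (F q).1 (fderiv ℝ F q) (N q)) ∧
      ∀ N' : EuclideanSpace ℝ (Fin n) → Flat n, ContinuousAt N' p → N' p = N₀ →
        (∀ᶠ q in 𝓝 p, IsNullDir c (w (F q).2) (F q).1 (fderiv ℝ F q) (N' q)) →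
        N' =ᶠ[𝓝 p] N := by
  let Φ : EuclideanSpace ℝ (Fin n) × Flat n → (EuclideanSpace ℝ (Fin n) →L[ℝ] ℝ) × ℝ × ℝ :=
    fun u => nullEquation c (w (F u.1).2) (F u.1).1 (fderiv ℝ F u.1) u.2
  have hΦ : ContDiffAt ℝ 1 Φ (p, N₀) := by
    have hF1 : ContDiffAt ℝ 1 (fun u : EuclideanSpace ℝ (Fin n) × Flat n => F u.1) (p, N₀) :=
      (hF.of_le one_le_two).comp (p, N₀) contDiffAt_fst
    have hF2 : ContDiffAt ℝ 1 (fun u : EuclideanSpace ℝ (Fin n) × Flat n => fderiv ℝ F u.1)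
        (p, N₀) :=
      (hF.fderiv_right (m := 1) (by norm_num)).comp (p, N₀) contDiffAt_fst
    have hw1 : ContDiffAt ℝ 1 (fun u : EuclideanSpace ℝ (Fin n) × Flat n => w (F u.1).2)
        (p, N₀) := ContDiffAt.comp (p, N₀) (g := w) hw hF1.snd
    refine ContDiffAt.prodMk ?_ (ContDiffAt.prodMk ?_ ?_)
    · refine (hw1.smul (ContDiffAt.clm_comp ?_ (contDiffAt_const.clm_comp hF2))).sub
        (contDiffAt_const.clm_comp hF2)
      fun_prop
    · exact contDiffAt_flatInner (contDiff_conormal.contDiffAt.comp (p, N₀) hF1.fst) contDiffAt_snd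
    · exact contDiffAt_flatInner contDiffAt_snd contDiffAt_snd
  obtain ⟨L, hL, hLv⟩ := hasFDerivAt_nullEquation (c := c) (w (F p).2) (F p).1 N₀ (fderiv ℝ F p)
  have hLΦ : fderiv ℝ Φ (p, N₀) ∘L .inr ℝ (EuclideanSpace ℝ (Fin n)) (Flat n) = L := by
    refine HasFDerivAt.unique (f := fun v => Φ (p, v)) (x := N₀) ?_ hL
    exact HasFDerivAt.comp N₀ (g := Φ) (hΦ.differentiableAt one_ne_zero).hasFDerivAt
      (hasFDerivAt_prodMk_right p N₀)
  have hinv : (fderiv ℝ Φ (p, N₀) ∘L .inr ℝ _ _).IsInvertible := by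
    rw [hLΦ]
    have hinj : Function.Injective L.toLinearMap := by
      rw [injective_iff_map_eq_zero]
      intro v hv
      have hv' : L v = 0 := hv
      obtain ⟨h1, h2, h3⟩ := hLv v
      rw [hv'] at h1 h2 h3
      have hW := hA.pos.ne'
      refine hA.eq_zero_of_orthogonal_nullDir hN h2.symm (fun X => ?_) ?_
      · simpa [hW] using (h1 X).symm
      · simpa using h3.symm
    have hdim : Module.finrank ℝ (Flat n) =
        Module.finrank ℝ ((EuclideanSpace ℝ (Fin n) →L[ℝ] ℝ) × ℝ × ℝ) := by
      rw [Module.finrank_prod, Module.finrank_prod, ← (LinearMap.toContinuousLinearMap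
        (𝕜 := ℝ) (E := EuclideanSpace ℝ (Fin n)) (F' := ℝ)).finrank_eq]
      simp
    let e := (LinearEquiv.ofInjectiveOfFinrankEq L.toLinearMap hinj hdim).toContinuousLinearEquiv
    exact ⟨e, ContinuousLinearMap.ext fun v => rfl⟩
  have hval : Φ (p, N₀) = (0, 0, 1) := nullEquation_iff.2 hN
  have hself := hΦ.implicitFunction_apply_self one_ne_zero hinv
  refine ⟨hΦ.implicitFunction one_ne_zero hinv, hΦ.contDiffAt_implicitFunction one_ne_zero hinv,
    hself, ?_, fun N' hN'c hN'0 hN' => ?_⟩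
  · filter_upwards [hΦ.eventually_apply_implicitFunction one_ne_zero hinv] with q hq
    exact nullEquation_iff.1 (hq.trans hval)
  · have ht : Filter.Tendsto (fun q => (q, N' q)) (𝓝 p) (𝓝 (p, N₀)) := by
      have := (continuousAt_id (x := p)).prodMk hN'c
      rw [← hN'0]
      exact this
    filter_upwards [ht.eventually (hΦ.eventually_apply_eq_iff_implicitFunction one_ne_zero hinv),
      hN'] with q hq hq'
    exact (hq.1 ((nullEquation_iff.2 hq').trans hval.symm)).symm

end implicit

/-- `w` is a smooth positive function on the open set `I`. -/
structure IsWarping (I : Set ℝ) (w : ℝ → ℝ) : Prop where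
  isOpen : IsOpen I
  contDiffOn : ContDiffOn ℝ ∞ w I
  pos : ∀ t ∈ I, 0 < w t

theorem IsWarping.contDiffAt {I : Set ℝ} {w : ℝ → ℝ} (hI : IsWarping I w) {t : ℝ} (ht : t ∈ I) :
    ContDiffAt ℝ ∞ w t := hI.contDiffOn.contDiffAt (hI.isOpen.mem_nhds ht)

theorem IsWarping.differentiableAt {I : Set ℝ} {w : ℝ → ℝ} (hI : IsWarping I w) {t : ℝ}
    (ht : t ∈ I) : DifferentiableAt ℝ w t := (hI.contDiffAt ht).differentiableAt (by simp)

theorem IsWarping.contDiffAt_deriv {I : Set ℝ} {w : ℝ → ℝ} (hI : IsWarping I w) {t : ℝ}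
    (ht : t ∈ I) : ContDiffAt ℝ ∞ (deriv w) t :=
  (contDiffOn_infty_iff_deriv_of_isOpen hI.isOpen |>.1 hI.contDiffOn).2.contDiffAt
    (hI.isOpen.mem_nhds ht)

/-! ### Invariance under linear changes of coordinates -/

section comp

variable {n : ℕ} {c : SignType} {W W' : ℝ} {p N : Flat n}
  {A : EuclideanSpace ℝ (Fin n) →L[ℝ] Flat n × ℝ}
  {L : EuclideanSpace ℝ (Fin n) →L[ℝ] EuclideanSpace ℝ (Fin n)}

theorem isNullDir_comp_iff (hL : Function.Bijective L) :
    IsNullDir c W p (A.comp L) N ↔ IsNullDir c W p A N := by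
  refine ⟨fun h => ⟨h.tangent, h.unit, fun X => ?_⟩, fun h => ⟨h.tangent, h.unit, fun X => ?_⟩⟩
  · obtain ⟨Y, rfl⟩ := hL.2 X
    exact h.normal Y
  · exact h.normal (L X)

theorem comp_eq_nullShape_comp_iff {B : EuclideanSpace ℝ (Fin n) →L[ℝ] Flat n}
    (hL : Function.Bijective L) :
    B.comp L = nullShape c W W' p (A.comp L) N ↔ B = nullShape c W W' p A N := by
  have h1 : nullShape c W W' p (A.comp L) N = (nullShape c W W' p A N).comp L := rfl
  rw [h1]
  refine ⟨fun h => ?_, fun h => by rw [h]⟩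
  ext1 X
  obtain ⟨Y, rfl⟩ := hL.2 X
  exact DFunLike.congr_fun h Y

end comp

/-! ### Null normal fields on the manifold -/

section field

variable {n : ℕ} {M : Type*} [TopologicalSpace M] [ChartedSpace (EuclideanSpace ℝ (Fin n)) M]
  {c : SignType} {I : Set ℝ} {w : ℝ → ℝ} {f : M → Flat n × ℝ} {N : M → Flat n}

/-- The value at `x` of the second fundamental form of `f` is orthogonal to the null normal vector
`(N, w)`. -/
def NullAlong (c : SignType) (w : ℝ → ℝ) (f : M → Flat n × ℝ) (x : M) (N : Flat n) : Prop :=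
  ∀ X Y : EuclideanSpace ℝ (Fin n),
    covDerivInner (warpedMetric c w) f x X Y (N, w (f x).2) = 0

/-- Near `x`, `(N, w)` is a `C¹` null normal field of `f`. -/
structure NullFieldAt (c : SignType) (w : ℝ → ℝ) (f : M → Flat n × ℝ) (N : M → Flat n) (x : M) :
    Prop where
  contMDiffAt : ContMDiffAt 𝓘(ℝ, EuclideanSpace ℝ (Fin n)) 𝓘(ℝ, Flat n) 1 N x
  isNullDir : ∀ᶠ y in 𝓝 x, IsNullDir c (w (f y).2) (f y).1 (D1 f y) (N y)

theorem eventually_inChart {P : M → Prop} {x y : M}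
    (hy : y ∈ (chartAt (EuclideanSpace ℝ (Fin n)) x).source) :
    (∀ᶠ z in 𝓝 y, P z) ↔ ∀ᶠ q in 𝓝 (chartAt (EuclideanSpace ℝ (Fin n)) x y),
      P ((chartAt (EuclideanSpace ℝ (Fin n)) x).symm q) :=
  ((chartAt (EuclideanSpace ℝ (Fin n)) x).eventually_nhds' P hy).symm

theorem eventually_mem_target {x y : M}
    (hy : y ∈ (chartAt (EuclideanSpace ℝ (Fin n)) x).source) :
    ∀ᶠ q in 𝓝 (chartAt (EuclideanSpace ℝ (Fin n)) x y),
      q ∈ (chartAt (EuclideanSpace ℝ (Fin n)) x).target :=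
  (chartAt (EuclideanSpace ℝ (Fin n)) x).open_target.mem_nhds
    ((chartAt (EuclideanSpace ℝ (Fin n)) x).map_source hy)

theorem eventually_mem_source {x y : M}
    (hy : y ∈ (chartAt (EuclideanSpace ℝ (Fin n)) x).source) :
    ∀ᶠ z in 𝓝 y, z ∈ (chartAt (EuclideanSpace ℝ (Fin n)) x).source :=
  (chartAt (EuclideanSpace ℝ (Fin n)) x).open_source.mem_nhds hy

variable [IsManifold 𝓘(ℝ, EuclideanSpace ℝ (Fin n)) 2 M]

theorem NullFieldAt.eventually {x : M} (h : NullFieldAt c w f N x) :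
    ∀ᶠ y in 𝓝 x, NullFieldAt c w f N y := by
  have : IsManifold 𝓘(ℝ, EuclideanSpace ℝ (Fin n)) 1 M := IsManifold.of_le one_le_two
  filter_upwards [(contMDiffAt_iff_contMDiffAt_nhds (by simp)).1 h.contMDiffAt, h.isNullDir.eventually_nhds] with y h1 h2
  exact ⟨h1, h2⟩

theorem IsSpacelikeImmersion.contDiffAt (hf : IsSpacelikeImmersion c I w f) {x y : M}
    (hy : y ∈ (chartAt (EuclideanSpace ℝ (Fin n)) x).source) :
    ContDiffAt ℝ 2 (inChart (n := n) f x) (chartAt (EuclideanSpace ℝ (Fin n)) x y) :=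
  (contMDiffAt_iff_inChart le_rfl hy).1 hf.contMDiff.contMDiffAt

theorem IsSpacelikeImmersion.D1_eq (hf : IsSpacelikeImmersion c I w f) {x y : M}
    (hy : y ∈ (chartAt (EuclideanSpace ℝ (Fin n)) x).source) :
    D1 (n := n) f y = (fderiv ℝ (inChart (n := n) f x)
      (chartAt (EuclideanSpace ℝ (Fin n)) x y)).comp (coordChange x y) :=
  D1_eq_comp_coordChange hy ((hf.contDiffAt hy).differentiableAt two_ne_zero)

theorem NullFieldAt.contDiffAt {x y : M} (h : NullFieldAt c w f N y)
    (hy : y ∈ (chartAt (EuclideanSpace ℝ (Fin n)) x).source) :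
    ContDiffAt ℝ 1 (inChart (n := n) N x) (chartAt (EuclideanSpace ℝ (Fin n)) x y) :=
  (contMDiffAt_iff_inChart one_le_two hy).1 h.contMDiffAt

theorem NullFieldAt.D1_eq {x y : M} (h : NullFieldAt c w f N y)
    (hy : y ∈ (chartAt (EuclideanSpace ℝ (Fin n)) x).source) :
    D1 (n := n) N y = (fderiv ℝ (inChart (n := n) N x)
      (chartAt (EuclideanSpace ℝ (Fin n)) x y)).comp (coordChange x y) :=
  D1_eq_comp_coordChange hy ((h.contDiffAt hy).differentiableAt one_ne_zero)

theorem IsSpacelikeImmersion.spacelikeAt (hf : IsSpacelikeImmersion c I w f)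
    (hI : IsWarping I w) (x : M) :
    SpacelikeAt c (w (f x).2) (f x).1 (D1 f x) where
  mem := hf.mem_spaceForm x
  pos := hI.pos _ (hf.mem_interval x)
  tangent X := by
    have hx := mem_chart_source (EuclideanSpace ℝ (Fin n)) x
    have hd := (hf.contDiffAt hx).differentiableAt two_ne_zero
    have h1 := flatInner_conormal_fderiv (c := c) hd.fst
      (Filter.Eventually.of_forall fun q => hf.mem_spaceForm _) X
    rw [hd.hasFDerivAt.fst.fderiv, inChart_apply _ hx] at h1
    exact h1
  spacelike X hX := hf.spacelike x X hX

theorem IsSpacelikeImmersion.isNullDir_iff (hf : IsSpacelikeImmersion c I w f) {x y : M}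
    (hy : y ∈ (chartAt (EuclideanSpace ℝ (Fin n)) x).source) {v : Flat n} :
    IsNullDir c (w (f y).2) (f y).1 (D1 f y) v ↔ IsNullDir c (w (f y).2) (f y).1
      (fderiv ℝ (inChart (n := n) f x) (chartAt (EuclideanSpace ℝ (Fin n)) x y)) v := by
  rw [hf.D1_eq hy, isNullDir_comp_iff (coordChange_bijective hy)]

theorem IsSpacelikeImmersion.eventually_isNullDir_iff (hf : IsSpacelikeImmersion c I w f)
    {x y : M} (hy : y ∈ (chartAt (EuclideanSpace ℝ (Fin n)) x).source) :
    (∀ᶠ z in 𝓝 y, IsNullDir c (w (f z).2) (f z).1 (D1 f z) (N z)) ↔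
      ∀ᶠ q in 𝓝 (chartAt (EuclideanSpace ℝ (Fin n)) x y),
        IsNullDir c (w (inChart (n := n) f x q).2) (inChart (n := n) f x q).1
          (fderiv ℝ (inChart (n := n) f x) q) (inChart (n := n) N x q) := by
  rw [eventually_inChart hy]
  refine Filter.eventually_congr ?_
  filter_upwards [eventually_mem_target hy] with q hq
  rw [hf.isNullDir_iff ((chartAt _ x).map_target hq), OpenPartialHomeomorph.right_inv _ hq]
  rfl

/-- The derivative of a null normal field decides whether the second fundamental form is collinear
to it. -/
theorem NullFieldAt.nullAlong_iff {x : M} (h : NullFieldAt c w f N x)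
    (hf : IsSpacelikeImmersion c I w f) (hI : IsWarping I w) :
    NullAlong c w f x (N x) ↔
      D1 N x = nullShape c (w (f x).2) (deriv w (f x).2) (f x).1 (D1 f x) (N x) := by
  have hx := mem_chart_source (EuclideanSpace ℝ (Fin n)) x
  have hF := hf.contDiffAt hx
  have hFd := hF.differentiableAt two_ne_zero
  have hN := (h.contDiffAt hx).differentiableAt one_ne_zero
  have hnull := (hf.eventually_isNullDir_iff hx).1 h.isNullDir
  have eF := inChart_apply (n := n) f hx
  have eN := inChart_apply (n := n) N hx
  have hB := flatInner_fderiv_unit hN (hnull.mono fun q hq => hq.unit)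
  have hBc := flatInner_conormal_fderiv_nullDir hFd.fst hN (hnull.mono fun q hq => hq.tangent)
  have hsd := secondDeriv_nullDir hF hN
    (by rw [eF]; exact hI.differentiableAt (hf.mem_interval x))
    (hnull.mono fun q hq => hq.normal)
  rw [hFd.hasFDerivAt.fst.fderiv] at hBc
  rw [eN] at hB
  rw [eF, eN] at hBc hsd
  refine Iff.trans ?_ ((hf.spacelikeAt hI x).eq_nullShape_iff (W' := deriv w (f x).2)
    h.isNullDir.self_of_nhds hB hBc)
  refine forall₂_congr fun X Y => ?_
  rw [covDerivInner, D2, D1, hsd, neg_eq_zero]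
  rfl

/-- Both sides are now read in the fixed chart at `x`, so they depend continuously on `y`. -/
theorem NullFieldAt.nullAlong_iff_inChart {x y : M} (h : NullFieldAt c w f N y)
    (hf : IsSpacelikeImmersion c I w f) (hI : IsWarping I w)
    (hy : y ∈ (chartAt (EuclideanSpace ℝ (Fin n)) x).source) :
    NullAlong c w f y (N y) ↔
      fderiv ℝ (inChart (n := n) N x) (chartAt (EuclideanSpace ℝ (Fin n)) x y) =
        nullShape c (w (f y).2) (deriv w (f y).2) (f y).1
          (fderiv ℝ (inChart (n := n) f x) (chartAt (EuclideanSpace ℝ (Fin n)) x y)) (N y) := by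
  rw [h.nullAlong_iff hf hI, h.D1_eq hy, hf.D1_eq hy,
    comp_eq_nullShape_comp_iff (coordChange_bijective hy)]

theorem contDiffAt_nullShape {E : Type*} [NormedAddCommGroup E] [NormedSpace ℝ E]
    {W W' : E → ℝ} {P V : E → Flat n} {A : E → EuclideanSpace ℝ (Fin n) →L[ℝ] Flat n × ℝ}
    {m : ℕ∞ω} {p : E} (hW : ContDiffAt ℝ m W p) (hW' : ContDiffAt ℝ m W' p)
    (hP : ContDiffAt ℝ m P p) (hA : ContDiffAt ℝ m A p) (hV : ContDiffAt ℝ m V p)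
    (h0 : W p ≠ 0) :
    ContDiffAt ℝ m (fun q => nullShape c (W q) (W' q) (P q) (A q) (V q)) p := by
  unfold nullShape
  refine (hW'.neg.smul (contDiffAt_const.clm_comp hA)).add ?_
  exact ContDiffAt.smulRight (contDiffAt_const.clm_comp hA)
    (((hW'.div hW h0).smul hV).sub ((contDiffAt_const.div hW h0).smul hP))

theorem IsSpacelikeImmersion.contDiffAt_nullShape_inChart (hf : IsSpacelikeImmersion c I w f)
    (hI : IsWarping I w) {x y : M} (hy : y ∈ (chartAt (EuclideanSpace ℝ (Fin n)) x).source)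
    (h : NullFieldAt c w f N y) :
    ContDiffAt ℝ 1 (fun q => nullShape c (w (inChart (n := n) f x q).2)
      (deriv w (inChart (n := n) f x q).2) (inChart (n := n) f x q).1
      (fderiv ℝ (inChart (n := n) f x) q) (inChart (n := n) N x q))
      (chartAt (EuclideanSpace ℝ (Fin n)) x y) := by
  have hF := hf.contDiffAt hy
  have hF1 := hF.of_le (one_le_two (α := ℕ∞ω))
  have eF := inChart_apply (n := n) f hy
  have hmem : (inChart (n := n) f x (chartAt (EuclideanSpace ℝ (Fin n)) x y)).2 ∈ I := by
    rw [eF]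
    exact hf.mem_interval y
  refine contDiffAt_nullShape ?_ ?_ hF1.fst (hF.fderiv_right (m := 1) (by norm_num))
    (h.contDiffAt hy) (hI.pos _ hmem).ne'
  · exact ((hI.contDiffAt hmem).of_le (by simp)).comp
      (g := w) (chartAt (EuclideanSpace ℝ (Fin n)) x y) hF1.snd
  · exact ((hI.contDiffAt_deriv hmem).of_le (by simp)).comp
      (g := deriv w) (chartAt (EuclideanSpace ℝ (Fin n)) x y) hF1.snd

/-- Collinearity is an equality of two maps continuous in a fixed chart, so its failure is open. The
density statement and the choice of sign at constant height rest on this. -/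
theorem NullFieldAt.eventually_not_nullAlong {x : M} (h : NullFieldAt c w f N x)
    (hf : IsSpacelikeImmersion c I w f) (hI : IsWarping I w)
    (hx : ¬ NullAlong c w f x (N x)) : ∀ᶠ y in 𝓝 x, ¬ NullAlong c w f y (N y) := by
  have hxs := mem_chart_source (EuclideanSpace ℝ (Fin n)) x
  rw [h.nullAlong_iff_inChart hf hI hxs] at hx
  have hc1 := ((h.contDiffAt hxs).fderiv_right (m := 0) (by norm_num)).continuousAt
  have hc2 := (hf.contDiffAt_nullShape_inChart hI hxs h).continuousAt
  have hne := hc1.ne_iff_eventually_ne hc2 |>.1 (by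
    rw [inChart_apply f hxs, inChart_apply N hxs]
    exact hx)
  have h1 := ((chartAt (EuclideanSpace ℝ (Fin n)) x).continuousAt hxs).eventually hne
  filter_upwards [h1, h.eventually, eventually_mem_source hxs] with y hy1 hy2 hy3
  rw [hy2.nullAlong_iff_inChart hf hI hy3]
  rwa [inChart_apply f hy3, inChart_apply N hy3] at hy1

theorem IsSpacelikeImmersion.exists_nullFieldAt (hf : IsSpacelikeImmersion c I w f)
    (hI : IsWarping I w) {x : M} {v : Flat n} (hv : IsNullDir c (w (f x).2) (f x).1 (D1 f x) v) :
    ∃ N : M → Flat n, NullFieldAt c w f N x ∧ N x = v ∧ ∀ N' : M → Flat n, ContinuousAt N' x →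
      N' x = v → (∀ᶠ y in 𝓝 x, IsNullDir c (w (f y).2) (f y).1 (D1 f y) (N' y)) →
      N' =ᶠ[𝓝 x] N := by
  have hx := mem_chart_source (EuclideanSpace ℝ (Fin n)) x
  have eF := inChart_apply (n := n) f hx
  have hF := hf.contDiffAt hx
  have hw : ContDiffAt ℝ 1 w (inChart (n := n) f x (chartAt _ x x)).2 := by
    rw [eF]
    exact (hI.contDiffAt (hf.mem_interval x)).of_le (by simp)
  obtain ⟨N, hN1, hN2, hN3, hN4⟩ := SpacelikeAt.exists_nullField (c := c) hF hw
    (by rw [eF]; exact hf.spacelikeAt hI x) (N₀ := v) (by rw [eF]; exact hv)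
  have hco : inChart (n := n) (N ∘ chartAt (EuclideanSpace ℝ (Fin n)) x) x
      =ᶠ[𝓝 (chartAt (EuclideanSpace ℝ (Fin n)) x x)] N := by
    filter_upwards [eventually_mem_target hx] with q hq
    simp [inChart, OpenPartialHomeomorph.right_inv _ hq]
  refine ⟨N ∘ chartAt (EuclideanSpace ℝ (Fin n)) x, ⟨?_, ?_⟩, hN2, fun N' h1 h2 h3 => ?_⟩
  · exact (contMDiffAt_iff_inChart one_le_two hx).2 (hN1.congr_of_eventuallyEq hco)
  · rw [hf.eventually_isNullDir_iff hx]
    filter_upwards [hN3, hco] with q h1 h2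
    rwa [h2]
  · rw [hf.eventually_isNullDir_iff hx] at h3
    have hcont : ContinuousAt (inChart (n := n) N' x)
        (chartAt (EuclideanSpace ℝ (Fin n)) x x) := by
      refine ContinuousAt.comp ?_ ((chartAt _ x).continuousAt_symm (mem_chart_target _ x))
      rwa [OpenPartialHomeomorph.left_inv _ hx]
    have h4 := hN4 _ hcont ((inChart_apply N' hx).trans h2) h3
    have h5 := ((chartAt (EuclideanSpace ℝ (Fin n)) x).continuousAt hx).eventually h4
    filter_upwards [h5, eventually_mem_source hx] with y hy hy'
    rw [inChart_apply N' hy'] at hy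
    exact hy

/-- Uniqueness in the implicit function theorem identifies a continuous field of null directions
with the `C¹` branch through its value at `x`. -/
theorem IsSpacelikeImmersion.nullFieldAt_of_continuousAt (hf : IsSpacelikeImmersion c I w f)
    (hI : IsWarping I w) {x : M} (hN : ContinuousAt N x)
    (h : ∀ᶠ y in 𝓝 x, IsNullDir c (w (f y).2) (f y).1 (D1 f y) (N y)) :
    NullFieldAt c w f N x := by
  obtain ⟨N₁, h1, -, h3⟩ := hf.exists_nullFieldAt hI h.self_of_nhds
  exact ⟨h1.contMDiffAt.congr_of_eventuallyEq (h3 N hN rfl h), h⟩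

end field

/-- A group is not the union of two proper subgroups: if `a u ≠ 0` and `b v ≠ 0`, then `u + v` lies
in neither kernel. -/
theorem eq_zero_or_eq_zero_of_forall {V G H : Type*} [AddGroup V] [AddGroup G] [AddGroup H]
    {a : V →+ G} {b : V →+ H} (h : ∀ v, a v = 0 ∨ b v = 0) :
    (∀ v, a v = 0) ∨ ∀ v, b v = 0 := by
  by_contra! hc
  obtain ⟨⟨u, hu⟩, v, hv⟩ := hc
  have hbu := (h u).resolve_left hu
  have hav := (h v).resolve_right hv
  rcases h (u + v) with h1 | h1
  · rw [map_add, hav, add_zero] at h1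
    exact hu h1
  · rw [map_add, hbu, zero_add] at h1
    exact hv h1

/-! ### The second fundamental form and its null directions -/

section secondFF

variable {n : ℕ} {M : Type*} [TopologicalSpace M] [ChartedSpace (EuclideanSpace ℝ (Fin n)) M]
  {c : SignType} {w : ℝ → ℝ} {f : M → Flat n × ℝ} {x : M}

theorem covDerivInner_warpedMetric (hw : DifferentiableAt ℝ w (f x).2)
    (X Y : EuclideanSpace ℝ (Fin n)) (Z : Flat n × ℝ) :
    covDerivInner (warpedMetric c w) f x X Y Z =
      w (f x).2 ^ 2 * flatInner c (D2 f x X Y).1 Z.1 - (D2 f x X Y).2 * Z.2 +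
      w (f x).2 * deriv w (f x).2 * ((D1 f x X).2 * flatInner c (D1 f x Y).1 Z.1 +
        (D1 f x Y).2 * flatInner c (D1 f x X).1 Z.1 -
        Z.2 * flatInner c (D1 f x X).1 (D1 f x Y).1) := by
  rw [covDerivInner, christoffel_warpedMetric hw]
  rfl

/-- The covariant derivative of `f` paired with a fixed vector, as a bilinear form. -/
def covDerivForm (c : SignType) (w : ℝ → ℝ) (f : M → Flat n × ℝ) (x : M)
    (hw : DifferentiableAt ℝ w (f x).2) (Z : Flat n × ℝ) :
    EuclideanSpace ℝ (Fin n) →ₗ[ℝ] EuclideanSpace ℝ (Fin n) →ₗ[ℝ] ℝ :=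
  LinearMap.mk₂ ℝ (fun X Y => covDerivInner (warpedMetric c w) f x X Y Z)
    (fun X X' Y => by
      simp only [covDerivInner_warpedMetric hw, map_add, add_apply, Prod.fst_add, Prod.snd_add,
        flatInner_add_left]
      ring)
    (fun a X Y => by
      simp only [covDerivInner_warpedMetric hw, map_smul, smul_apply, Prod.smul_fst,
        Prod.smul_snd, flatInner_smul_left, smul_eq_mul]
      ring)
    (fun X Y Y' => by
      simp only [covDerivInner_warpedMetric hw, map_add, Prod.fst_add, Prod.snd_add,
        flatInner_add_left, flatInner_add_right]
      ring)
    (fun a X Y => by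
      simp only [covDerivInner_warpedMetric hw, map_smul, Prod.smul_fst,
        Prod.smul_snd, flatInner_smul_left, flatInner_smul_right, smul_eq_mul]
      ring)

/-- The lemma on two kernels is applied in `Y` for each fixed `X`, then in `X`: a choice made pair
by pair becomes a single choice. -/
theorem nullAlong_or_of_forall (hw : DifferentiableAt ℝ w (f x).2) {N₁ N₂ : Flat n}
    (h : ∀ X Y : EuclideanSpace ℝ (Fin n),
      covDerivInner (warpedMetric c w) f x X Y (N₁, w (f x).2) = 0 ∨
      covDerivInner (warpedMetric c w) f x X Y (N₂, w (f x).2) = 0) :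
    NullAlong c w f x N₁ ∨ NullAlong c w f x N₂ := by
  have h1 : ∀ X, covDerivForm c w f x hw (N₁, w (f x).2) X = 0 ∨
      covDerivForm c w f x hw (N₂, w (f x).2) X = 0 := by
    intro X
    refine (eq_zero_or_eq_zero_of_forall
      (a := (covDerivForm c w f x hw (N₁, w (f x).2) X).toAddMonoidHom)
      (b := (covDerivForm c w f x hw (N₂, w (f x).2) X).toAddMonoidHom) fun Y => h X Y).imp ?_ ?_
    · exact fun h => LinearMap.ext h
    · exact fun h => LinearMap.ext h
  refine (eq_zero_or_eq_zero_of_forall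
    (a := (covDerivForm c w f x hw (N₁, w (f x).2)).toAddMonoidHom)
    (b := (covDerivForm c w f x hw (N₂, w (f x).2)).toAddMonoidHom) h1).imp ?_ ?_
  · exact fun h X Y => LinearMap.congr_fun (h X) Y
  · exact fun h X Y => LinearMap.congr_fun (h X) Y

theorem IsNullDir.mem_normalSpace {N : Flat n}
    (hN : IsNullDir c (w (f x).2) (f x).1 (D1 f x) N) :
    (N, w (f x).2) ∈ normalSpace c w f x := by
  refine ⟨mem_spaceFormTangent_iff.2 hN.tangent, fun X => ?_⟩
  rw [warpedMetric, ← hN.normal X]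
  ring

/-- A nonzero vector of zero height is tangent to the space form, hence of positive square; so a
null normal vector can be scaled to height component `w`. -/
theorem isNullDir_of_mem_normalSpace (hA : SpacelikeAt c (w (f x).2) (f x).1 (D1 f x))
    {Z : Flat n × ℝ} (hZ : Z ∈ normalSpace c w f x) (hnull : warpedMetric c w (f x) Z Z = 0)
    (h0 : Z ≠ 0) :
    Z.2 ≠ 0 ∧ IsNullDir c (w (f x).2) (f x).1 (D1 f x) ((w (f x).2 / Z.2) • Z.1) := by
  have hW := hA.pos
  have hnull' : w (f x).2 ^ 2 * flatInner c Z.1 Z.1 - Z.2 * Z.2 = 0 := hnull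
  have hZ2 : Z.2 ≠ 0 := by
    intro hs
    have hZ1 : Z.1 ≠ 0 := fun h => h0 (Prod.ext h hs)
    have := flatInner_self_pos hA.mem hZ.1 hZ1
    rw [hs] at hnull'
    have : 0 < w (f x).2 ^ 2 * flatInner c Z.1 Z.1 := by positivity
    linarith
  refine ⟨hZ2, ?_, ?_, fun X => ?_⟩
  · rw [flatInner_smul_right, mem_spaceFormTangent_iff.1 hZ.1, mul_zero]
  · rw [flatInner_smul_right, flatInner_smul_left]
    field_simp
    linarith
  · have h1 : w (f x).2 ^ 2 * flatInner c (D1 f x X).1 Z.1 - (D1 f x X).2 * Z.2 = 0 := hZ.2 X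
    rw [flatInner_smul_right]
    field_simp
    linarith

/-- At each point, a null second fundamental form is collinear to one of the two null normal
directions. -/
theorem SpacelikeAt.nullAlong_or (hA : SpacelikeAt c (w (f x).2) (f x).1 (D1 f x))
    (hw : DifferentiableAt ℝ w (f x).2)
    (h : ∀ X Y : EuclideanSpace ℝ (Fin n), ∃ η, IsSecondFF c w f x X Y η ∧
      warpedMetric c w (f x) η η = 0)
    {N₁ N₂ : Flat n} (h₁ : IsNullDir c (w (f x).2) (f x).1 (D1 f x) N₁)
    (h₂ : IsNullDir c (w (f x).2) (f x).1 (D1 f x) N₂) (hne : N₁ ≠ N₂) :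
    NullAlong c w f x N₁ ∨ NullAlong c w f x N₂ := by
  have hW := hA.pos
  refine nullAlong_or_of_forall hw fun X Y => ?_
  obtain ⟨η, ⟨hη1, hη2⟩, hη3⟩ := h X Y
  by_cases h0 : η = 0
  · left
    rw [← hη2 _ h₁.mem_normalSpace, h0, warpedMetric]
    simp [flatInner_zero_left]
  obtain ⟨hs, hN⟩ := isNullDir_of_mem_normalSpace hA hη1 hη3 h0
  -- If `η` is proportional to `(N, w)`, it is orthogonal to `(N, w)` because a null vector is
  -- orthogonal to itself.
  have key : ∀ {N}, IsNullDir c (w (f x).2) (f x).1 (D1 f x) N →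
      (w (f x).2 / η.2) • η.1 = N →
      covDerivInner (warpedMetric c w) f x X Y (N, w (f x).2) = 0 := by
    intro N hN' he
    rw [← hη2 _ hN'.mem_normalSpace]
    have h1 := hN'.unit
    nth_rewrite 1 [← he] at h1
    rw [flatInner_smul_left] at h1
    rw [warpedMetric]
    simp only
    field_simp at h1
    linear_combination w (f x).2 * h1
  exact (hA.eq_or_eq h₁ h₂ hne hN).imp (key h₁) (key h₂)

theorem SecondFFCollinearOn.isNullDir {ξ : M → Flat n × ℝ} {U : Set M}
    (h : SecondFFCollinearOn c w f ξ U) (hA : SpacelikeAt c (w (f x).2) (f x).1 (D1 f x))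
    (hx : x ∈ U) : (ξ x).2 ≠ 0 ∧
      IsNullDir c (w (f x).2) (f x).1 (D1 f x) ((w (f x).2 / (ξ x).2) • (ξ x).1) :=
  isNullDir_of_mem_normalSpace hA (h.normal x hx) (h.null x hx) (h.ne_zero x hx)

theorem SecondFFCollinearOn.nullAlong {ξ : M → Flat n × ℝ} {U : Set M}
    (h : SecondFFCollinearOn c w f ξ U) (hA : SpacelikeAt c (w (f x).2) (f x).1 (D1 f x))
    (hx : x ∈ U) : NullAlong c w f x ((w (f x).2 / (ξ x).2) • (ξ x).1) := by
  intro X Y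
  obtain ⟨hs, hN⟩ := h.isNullDir hA hx
  obtain ⟨a, -, ha⟩ := h.collinear x hx X Y
  rw [← ha _ hN.mem_normalSpace]
  have h1 : w (f x).2 ^ 2 * flatInner c (ξ x).1 (ξ x).1 - (ξ x).2 * (ξ x).2 = 0 := h.null x hx
  simp only [warpedMetric, Prod.smul_fst, Prod.smul_snd, smul_eq_mul, flatInner_smul_left,
    flatInner_smul_right]
  field_simp
  linear_combination a * w (f x).2 * h1

/-- If the second fundamental form is orthogonal to a null normal vector, it is collinear to it. -/
theorem SpacelikeAt.exists_isSecondFF (hA : SpacelikeAt c (w (f x).2) (f x).1 (D1 f x))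
    (hw : DifferentiableAt ℝ w (f x).2) {N : Flat n}
    (hN : IsNullDir c (w (f x).2) (f x).1 (D1 f x) N) (h : NullAlong c w f x N)
    (X Y : EuclideanSpace ℝ (Fin n)) :
    ∃ a : ℝ, IsSecondFF c w f x X Y (a • (N, w (f x).2)) := by
  obtain ⟨m, hm1, hm2, hm3⟩ := hA.exists_unit_normal
  have hW := hA.pos.ne'
  have hm0 : m ≠ 0 := by
    rintro rfl
    rw [flatInner_zero_left] at hm3
    exact zero_ne_one hm3
  have hk : flatInner c N m ≠ 0 := fun hk =>
    hm0 (hA.eq_zero_of_orthogonal_nullDir hN hm1 hm2 hk)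
  -- The coefficient is forced by pairing with the normal vector `(m, 0)`, whose product with `(N,
  -- w)` is `w² ⟨N, m⟩ ≠ 0`.
  refine ⟨covDerivInner (warpedMetric c w) f x X Y (m, 0) /
    (w (f x).2 ^ 2 * flatInner c N m), ⟨?_, fun V => ?_⟩, fun Z hZ => ?_⟩
  · rw [Prod.smul_fst, mem_spaceFormTangent_iff, flatInner_smul_right, hN.tangent, mul_zero]
  · have := hN.mem_normalSpace.2 V
    simp only [warpedMetric] at this
    simp only [warpedMetric, Prod.smul_fst, Prod.smul_snd, smul_eq_mul, flatInner_smul_right]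
    linear_combination (covDerivInner (warpedMetric c w) f x X Y (m, 0) /
      (w (f x).2 ^ 2 * flatInner c N m)) * this
  · have hv1 : flatInner c (conormal c (f x).1) (Z.1 - (Z.2 / w (f x).2) • N) = 0 := by
      rw [flatInner_sub_right, flatInner_smul_right, hN.tangent,
        mem_spaceFormTangent_iff.1 hZ.1]
      ring
    have hv2 : ∀ V : EuclideanSpace ℝ (Fin n),
        flatInner c (D1 f x V).1 (Z.1 - (Z.2 / w (f x).2) • N) = 0 := by
      intro V
      have h1 : w (f x).2 ^ 2 * flatInner c (D1 f x V).1 Z.1 - (D1 f x V).2 * Z.2 = 0 := hZ.2 V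
      rw [← hN.normal V] at h1
      rw [flatInner_sub_right, flatInner_smul_right]
      field_simp
      refine mul_left_cancel₀ hW ?_
      linear_combination h1
    have hv := hA.eq_smul_normal hm1 hm2 hm0 hv1 hv2
    -- Every normal vector is `Z = (Z₂/w) (N, w) + b (m, 0)`. On `(N, w)` both sides vanish; on `(m,
    -- 0)` they agree by the choice of the coefficient.
    set b := flatInner c m (Z.1 - (Z.2 / w (f x).2) • N) / flatInner c m m
    have hZ1 : Z.1 = (Z.2 / w (f x).2) • N + b • m := by rw [← hv]; abel
    have hN0 := h X Y
    rw [covDerivInner_warpedMetric hw] at hN0 ⊢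
    rw [covDerivInner_warpedMetric hw]
    simp only [warpedMetric, Prod.smul_fst, Prod.smul_snd, smul_eq_mul,
      flatInner_smul_left] at hN0 ⊢
    rw [hZ1]
    simp only [flatInner_add_right, flatInner_smul_right, hN.unit]
    field_simp
    linear_combination -(Z.2 * flatInner c N m) * hN0

end secondFF

/-! ### Geodesics of the space form and their derivatives -/

section rotation

variable {n : ℕ} {c : SignType}

theorem hasDerivAt_co (c : SignType) (t : ℝ) : HasDerivAt (co c) (-((c : ℝ) * si c t)) t := by
  cases c
  · have h : HasDerivAt (co .zero) 0 t := hasDerivAt_const t 1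
    simpa using h
  · have h : HasDerivAt (co .neg) (si .neg t) t := Real.hasDerivAt_cosh t
    simpa using h
  · have h : HasDerivAt (co .pos) (-si .pos t) t := Real.hasDerivAt_cos t
    simpa using h

theorem hasDerivAt_si (c : SignType) (t : ℝ) : HasDerivAt (si c) (co c t) t := by
  cases c
  · exact hasDerivAt_id t
  · exact Real.hasDerivAt_sinh t
  · exact Real.hasDerivAt_sin t

theorem contDiff_co (c : SignType) : ContDiff ℝ 2 (co c) := by
  cases c
  · exact contDiff_const
  · exact Real.contDiff_cosh
  · exact Real.contDiff_cos

theorem contDiff_si (c : SignType) : ContDiff ℝ 2 (si c) := by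
  cases c
  · exact contDiff_id
  · exact Real.contDiff_sinh
  · exact Real.contDiff_sin

theorem co_neg (c : SignType) (t : ℝ) : co c (-t) = co c t := by
  cases c <;> simp [co]

theorem si_neg (c : SignType) (t : ℝ) : si c (-t) = -si c t := by
  cases c <;> simp [si]

/-- The point at distance `t` from `u` on the geodesic of direction `v`. -/
def geodesic (c : SignType) (t : ℝ) (u v : Flat n) : Flat n := co c t • u + si c t • v

/-- The velocity at time `t` of the geodesic from `u` of direction `v`. -/
def geodesicVelocity (c : SignType) (t : ℝ) (u v : Flat n) : Flat n :=
  -((c : ℝ) * si c t) • u + co c t • v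

theorem geodesic_neg (t : ℝ) (u v : Flat n) :
    geodesic c t (geodesic c (-t) u v) (geodesicVelocity c (-t) u v) = u := by
  have h := co_sq_add_si_sq c t
  have : geodesic c t (geodesic c (-t) u v) (geodesicVelocity c (-t) u v) =
      (co c t ^ 2 + (c : ℝ) * si c t ^ 2) • u := by
    simp only [geodesic, geodesicVelocity, co_neg, si_neg]
    module
  rw [this, h, one_smul]

variable {E : Type*} [NormedAddCommGroup E] [NormedSpace ℝ E] {u v : E → Flat n} {s : E → ℝ}
  {u' v' : E →L[ℝ] Flat n} {s' : E →L[ℝ] ℝ} {p : E}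

theorem fderiv_geodesic (hu : HasFDerivAt u u' p) (hv : HasFDerivAt v v' p)
    (hs : HasFDerivAt s s' p) (X : E) :
    fderiv ℝ (fun q => geodesic c (s q) (u q) (v q)) p X =
      geodesic c (s p) (u' X) (v' X) + s' X • geodesicVelocity c (s p) (u p) (v p) := by
  have h := (((hasDerivAt_co c (s p)).comp_hasFDerivAt p hs).smul hu).add
    (((hasDerivAt_si c (s p)).comp_hasFDerivAt p hs).smul hv)
  have e : fderiv ℝ (fun q => geodesic c (s q) (u q) (v q)) p = _ := h.fderiv
  rw [e]
  simp only [add_apply, smul_apply, ContinuousLinearMap.smulRight_apply, Function.comp_apply,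
    geodesic, geodesicVelocity, smul_eq_mul]
  module

theorem fderiv_geodesicVelocity (hu : HasFDerivAt u u' p) (hv : HasFDerivAt v v' p)
    (hs : HasFDerivAt s s' p) (X : E) :
    fderiv ℝ (fun q => geodesicVelocity c (s q) (u q) (v q)) p X =
      geodesicVelocity c (s p) (u' X) (v' X) -
        ((c : ℝ) * s' X) • geodesic c (s p) (u p) (v p) := by
  have h := ((((hasDerivAt_si c (s p)).comp_hasFDerivAt p hs).const_mul (c : ℝ)).neg.smul hu).add
    (((hasDerivAt_co c (s p)).comp_hasFDerivAt p hs).smul hv)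
  have e : fderiv ℝ (fun q => geodesicVelocity c (s q) (u q) (v q)) p = _ := h.fderiv
  rw [e]
  simp only [add_apply, smul_apply, ContinuousLinearMap.smulRight_apply, Function.comp_apply,
    neg_apply, Pi.neg_apply, geodesic, geodesicVelocity, smul_eq_mul]
  module

theorem contDiffAt_geodesic {m : ℕ∞ω} (hm : m ≤ 2) (hu : ContDiffAt ℝ m u p)
    (hv : ContDiffAt ℝ m v p) (hs : ContDiffAt ℝ m s p) :
    ContDiffAt ℝ m (fun q => geodesic c (s q) (u q) (v q)) p :=
  (((contDiff_co c).of_le hm).contDiffAt.comp p hs |>.smul hu).add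
    (((contDiff_si c).of_le hm).contDiffAt.comp p hs |>.smul hv)

theorem contDiffAt_geodesicVelocity {m : ℕ∞ω} (hm : m ≤ 2) (hu : ContDiffAt ℝ m u p)
    (hv : ContDiffAt ℝ m v p) (hs : ContDiffAt ℝ m s p) :
    ContDiffAt ℝ m (fun q => geodesicVelocity c (s q) (u q) (v q)) p :=
  ((contDiffAt_const.mul (((contDiff_si c).of_le hm).contDiffAt.comp p hs)).neg.smul hu).add
    (((contDiff_co c).of_le hm).contDiffAt.comp p hs |>.smul hv)

end rotation

/-! ### The function `θ`, and `Ω` as a quotient of `shiftCofactor` by `shiftFactor` -/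

section theta

variable {c : SignType} {I : Set ℝ} {w : ℝ → ℝ} {t₀ t : ℝ}

theorem IsWarping.hasDerivAt_theta (hI : IsWarping I w) (hIc : I.OrdConnected) (h₀ : t₀ ∈ I)
    (ht : t ∈ I) : HasDerivAt (theta w t₀) (w t)⁻¹ t := by
  have hcont : ContinuousOn (fun s => (w s)⁻¹) I :=
    hI.contDiffOn.continuousOn.inv₀ fun s hs => (hI.pos s hs).ne'
  exact intervalIntegral.integral_hasDerivAt_right
    ((hcont.mono (hIc.uIcc_subset h₀ ht)).intervalIntegrable)
    (hcont.stronglyMeasurableAtFilter hI.isOpen t ht)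
    (hcont.continuousAt (hI.isOpen.mem_nhds ht))

theorem IsWarping.contDiffAt_theta (hI : IsWarping I w) (hIc : I.OrdConnected) (h₀ : t₀ ∈ I)
    (ht : t ∈ I) : ContDiffAt ℝ ∞ (theta w t₀) t := by
  refine ContDiffOn.contDiffAt ?_ (hI.isOpen.mem_nhds ht)
  refine (contDiffOn_infty_iff_deriv_of_isOpen hI.isOpen).2 ⟨fun s hs =>
    (hI.hasDerivAt_theta hIc h₀ hs).differentiableAt.differentiableWithinAt, ?_⟩
  exact (hI.contDiffOn.inv fun s hs => (hI.pos s hs).ne').congr fun s hs =>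
    (hI.hasDerivAt_theta hIc h₀ hs).deriv

theorem IsWarping.deriv_deriv_theta (hI : IsWarping I w) (hIc : I.OrdConnected) (h₀ : t₀ ∈ I)
    (ht : t ∈ I) : deriv (deriv (theta w t₀)) t = -deriv w t / w t ^ 2 := by
  have h : deriv (theta w t₀) =ᶠ[𝓝 t] w⁻¹ := by
    filter_upwards [hI.isOpen.mem_nhds ht] with s hs
    exact (hI.hasDerivAt_theta hIc h₀ hs).deriv
  rw [h.deriv_eq]
  exact ((hI.differentiableAt ht).hasDerivAt.inv (hI.pos t ht).ne').deriv

/-- `co(θ) + w' si(θ)`. -/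
def shiftFactor (c : SignType) (w : ℝ → ℝ) (t₀ t : ℝ) : ℝ :=
  co c (theta w t₀ t) + deriv w t * si c (theta w t₀ t)

/-- `w' co(θ) - c si(θ)`. -/
def shiftCofactor (c : SignType) (w : ℝ → ℝ) (t₀ t : ℝ) : ℝ :=
  deriv w t * co c (theta w t₀ t) - (c : ℝ) * si c (theta w t₀ t)

theorem IsWarping.OmegaDen_eq (hI : IsWarping I w) (hIc : I.OrdConnected) (h₀ : t₀ ∈ I)
    (ht : t ∈ I) : OmegaDen c w t₀ t = -shiftFactor c w t₀ t / w t ^ 2 := by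
  have := (hI.pos t ht).ne'
  rw [OmegaDen, hI.deriv_deriv_theta hIc h₀ ht, (hI.hasDerivAt_theta hIc h₀ ht).deriv, shiftFactor]
  field_simp
  ring

theorem IsWarping.OmegaDen_ne_zero_iff (hI : IsWarping I w) (hIc : I.OrdConnected) (h₀ : t₀ ∈ I)
    (ht : t ∈ I) : OmegaDen c w t₀ t ≠ 0 ↔ shiftFactor c w t₀ t ≠ 0 := by
  have := (hI.pos t ht).ne'
  rw [hI.OmegaDen_eq hIc h₀ ht]
  simp [this]

/-- Inserting `θ' = 1/w` and `θ'' = -w'/w²`, numerator and denominator share the factor `-1/w²`. -/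
theorem IsWarping.Omega_eq (hI : IsWarping I w) (hIc : I.OrdConnected) (h₀ : t₀ ∈ I)
    (ht : t ∈ I) : Omega c w t₀ t = shiftCofactor c w t₀ t / shiftFactor c w t₀ t := by
  have hW := (hI.pos t ht).ne'
  have hnum : OmegaNum c w t₀ t = -shiftCofactor c w t₀ t / w t ^ 2 := by
    rw [OmegaNum, hI.deriv_deriv_theta hIc h₀ ht, (hI.hasDerivAt_theta hIc h₀ ht).deriv,
      shiftCofactor]
    field_simp
    ring
  rw [Omega, hnum, hI.OmegaDen_eq hIc h₀ ht, div_div_div_cancel_right₀ (pow_ne_zero 2 hW),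
    neg_div_neg_eq]

end theta

/-! ### Integrability of the equation of a null field -/

section local_analysis

variable {n : ℕ} {c : SignType} {w : ℝ → ℝ}

/-- The integrability condition of the equation of a null normal field along which the second
fundamental form is null. -/
theorem integrability_of_hasFDerivAt_nullShape {F : EuclideanSpace ℝ (Fin n) → Flat n × ℝ}
    {N : EuclideanSpace ℝ (Fin n) → Flat n} {p : EuclideanSpace ℝ (Fin n)}
    (hF : ContDiffAt ℝ 2 F p) (hw : DifferentiableAt ℝ w (F p).2)
    (hw' : DifferentiableAt ℝ (deriv w) (F p).2) (h0 : w (F p).2 ≠ 0)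
    (hN : ∀ᶠ q in 𝓝 p, HasFDerivAt N (nullShape c (w (F q).2) (deriv w (F q).2) (F q).1
      (fderiv ℝ F q) (N q)) q)
    (hS : DifferentiableAt ℝ (fun q => nullShape c (w (F q).2) (deriv w (F q).2) (F q).1
      (fderiv ℝ F q) (N q)) p) (X Y : EuclideanSpace ℝ (Fin n)) :
    (deriv (deriv w) (F p).2 * w (F p).2 - deriv w (F p).2 ^ 2 - c : ℝ) •
      ((fderiv ℝ F p Y).2 • (fderiv ℝ F p X).1 - (fderiv ℝ F p X).2 • (fderiv ℝ F p Y).1) = 0 := by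
  have hF1 : HasFDerivAt F (fderiv ℝ F p) p := (hF.differentiableAt two_ne_zero).hasFDerivAt
  have hF2 : HasFDerivAt (fderiv ℝ F) (fderiv ℝ (fderiv ℝ F) p) p :=
    ((hF.fderiv_right (m := 1) (by norm_num)).differentiableAt one_ne_zero).hasFDerivAt
  have hFsymm : fderiv ℝ (fderiv ℝ F) p X Y = fderiv ℝ (fderiv ℝ F) p Y X := by
    refine second_derivative_symmetric_of_eventually (f := F) ?_ hF2 X Y
    filter_upwards [hF.eventually (by simp)] with q hq
    exact (hq.differentiableAt two_ne_zero).hasFDerivAt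
  have hNsymm := second_derivative_symmetric_of_eventually hN hS.hasFDerivAt X Y
  have hN1 := hN.self_of_nhds
  have hw1 : HasFDerivAt (fun q => w (F q).2)
      (deriv w (F p).2 • (ContinuousLinearMap.snd ℝ (Flat n) ℝ).comp (fderiv ℝ F p)) p :=
    hw.hasDerivAt.comp_hasFDerivAt p hF1.snd
  have hw2 : HasFDerivAt (fun q => deriv w (F q).2)
      (deriv (deriv w) (F p).2 • (ContinuousLinearMap.snd ℝ (Flat n) ℝ).comp (fderiv ℝ F p)) p :=
    hw'.hasDerivAt.comp_hasFDerivAt (h₂ := deriv w) p hF1.snd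
  have hr : HasFDerivAt (fun q => deriv w (F q).2 / w (F q).2)
      (deriv (fun t => deriv w t / w t) (F p).2 •
        (ContinuousLinearMap.snd ℝ (Flat n) ℝ).comp (fderiv ℝ F p)) p :=
    (hw'.div hw h0).hasDerivAt.comp_hasFDerivAt (h₂ := fun t => deriv w t / w t) p hF1.snd
  have hs : HasFDerivAt (fun q => (c : ℝ) / w (F q).2)
      (deriv (fun t => (c : ℝ) / w t) (F p).2 •
        (ContinuousLinearMap.snd ℝ (Flat n) ℝ).comp (fderiv ℝ F p)) p :=
    ((differentiableAt_const (c : ℝ)).div hw h0).hasDerivAt.comp_hasFDerivAt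
      (h₂ := fun t => (c : ℝ) / w t) p hF1.snd
  -- The derivative in the direction `X` of the right side evaluated at `Y`, with `dN` replaced by
  -- its own expression.
  have key : ∀ X Y, fderiv ℝ (fun q => nullShape c (w (F q).2) (deriv w (F q).2) (F q).1
      (fderiv ℝ F q) (N q)) p X Y =
      -(deriv (deriv w) (F p).2 * (fderiv ℝ F p X).2) • (fderiv ℝ F p Y).1 -
      deriv w (F p).2 • (fderiv ℝ (fderiv ℝ F) p X Y).1 +
      (fderiv ℝ (fderiv ℝ F) p X Y).2 •
        ((deriv w (F p).2 / w (F p).2) • N p - ((c : ℝ) / w (F p).2) • (F p).1) +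
      (fderiv ℝ F p Y).2 •
        ((deriv (fun t => deriv w t / w t) (F p).2 * (fderiv ℝ F p X).2) • N p +
          (deriv w (F p).2 / w (F p).2) • (-deriv w (F p).2 • (fderiv ℝ F p X).1 +
            (fderiv ℝ F p X).2 •
              ((deriv w (F p).2 / w (F p).2) • N p - ((c : ℝ) / w (F p).2) • (F p).1)) -
          (deriv (fun t => (c : ℝ) / w t) (F p).2 * (fderiv ℝ F p X).2) • (F p).1 -
          ((c : ℝ) / w (F p).2) • (fderiv ℝ F p X).1) := by
    intro X Y
    have hFY : HasFDerivAt (fun q => fderiv ℝ F q Y) ((fderiv ℝ (fderiv ℝ F) p).flip Y) p := by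
      refine (hF2.clm_apply (hasFDerivAt_const Y p)).congr_fderiv ?_
      ext <;> simp
    have h1 := (hw2.neg.smul hFY.fst).add (hFY.snd.smul ((hr.smul hN1).sub (hs.smul hF1.fst)))
    have h2 := hS.hasFDerivAt.clm_apply (hasFDerivAt_const Y p)
    have h3 := DFunLike.congr_fun (h2.unique h1) X
    simp only [add_apply, ContinuousLinearMap.comp_apply, ContinuousLinearMap.flip_apply,
      ContinuousLinearMap.smulRight_apply, smul_apply, neg_apply, sub_apply,
      ContinuousLinearMap.coe_fst', ContinuousLinearMap.coe_snd', smul_eq_mul, zero_apply,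
      map_zero, nullShape_apply, zero_add, Pi.neg_apply, Pi.sub_apply,
      Pi.smul_apply'] at h3
    rw [h3]
    module
  rw [key, key, hFsymm] at hNsymm
  -- Antisymmetrizing in `X`, `Y` kills the second derivatives of `F` and the terms along `N` and
  -- `F`, which carry `dτ(X) dτ(Y)`. Only the terms in `dτ(X) dψ(Y)` and `dτ(Y) dψ(X)` survive.
  have h4 : (deriv (deriv w) (F p).2 - deriv w (F p).2 / w (F p).2 * deriv w (F p).2 -
      (c : ℝ) / w (F p).2) • ((fderiv ℝ F p Y).2 • (fderiv ℝ F p X).1 -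
        (fderiv ℝ F p X).2 • (fderiv ℝ F p Y).1) = 0 := by
    refine Eq.trans ?_ (sub_eq_zero.2 hNsymm)
    module
  have h5 : (deriv (deriv w) (F p).2 * w (F p).2 - deriv w (F p).2 ^ 2 - c : ℝ) =
      w (F p).2 * (deriv (deriv w) (F p).2 - deriv w (F p).2 / w (F p).2 * deriv w (F p).2 -
      (c : ℝ) / w (F p).2) := by
    field_simp
  rw [h5, mul_smul, h4, smul_zero]

end local_analysis

/-! ### Null frames: regularity, critical heights, density, local form -/

section frame_field

variable {n : ℕ} {M : Type*} [TopologicalSpace M] [ChartedSpace (EuclideanSpace ℝ (Fin n)) M]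
  {c : SignType} {I : Set ℝ} {w : ℝ → ℝ} {f : M → Flat n × ℝ} {N : M → Flat n} {x : M}

/-- Near `x`, `(N, w)` is a `C¹` null normal field to which the second fundamental form of `f` is
collinear. -/
structure NullFrameAt (c : SignType) (w : ℝ → ℝ) (f : M → Flat n × ℝ) (N : M → Flat n) (x : M) :
    Prop where
  nullFieldAt : NullFieldAt c w f N x
  nullAlong : ∀ᶠ y in 𝓝 x, NullAlong c w f y (N y)

theorem NullFrameAt.isNullDir (h : NullFrameAt c w f N x) :
    IsNullDir c (w (f x).2) (f x).1 (D1 f x) (N x) := h.nullFieldAt.isNullDir.self_of_nhds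

variable [IsManifold 𝓘(ℝ, EuclideanSpace ℝ (Fin n)) 2 M]

theorem NullFrameAt.eventually (h : NullFrameAt c w f N x) :
    ∀ᶠ y in 𝓝 x, NullFrameAt c w f N y := by
  filter_upwards [h.nullFieldAt.eventually, h.nullAlong.eventually_nhds] with y h1 h2
  exact ⟨h1, h2⟩

theorem NullFrameAt.D1_eq (h : NullFrameAt c w f N x) (hf : IsSpacelikeImmersion c I w f)
    (hI : IsWarping I w) :
    D1 N x = nullShape c (w (f x).2) (deriv w (f x).2) (f x).1 (D1 f x) (N x) :=
  (h.nullFieldAt.nullAlong_iff hf hI).1 h.nullAlong.self_of_nhds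

theorem NullFrameAt.hasFDerivAt_inChart (h : NullFrameAt c w f N x)
    (hf : IsSpacelikeImmersion c I w f) (hI : IsWarping I w) :
    ∀ᶠ q in 𝓝 (chartAt (EuclideanSpace ℝ (Fin n)) x x), HasFDerivAt (inChart (n := n) N x)
      (nullShape c (w (inChart (n := n) f x q).2) (deriv w (inChart (n := n) f x q).2)
        (inChart (n := n) f x q).1 (fderiv ℝ (inChart (n := n) f x) q)
        (inChart (n := n) N x q)) q := by
  have hx := mem_chart_source (EuclideanSpace ℝ (Fin n)) x
  filter_upwards [(eventually_inChart hx).1 h.eventually, eventually_mem_target hx] with q h1 hq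
  have hs := (chartAt (EuclideanSpace ℝ (Fin n)) x).map_target hq
  have h2 := (h1.nullFieldAt.nullAlong_iff_inChart hf hI hs).1 h1.nullAlong.self_of_nhds
  have h3 := (h1.nullFieldAt.contDiffAt hs).differentiableAt one_ne_zero
  rw [OpenPartialHomeomorph.right_inv _ hq] at h2 h3
  have h4 := h3.hasFDerivAt
  rw [h2] at h4
  exact h4

/-- Bootstrap: `N` is `C¹`, and its derivative is an expression in `f`, `df` and `N`, which is again
`C¹`. -/
theorem NullFrameAt.contMDiffAt_two (h : NullFrameAt c w f N x)
    (hf : IsSpacelikeImmersion c I w f) (hI : IsWarping I w) :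
    ContMDiffAt 𝓘(ℝ, EuclideanSpace ℝ (Fin n)) 𝓘(ℝ, Flat n) 2 N x := by
  have hx := mem_chart_source (EuclideanSpace ℝ (Fin n)) x
  rw [contMDiffAt_iff_inChart le_rfl hx]
  have h1 := (contDiffAt_succ_iff_hasFDerivAt (n := 1)).2 ⟨_,
    ⟨_, h.hasFDerivAt_inChart hf hI, fun q hq => hq⟩,
    hf.contDiffAt_nullShape_inChart hI hx h.nullFieldAt⟩
  rwa [show ((1 : ℕ) : ℕ∞ω) + 1 = 2 by rw [Nat.cast_one, one_add_one_eq_two]] at h1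

/-- The height is critical where the integrability condition on the warping function fails. -/
theorem NullFrameAt.D1_height_eq_zero (h : NullFrameAt c w f N x) (hn : 1 < n)
    (hf : IsSpacelikeImmersion c I w f) (hI : IsWarping I w)
    (hG : deriv (deriv w) (f x).2 * w (f x).2 - deriv w (f x).2 ^ 2 - c ≠ 0)
    (Y : EuclideanSpace ℝ (Fin n)) : (D1 f x Y).2 = 0 := by
  have hx := mem_chart_source (EuclideanSpace ℝ (Fin n)) x
  have eF := inChart_apply (n := n) f hx
  have hm := hf.mem_interval x
  have key := integrability_of_hasFDerivAt_nullShape (hf.contDiffAt hx)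
    (by rw [eF]; exact hI.differentiableAt hm)
    (by rw [eF]; exact (hI.contDiffAt_deriv hm).differentiableAt (by simp))
    (by rw [eF]; exact (hI.pos _ hm).ne') (h.hasFDerivAt_inChart hf hI)
    ((hf.contDiffAt_nullShape_inChart hI hx h.nullFieldAt).differentiableAt one_ne_zero)
  rw [eF] at key
  by_contra hY
  -- Here `n > 1` enters: `dτ` has a kernel vector `X ≠ 0`, and if `dτ(Y) ≠ 0` the integrability
  -- condition forces `dψ(X) = 0`.
  have hker : LinearMap.ker (LinearMap.snd ℝ (Flat n) ℝ ∘ₗ (D1 (n := n) f x).toLinearMap) ≠ ⊥ := by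
    apply LinearMap.ker_ne_bot_of_finrank_lt
    simpa using hn
  obtain ⟨X, hX, hX0⟩ := (Submodule.ne_bot_iff _).1 hker
  have hX' : (D1 f x X).2 = 0 := hX
  have h1 : (D1 f x Y).2 • (D1 f x X).1 - (D1 f x X).2 • (D1 f x Y).1 = 0 :=
    (smul_eq_zero.1 (key X Y)).resolve_left hG
  rw [hX', zero_smul, sub_zero] at h1
  exact (hf.spacelikeAt hI x).ne_zero hX0 ((smul_eq_zero.1 h1).resolve_left hY)

/-- Near every point there is a point at which the second fundamental form is locally collinear to
one null normal field. -/
theorem IsSpacelikeImmersion.exists_nullFrameAt (hf : IsSpacelikeImmersion c I w f)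
    (hI : IsWarping I w) (hnull : HasNullSecondFF c w f) (x : M) {s : Set M} (hs : s ∈ 𝓝 x) :
    ∃ y ∈ s, ∃ N, NullFrameAt c w f N y := by
  obtain ⟨v₁, v₂, hv₁, hv₂, hne⟩ := (hf.spacelikeAt hI x).exists_nullDir_pair
  obtain ⟨N₁, hN₁, rfl, -⟩ := hf.exists_nullFieldAt hI hv₁
  obtain ⟨N₂, hN₂, rfl, -⟩ := hf.exists_nullFieldAt hI hv₂
  have hne' : ∀ᶠ y in 𝓝 x, N₁ y ≠ N₂ y :=
    (hN₁.contMDiffAt.continuousAt.ne_iff_eventually_ne hN₂.contMDiffAt.continuousAt).1 hne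
  by_cases h : ∀ᶠ y in 𝓝 x, NullAlong c w f y (N₁ y)
  · exact ⟨x, mem_of_mem_nhds hs, N₁, hN₁, h⟩
  · rw [Filter.not_eventually] at h
    obtain ⟨y, ⟨⟨⟨hy, h1⟩, h2⟩, h3⟩, hys⟩ :=
      (((h.and_eventually hN₁.eventually).and_eventually hN₂.eventually).and_eventually
        hne'.eventually_nhds).and_eventually hs |>.exists
    refine ⟨y, hys, N₂, h2, ?_⟩
    filter_upwards [h1.eventually_not_nullAlong hf hI hy, h1.isNullDir, h2.isNullDir, h3]
      with z hz hz1 hz2 hz3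
    exact ((hf.spacelikeAt hI z).nullAlong_or (hI.differentiableAt (hf.mem_interval z))
      (hnull z) hz1 hz2 hz3).resolve_left hz

/-- Scaling `ξ` to height component `w` gives a continuous field of null directions, which is then
automatically `C¹`. -/
theorem SecondFFCollinearOn.exists_nullFrameAt {ξ : M → Flat n × ℝ} {U : Set M}
    (h : SecondFFCollinearOn c w f ξ U) (hU : U ∈ 𝓝 x) (hf : IsSpacelikeImmersion c I w f)
    (hI : IsWarping I w) : ∃ N, NullFrameAt c w f N x := by
  have hfc : ContinuousAt f x := hf.contMDiff.continuous.continuousAt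
  have hξ : ContinuousAt ξ x := h.continuousOn.continuousAt hU
  have hcont : ContinuousAt (fun y => (w (f y).2 / (ξ y).2) • (ξ y).1) x := by
    refine ContinuousAt.smul (ContinuousAt.div ?_ hξ.snd ?_) hξ.fst
    · exact ContinuousAt.comp (g := w) (hI.differentiableAt (hf.mem_interval x)).continuousAt
        hfc.snd
    · exact (h.isNullDir (hf.spacelikeAt hI x) (mem_of_mem_nhds hU)).1
  refine ⟨fun y => (w (f y).2 / (ξ y).2) • (ξ y).1,
    hf.nullFieldAt_of_continuousAt hI hcont ?_, ?_⟩
  · filter_upwards [hU] with y hy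
    exact (h.isNullDir (hf.spacelikeAt hI y) hy).2
  · filter_upwards [hU] with y hy
    exact h.nullAlong (hf.spacelikeAt hI y) hy

/-- The local form of `f` near a point at which the second fundamental form is collinear to one
null normal field. -/
theorem NullFrameAt.hasLocalForm (h : NullFrameAt c w f N x) (hf : IsSpacelikeImmersion c I w f)
    (hI : IsWarping I w) (hIc : I.OrdConnected) {t₀ C₀ : ℝ} (h₀ : t₀ ∈ I)
    (hP : ∀ y, shiftFactor c w t₀ (f y).2 ≠ 0)
    (hR : ∀ y, shiftCofactor c w t₀ (f y).2 = C₀ * shiftFactor c w t₀ (f y).2) :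
    HasLocalForm c w t₀ C₀ f x := by
  obtain ⟨U, hU, hUo, hxU⟩ := eventually_nhds_iff.1 h.eventually
  have hs : ∀ {m : ℕ∞ω}, m ≤ 2 → ∀ y,
      ContDiffAt ℝ m (fun q => -theta w t₀ (inChart (n := n) f y q).2)
        (chartAt (EuclideanSpace ℝ (Fin n)) y y) := by
    intro m hm y
    have hy := mem_chart_source (EuclideanSpace ℝ (Fin n)) y
    have h1 : ContDiffAt ℝ 2 (theta w t₀)
        (inChart (n := n) f y (chartAt (EuclideanSpace ℝ (Fin n)) y y)).2 := by
      rw [inChart_apply f hy]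
      exact (hI.contDiffAt_theta hIc h₀ (hf.mem_interval y)).of_le ENat.LEInfty.out
    exact ((ContDiffAt.comp (g := theta w t₀) (chartAt (EuclideanSpace ℝ (Fin n)) y y) h1
      (hf.contDiffAt hy).snd).neg).of_le hm
  have hN : ∀ y ∈ U, ContDiffAt ℝ 2 (inChart (n := n) N y)
      (chartAt (EuclideanSpace ℝ (Fin n)) y y) := fun y hy =>
    (contMDiffAt_iff_inChart le_rfl (mem_chart_source _ y)).1 ((hU y hy).contMDiffAt_two hf hI)
  -- The construction of `nullShift` is undone by moving back by `θ` along the geodesic of direction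
  -- `N`. The `C²` regularity of `N` makes `φ` of class `C²`.
  set φ : M → Flat n := fun y => geodesic c (-theta w t₀ (f y).2) (f y).1 (N y) with hφ
  set ν : M → Flat n := fun y => geodesicVelocity c (-theta w t₀ (f y).2) (f y).1 (N y) with hν
  -- The components along `ψ` cancel once `dN` is replaced by `nullShape`, so both differentials are
  -- multiples of the single form `dψ - (dτ/w) N`.
  have hE : ∀ y ∈ U, ∀ X : EuclideanSpace ℝ (Fin n), D1 φ y X = shiftFactor c w t₀ (f y).2 •
        ((D1 f y X).1 - ((D1 f y X).2 / w (f y).2) • N y) ∧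
      D1 ν y X = -(shiftCofactor c w t₀ (f y).2) •
        ((D1 f y X).1 - ((D1 f y X).2 / w (f y).2) • N y) := by
    intro y hyU X
    have hy := mem_chart_source (EuclideanSpace ℝ (Fin n)) y
    have eF := inChart_apply (n := n) f hy
    have eN := inChart_apply (n := n) N hy
    have hFd := ((hf.contDiffAt hy).differentiableAt two_ne_zero).hasFDerivAt
    have hNd := ((hN y hyU).differentiableAt two_ne_zero).hasFDerivAt
    have hth : HasDerivAt (theta w t₀) (w (f y).2)⁻¹
        (inChart (n := n) f y (chartAt (EuclideanSpace ℝ (Fin n)) y y)).2 := by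
      rw [eF]
      exact hI.hasDerivAt_theta hIc h₀ (hf.mem_interval y)
    have hsd := (hth.comp_hasFDerivAt (chartAt (EuclideanSpace ℝ (Fin n)) y y) hFd.snd).neg
    have hDN : fderiv ℝ (inChart (n := n) N y) (chartAt (EuclideanSpace ℝ (Fin n)) y y) = _ :=
      (hU y hyU).D1_eq hf hI
    have hDN' := congrArg (fun L => L X) hDN
    simp only [nullShape_apply] at hDN'
    have e1 : D1 φ y X = _ := fderiv_geodesic (c := c) hFd.fst hNd hsd X
    have e2 : D1 ν y X = _ := fderiv_geodesicVelocity (c := c) hFd.fst hNd hsd X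
    rw [e1, e2]
    simp only [Pi.neg_apply, Function.comp_apply, eF, eN, hDN', neg_apply, smul_apply,
      ContinuousLinearMap.comp_apply, ContinuousLinearMap.coe_fst',
      ContinuousLinearMap.coe_snd', smul_eq_mul, geodesic, geodesicVelocity, co_neg, si_neg,
      shiftFactor, shiftCofactor]
    have hA : fderiv ℝ (inChart (n := n) f y) (chartAt (EuclideanSpace ℝ (Fin n)) y y) =
      D1 f y := rfl
    rw [hA]
    constructor <;> module
  refine ⟨U, hUo, hxU, φ, ν, fun y => (f y).2, ?_, ?_, ?_⟩
  · refine ⟨fun y hy => ContMDiffAt.contMDiffWithinAt ?_, fun y hy => ?_, fun y hy => ?_,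
      fun y hy => ContMDiffAt.contMDiffWithinAt ?_, fun y hy => ?_, fun y hy => ?_,
      fun y hy X => ?_, fun y hy X => ?_⟩
    · have hys := mem_chart_source (EuclideanSpace ℝ (Fin n)) y
      exact (contMDiffAt_iff_inChart le_rfl hys).2 (contDiffAt_geodesic le_rfl
        (hf.contDiffAt hys).fst (hN y hy) (hs le_rfl y))
    · exact rotate_mem_spaceForm (hf.mem_spaceForm y)
        (mem_spaceFormTangent_iff.2 (hU y hy).isNullDir.tangent) (hU y hy).isNullDir.unit _
    · rw [injective_iff_map_eq_zero]
      intro X hX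
      by_contra hX0
      rw [(hE y hy X).1] at hX
      -- A kernel vector would satisfy `dψ(X) = (dτ(X)/w) N`, hence be null.
      have h1 := sub_eq_zero.1 ((smul_eq_zero.1 hX).resolve_left (hP y))
      have h2 := (hf.spacelikeAt hI y).spacelike X hX0
      have h3 := (hf.spacelikeAt hI y).pos.ne'
      rw [h1, flatInner_smul_left, flatInner_smul_right, (hU y hy).isNullDir.unit] at h2
      field_simp at h2
      simp at h2
    · have hys := mem_chart_source (EuclideanSpace ℝ (Fin n)) y
      exact (contMDiffAt_iff_inChart one_le_two hys).2 (contDiffAt_geodesicVelocity one_le_two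
        ((hf.contDiffAt hys).fst.of_le one_le_two) ((hN y hy).of_le one_le_two)
        (hs one_le_two y))
    · exact rotate_mem_spaceFormTangent (hf.mem_spaceForm y)
        (mem_spaceFormTangent_iff.2 (hU y hy).isNullDir.tangent) (hU y hy).isNullDir.unit _
    · exact flatInner_rotate_self (hf.mem_spaceForm y)
        (mem_spaceFormTangent_iff.2 (hU y hy).isNullDir.tangent) (hU y hy).isNullDir.unit _
    · have hA := hf.spacelikeAt hI y
      have hNy := (hU y hy).isNullDir
      have h1 := flatInner_conormal_left (mem_spaceFormTangent_iff.2 (hA.tangent X))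
      have h2 := flatInner_conormal_left (mem_spaceFormTangent_iff.2 hNy.tangent)
      have h3 := hNy.normal X
      have h4 := hA.pos.ne'
      rw [flatInner_comm] at h1 h2
      rw [(hE y hy X).1, ← h3]
      simp only [hν, geodesicVelocity, flatInner_smul_left, flatInner_smul_right,
        flatInner_add_right, flatInner_sub_left, hNy.unit]
      field_simp
      linear_combination -(shiftFactor c w t₀ (f y).2 * si c (-theta w t₀ (f y).2)) *
        (h1 - flatInner c (D1 f y X).1 (N y) * h2)
    · rw [(hE y hy X).1, (hE y hy X).2, hR y]
      module
  · intro y hy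
    have hys := mem_chart_source (EuclideanSpace ℝ (Fin n)) y
    exact ((contMDiffAt_iff_inChart (k := fun y => (f y).2) le_rfl hys).2
      (hf.contDiffAt hys).snd).contMDiffWithinAt
  · intro y hy
    exact Prod.ext (geodesic_neg _ _ _).symm rfl

end frame_field

/-! ### Functions with vanishing derivative -/

section constancy

variable {n : ℕ} {M : Type*} [TopologicalSpace M] [ChartedSpace (EuclideanSpace ℝ (Fin n)) M]
  [IsManifold 𝓘(ℝ, EuclideanSpace ℝ (Fin n)) 2 M]
  {c : SignType} {I : Set ℝ} {w : ℝ → ℝ} {f : M → Flat n × ℝ} {N : M → Flat n} {x : M}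

theorem eventually_eq_of_D1_eq_zero {E : Type*} [NormedAddCommGroup E] [NormedSpace ℝ E]
    {k : M → E} (hk : ∀ᶠ y in 𝓝 x, ContMDiffAt 𝓘(ℝ, EuclideanSpace ℝ (Fin n)) 𝓘(ℝ, E) 1 k y)
    (h : ∀ᶠ y in 𝓝 x, D1 (n := n) k y = 0) : ∀ᶠ y in 𝓝 x, k y = k x := by
  have hx := mem_chart_source (EuclideanSpace ℝ (Fin n)) x
  have h1 : ∀ᶠ q in 𝓝 (chartAt (EuclideanSpace ℝ (Fin n)) x x),
      DifferentiableAt ℝ (inChart (n := n) k x) q ∧ fderiv ℝ (inChart (n := n) k x) q = 0 := by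
    filter_upwards [(eventually_inChart hx).1 hk, (eventually_inChart hx).1 h,
      eventually_mem_target hx] with q hq1 hq2 hq
    have hs := (chartAt (EuclideanSpace ℝ (Fin n)) x).map_target hq
    have hd := ((contMDiffAt_iff_inChart one_le_two hs).1 hq1).differentiableAt one_ne_zero
    rw [D1_eq_comp_coordChange hs hd] at hq2
    rw [OpenPartialHomeomorph.right_inv _ hq] at hd hq2
    refine ⟨hd, ContinuousLinearMap.ext fun X => ?_⟩
    obtain ⟨Y, rfl⟩ := (coordChange_bijective hs).2 X
    exact DFunLike.congr_fun hq2 Y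
  obtain ⟨r, hr, hball⟩ := Metric.eventually_nhds_iff_ball.1 h1
  have h2 : ∀ q ∈ Metric.ball (chartAt (EuclideanSpace ℝ (Fin n)) x x) r,
      inChart (n := n) k x q = k x := by
    intro q hq
    rw [← inChart_apply k hx]
    exact (Metric.isOpen_ball).is_const_of_fderiv_eq_zero (convex_ball _ _).isPreconnected
      (fun z hz => (hball z hz).1.differentiableWithinAt) (fun z hz => (hball z hz).2) hq
      (Metric.mem_ball_self hr)
  filter_upwards [((chartAt (EuclideanSpace ℝ (Fin n)) x).continuousAt hx).eventually
    (Metric.ball_mem_nhds _ hr), eventually_mem_source hx] with y hy hys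
  rw [← inChart_apply k hys]
  exact h2 _ hy

theorem eq_of_hasDerivAt_zero {J : Set ℝ} (hJ : J.OrdConnected) {g : ℝ → ℝ}
    (hg : ∀ t ∈ J, HasDerivAt g 0 t) {a b : ℝ} (ha : a ∈ J) (hb : b ∈ J) : g a = g b := by
  wlog hab : a ≤ b generalizing a b
  · exact (this hb ha (le_of_not_ge hab)).symm
  have hsub := hJ.out ha hb
  exact (constant_of_has_deriv_right_zero
    (fun t ht => (hg t (hsub ht)).continuousAt.continuousWithinAt)
    (fun t ht => (hg t (hsub (Set.Ico_subset_Icc_self ht))).hasDerivWithinAt) b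
    (Set.right_mem_Icc.2 hab)).symm

end constancy

/-! ### Submanifolds of constant height -/

section constant_height

variable {n : ℕ} {M : Type*} [TopologicalSpace M] [ChartedSpace (EuclideanSpace ℝ (Fin n)) M]
  {c : SignType} {I : Set ℝ} {w : ℝ → ℝ} {f : M → Flat n × ℝ} {N : M → Flat n} {x : M} {T : ℝ}

/-- When `dτ = 0` the normal condition is homogeneous in `N`, so the two null directions are
opposite. -/
theorem IsNullDir.neg {W : ℝ} {p v : Flat n}
    {A : EuclideanSpace ℝ (Fin n) →L[ℝ] Flat n × ℝ} (hA : ∀ X, (A X).2 = 0)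
    (h : IsNullDir c W p A v) : IsNullDir c W p A (-v) := by
  refine ⟨?_, ?_, fun X => ?_⟩
  · rw [flatInner_neg_right, h.tangent, neg_zero]
  · rw [flatInner_neg_right, flatInner_neg_left, h.unit, neg_neg]
  · rw [flatInner_neg_right, mul_neg, h.normal, hA, neg_zero]

theorem IsNullDir.ne_neg {W : ℝ} {p v : Flat n}
    {A : EuclideanSpace ℝ (Fin n) →L[ℝ] Flat n × ℝ} (h : IsNullDir c W p A v) : v ≠ -v := by
  intro h1
  have h2 := h.unit
  have h3 : flatInner c v v = -flatInner c v v := by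
    nth_rewrite 1 [h1]
    rw [flatInner_neg_left]
  linarith

variable [IsManifold 𝓘(ℝ, EuclideanSpace ℝ (Fin n)) 2 M]

theorem IsSpacelikeImmersion.hasFDerivAt_inChart (hf : IsSpacelikeImmersion c I w f) (x : M) :
    HasFDerivAt (inChart (n := n) f x) (D1 f x) (chartAt (EuclideanSpace ℝ (Fin n)) x x) :=
  ((hf.contDiffAt (mem_chart_source _ x)).differentiableAt two_ne_zero).hasFDerivAt

theorem IsSpacelikeImmersion.D1_fst (hf : IsSpacelikeImmersion c I w f)
    (X : EuclideanSpace ℝ (Fin n)) : D1 (fun y => (f y).1) x X = (D1 f x X).1 :=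
  DFunLike.congr_fun (hf.hasFDerivAt_inChart x).fst.fderiv X

theorem IsSpacelikeImmersion.D1_snd (hf : IsSpacelikeImmersion c I w f)
    (X : EuclideanSpace ℝ (Fin n)) : D1 (fun y => (f y).2) x X = (D1 f x X).2 :=
  DFunLike.congr_fun (hf.hasFDerivAt_inChart x).snd.fderiv X

theorem IsSpacelikeImmersion.D1_snd_eq_zero (hf : IsSpacelikeImmersion c I w f)
    (hT : ∀ y, (f y).2 = T) (X : EuclideanSpace ℝ (Fin n)) : (D1 f x X).2 = 0 := by
  rw [← hf.D1_snd, funext hT]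
  have : fderiv ℝ (inChart (n := n) (fun _ : M => T) x) (chartAt _ x x) = 0 :=
    fderiv_const_apply T
  exact DFunLike.congr_fun this X

theorem NullFieldAt.neg (h : NullFieldAt c w f N x) (hf : IsSpacelikeImmersion c I w f)
    (hT : ∀ y, (f y).2 = T) : NullFieldAt c w f (-N) x :=
  ⟨h.contMDiffAt.neg, h.isNullDir.mono fun _ hy => hy.neg (hf.D1_snd_eq_zero hT)⟩

theorem nullShape_of_constant_height (hf : IsSpacelikeImmersion c I w f)
    (hT : ∀ y, (f y).2 = T) {W W' : ℝ} {p v : Flat n} (X : EuclideanSpace ℝ (Fin n)) :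
    nullShape c W W' p (D1 f x) v X = -W' • (D1 f x X).1 := by
  rw [nullShape_apply, hf.D1_snd_eq_zero hT, zero_smul, add_zero]

/-- With `dτ = 0`, a null direction is a unit normal of `ψ`, and the equation of a null field
reduces to `dN = -w'(T) dψ`. -/
theorem isUmbilicOn_of_nullFrameAt (hf : IsSpacelikeImmersion c I w f) (hI : IsWarping I w)
    (hT : ∀ y, (f y).2 = T) (h : ∀ x, NullFrameAt c w f N x) :
    IsUmbilicOn c (deriv w T) (fun x => (f x).1) N Set.univ where
  contMDiffOn x _ := by
    have hx := mem_chart_source (EuclideanSpace ℝ (Fin n)) x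
    exact ((contMDiffAt_iff_inChart (k := fun y => (f y).1) le_rfl hx).2
      (hf.contDiffAt hx).fst).contMDiffWithinAt
  mem x _ := hf.mem_spaceForm x
  immersion x _ := by
    rw [injective_iff_map_eq_zero]
    intro X hX
    by_contra h0
    rw [hf.D1_fst] at hX
    exact (hf.spacelikeAt hI x).ne_zero h0 hX
  normal_contMDiffOn x _ := (h x).nullFieldAt.contMDiffAt.contMDiffWithinAt
  normal_mem x _ := mem_spaceFormTangent_iff.2 (h x).isNullDir.tangent
  normal_unit x _ := (h x).isNullDir.unit
  normal_orthogonal x _ X := by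
    have h1 := (h x).isNullDir.normal X
    rw [hf.D1_snd_eq_zero hT] at h1
    rw [hf.D1_fst]
    exact (mul_eq_zero.1 h1).resolve_left (hI.pos _ (hf.mem_interval x)).ne'
  shape x _ X := by
    rw [(h x).D1_eq hf hI, nullShape_of_constant_height hf hT, hf.D1_fst, hT, neg_smul]

theorem NullFieldAt.nullAlong_neg_iff (h : NullFieldAt c w f N x)
    (hf : IsSpacelikeImmersion c I w f) (hI : IsWarping I w) (hT : ∀ y, (f y).2 = T) :
    NullAlong c w f x (-N x) ↔
      ∀ X : EuclideanSpace ℝ (Fin n), D1 N x X = deriv w T • (D1 f x X).1 := by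
  have h1 := (h.neg hf hT).nullAlong_iff hf hI
  have h2 : D1 (n := n) (-N) x = -D1 N x := fderiv_neg
  rw [h2] at h1
  refine h1.trans ?_
  rw [ContinuousLinearMap.ext_iff]
  refine forall_congr' fun X => ?_
  rw [nullShape_of_constant_height hf hT, neg_apply, hT, neg_smul, neg_inj]

theorem NullFieldAt.nullAlong_iff_of_constant_height (h : NullFieldAt c w f N x)
    (hf : IsSpacelikeImmersion c I w f) (hI : IsWarping I w) (hT : ∀ y, (f y).2 = T) :
    NullAlong c w f x (N x) ↔
      ∀ X : EuclideanSpace ℝ (Fin n), D1 N x X = -deriv w T • (D1 f x X).1 := by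
  refine (h.nullAlong_iff hf hI).trans ?_
  rw [ContinuousLinearMap.ext_iff]
  refine forall_congr' fun X => ?_
  rw [nullShape_of_constant_height hf hT, hT]

theorem NullFieldAt.nullAlong_or_neg (h : NullFieldAt c w f N x)
    (hf : IsSpacelikeImmersion c I w f) (hI : IsWarping I w) (hT : ∀ y, (f y).2 = T)
    (hnull : HasNullSecondFF c w f) : NullAlong c w f x (N x) ∨ NullAlong c w f x (-N x) :=
  (hf.spacelikeAt hI x).nullAlong_or (hI.differentiableAt (hf.mem_interval x)) (hnull x)
    h.isNullDir.self_of_nhds (h.isNullDir.self_of_nhds.neg (hf.D1_snd_eq_zero hT))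
    h.isNullDir.self_of_nhds.ne_neg

/-- The fields `N` and `-N` would require `dN = -w'(T) dψ` and `dN = w'(T) dψ`, which exclude each
other. The good direction is therefore unique at each point, and as exclusion is open it agrees
locally with a `C¹` field; no orientability is needed. -/
theorem exists_isUmbilicOn_of_deriv_ne_zero (hn : 1 < n) (hf : IsSpacelikeImmersion c I w f)
    (hI : IsWarping I w) (hT : ∀ y, (f y).2 = T) (hnull : HasNullSecondFF c w f)
    (h0 : deriv w T ≠ 0) : ∃ ν, IsUmbilicOn c (deriv w T) (fun x => (f x).1) ν Set.univ := by
  -- A nonzero tangent vector is needed to tell the two equations apart.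
  have : Nonempty (Fin n) := ⟨⟨0, by omega⟩⟩
  obtain ⟨X₀, hX₀⟩ := exists_ne (0 : EuclideanSpace ℝ (Fin n))
  have hexcl : ∀ {N : M → Flat n} {x : M}, NullFieldAt c w f N x → NullAlong c w f x (N x) →
      ¬ NullAlong c w f x (-N x) := by
    intro N x h h1 h2
    rw [h.nullAlong_iff_of_constant_height hf hI hT] at h1
    rw [h.nullAlong_neg_iff hf hI hT] at h2
    have h3 := (h1 X₀).symm.trans (h2 X₀)
    have h4 : (2 : ℝ) • deriv w T • (D1 f x X₀).1 = 0 := by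
      rw [two_smul]
      nth_rewrite 1 [← h3]
      module
    exact (hf.spacelikeAt hI x).ne_zero hX₀ ((smul_eq_zero.1
      ((smul_eq_zero.1 h4).resolve_left two_ne_zero)).resolve_left h0)
  have hex : ∀ x, ∃ v, IsNullDir c (w (f x).2) (f x).1 (D1 (n := n) f x) v ∧
      NullAlong c w f x v := by
    intro x
    obtain ⟨v, -, hv, -⟩ := (hf.spacelikeAt hI x).exists_nullDir_pair
    obtain ⟨N, hN, rfl, -⟩ := hf.exists_nullFieldAt hI hv
    rcases hN.nullAlong_or_neg hf hI hT hnull with h | h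
    · exact ⟨_, hv, h⟩
    · exact ⟨_, hv.neg (hf.D1_snd_eq_zero hT), h⟩
  choose ν hν1 hν2 using hex
  refine ⟨ν, isUmbilicOn_of_nullFrameAt hf hI hT fun x => ?_⟩
  obtain ⟨N, hN, hNx, -⟩ := hf.exists_nullFieldAt hI (hν1 x)
  have h1 : NullAlong c w f x (N x) := by rw [hNx]; exact hν2 x
  have h2 : ∀ᶠ y in 𝓝 x, ν y = N y := by
    filter_upwards [hN.eventually,
      (hN.neg hf hT).eventually_not_nullAlong hf hI (hexcl hN h1)] with y hy hy2
    have hd := hy.isNullDir.self_of_nhds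
    refine ((hf.spacelikeAt hI y).eq_or_eq hd (hd.neg (hf.D1_snd_eq_zero hT)) hd.ne_neg
      (hν1 y)).resolve_right fun h3 => ?_
    have h4 := hν2 y
    rw [h3] at h4
    exact hy2 h4
  exact ⟨⟨hN.contMDiffAt.congr_of_eventuallyEq h2, Filter.Eventually.of_forall hν1⟩,
    Filter.Eventually.of_forall hν2⟩

/-- Both alternatives now say `dN = 0`, so `h` does not select a sign; but null fields are locally
constant vectors. The points where a fixed vector `m` is a null direction form a clopen set, so `m`
is a global Gauss map. -/
theorem exists_isUmbilicOn_of_deriv_eq_zero [ConnectedSpace M]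
    (hf : IsSpacelikeImmersion c I w f)
    (hI : IsWarping I w) (hT : ∀ y, (f y).2 = T) (hnull : HasNullSecondFF c w f)
    (h0 : deriv w T = 0) : ∃ ν, IsUmbilicOn c (deriv w T) (fun x => (f x).1) ν Set.univ := by
  have hD : ∀ {N : M → Flat n} {x : M}, NullFieldAt c w f N x →
      NullAlong c w f x (N x) ∧ D1 (n := n) N x = 0 := by
    intro N x h
    have h1 := h.nullAlong_iff_of_constant_height hf hI hT
    have h2 := h.nullAlong_neg_iff hf hI hT
    simp only [h0, neg_zero, zero_smul] at h1 h2
    have h3 : ∀ X, D1 (n := n) N x X = 0 := (h.nullAlong_or_neg hf hI hT hnull).elim h1.1 h2.1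
    exact ⟨h1.2 h3, ContinuousLinearMap.ext h3⟩
  have hconst : ∀ {N : M → Flat n} {x : M}, NullFieldAt c w f N x →
      ∀ᶠ y in 𝓝 x, N y = N x := fun h =>
    eventually_eq_of_D1_eq_zero (h.eventually.mono fun y hy => hy.contMDiffAt)
      (h.eventually.mono fun y hy => (hD hy).2)
  obtain ⟨x₀⟩ : Nonempty M := inferInstance
  obtain ⟨m, -, hm, -⟩ := (hf.spacelikeAt hI x₀).exists_nullDir_pair
  have hclopen : IsClopen {x | IsNullDir c (w (f x).2) (f x).1 (D1 (n := n) f x) m} := by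
    constructor
    -- If `m` were a null direction at `y` near `x`, it would be `±N y = ±N x`, a null direction at
    -- `x`.
    · rw [← isOpen_compl_iff, isOpen_iff_mem_nhds]
      intro x hx
      obtain ⟨v, -, hv, -⟩ := (hf.spacelikeAt hI x).exists_nullDir_pair
      obtain ⟨N, hN, rfl, -⟩ := hf.exists_nullFieldAt hI hv
      filter_upwards [hconst hN, hN.isNullDir] with y hy1 hy2 hy3
      rw [hy1] at hy2
      refine hx ?_
      rcases (hf.spacelikeAt hI y).eq_or_eq hy2 (hy2.neg (hf.D1_snd_eq_zero hT)) hy2.ne_neg hy3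
        with h | h
      · rw [h]; exact hv
      · rw [h]; exact hv.neg (hf.D1_snd_eq_zero hT)
    · rw [isOpen_iff_mem_nhds]
      intro x hx
      obtain ⟨N, hN, hNx, -⟩ := hf.exists_nullFieldAt hI hx
      filter_upwards [hconst hN, hN.isNullDir] with y hy1 hy2
      rw [hy1, hNx] at hy2
      exact hy2
  have huniv := hclopen.eq_univ ⟨x₀, hm⟩
  have hall : ∀ x, IsNullDir c (w (f x).2) (f x).1 (D1 (n := n) f x) m := fun x =>
    huniv.symm.subset (Set.mem_univ x)
  have hfield : ∀ x, NullFieldAt c w f (fun _ => m) x := fun x =>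
    ⟨contMDiffAt_const, Filter.Eventually.of_forall hall⟩
  exact ⟨fun _ => m, isUmbilicOn_of_nullFrameAt hf hI hT fun x =>
    ⟨hfield x, Filter.Eventually.of_forall fun y => (hD (hfield y)).1⟩⟩

end constant_height

/-! ### Nonconstant height and the equation `w w'' - w'² = c` -/

section nonconstant_height

variable {n : ℕ} {M : Type*} [TopologicalSpace M] [ChartedSpace (EuclideanSpace ℝ (Fin n)) M]
  [IsManifold 𝓘(ℝ, EuclideanSpace ℝ (Fin n)) 2 M]
  {c : SignType} {I : Set ℝ} {w : ℝ → ℝ} {f : M → Flat n × ℝ} {x : M}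

/-- At points with a null frame this is the integrability condition. Such points are dense and `dτ`
is continuous, so it passes to all points. -/
theorem IsSpacelikeImmersion.D1_height_eq_zero (hf : IsSpacelikeImmersion c I w f) (hn : 1 < n)
    (hI : IsWarping I w) (hnull : HasNullSecondFF c w f)
    (hG : ∀ᶠ y in 𝓝 x, deriv (deriv w) (f y).2 * w (f y).2 - deriv w (f y).2 ^ 2 - c ≠ 0)
    (X : EuclideanSpace ℝ (Fin n)) : (D1 f x X).2 = 0 := by
  by_contra h
  have hx := mem_chart_source (EuclideanSpace ℝ (Fin n)) x
  have hc : ContinuousAt (fun q => (fderiv ℝ (inChart (n := n) f x) q X).2)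
      (chartAt (EuclideanSpace ℝ (Fin n)) x x) :=
    ((((hf.contDiffAt hx).fderiv_right (m := 0) (by norm_num)).continuousAt).clm_apply
      continuousAt_const).snd
  have h1 := ((chartAt (EuclideanSpace ℝ (Fin n)) x).continuousAt hx).eventually
    (hc.eventually_ne h)
  obtain ⟨y, ⟨⟨hy1, hy2⟩, hy3⟩, N, hN⟩ := hf.exists_nullFrameAt hI hnull x
    (Filter.inter_mem (Filter.inter_mem h1 hG) (eventually_mem_source hx))
  obtain ⟨Y, hY⟩ := (coordChange_bijective hy3).2 X
  have h2 := hN.D1_height_eq_zero hn hf hI hy2 Y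
  rw [hf.D1_eq hy3, ContinuousLinearMap.comp_apply, hY] at h2
  exact hy1 h2

/-- If the height is not constant, the warping function satisfies `w w'' - w'² = c` at all the
heights attained. -/
theorem IsSpacelikeImmersion.warping_equation [ConnectedSpace M]
    (hf : IsSpacelikeImmersion c I w f) (hn : 1 < n) (hI : IsWarping I w)
    (hnull : HasNullSecondFF c w f) (hne : ∃ x y, (f x).2 ≠ (f y).2) (x : M) :
    deriv (deriv w) (f x).2 * w (f x).2 - deriv w (f x).2 ^ 2 - c = 0 := by
  by_contra hG
  have hcont : ∀ y, ContinuousAt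
      (fun y => deriv (deriv w) (f y).2 * w (f y).2 - deriv w (f y).2 ^ 2 - c) y := by
    intro y
    have hm := hf.mem_interval y
    have hfc : ContinuousAt (fun y => (f y).2) y := hf.contMDiff.continuous.continuousAt.snd
    have h0 := ContinuousAt.comp (f := fun y => (f y).2) (x := y) (g := w)
      (hI.differentiableAt hm).continuousAt hfc
    have h1 := ContinuousAt.comp (f := fun y => (f y).2) (x := y) (g := deriv w)
      (hI.contDiffAt_deriv hm).continuousAt hfc
    have h2 : ContinuousAt (deriv (deriv w)) (f y).2 :=
      ((contDiffOn_infty_iff_deriv_of_isOpen hI.isOpen |>.1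
        (contDiffOn_infty_iff_deriv_of_isOpen hI.isOpen |>.1 hI.contDiffOn).2).2.continuousOn
        ).continuousAt (hI.isOpen.mem_nhds hm)
    have h3 := ContinuousAt.comp (f := fun y => (f y).2) (x := y) (g := deriv (deriv w)) h2 hfc
    exact ((h3.mul h0).sub (h1.pow 2)).sub continuousAt_const
  -- The defect `w w'' - w'² - c` depends only on the height, so it is nonzero around every point of
  -- the level set through `x`. There `dτ = 0`, so that level set is open as well as closed.
  have hclopen : IsClopen {y | (f y).2 = (f x).2} := by
    refine ⟨isClosed_eq hf.contMDiff.continuous.snd continuous_const, ?_⟩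
    rw [isOpen_iff_mem_nhds]
    intro y hy
    have hy' : (f y).2 = (f x).2 := hy
    have hGy : ∀ᶠ z in 𝓝 y,
        deriv (deriv w) (f z).2 * w (f z).2 - deriv w (f z).2 ^ 2 - c ≠ 0 :=
      (hcont y).eventually_ne (by rwa [hy'])
    have h1 : ∀ᶠ z in 𝓝 y, (f z).2 = (f y).2 := by
      refine eventually_eq_of_D1_eq_zero (n := n) (k := fun z => (f z).2)
        (Filter.Eventually.of_forall fun z => ?_) ?_
      · have hz := mem_chart_source (EuclideanSpace ℝ (Fin n)) z
        exact (contMDiffAt_iff_inChart (k := fun z => (f z).2) one_le_two hz).2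
          ((hf.contDiffAt hz).snd.of_le one_le_two)
      · filter_upwards [hGy.eventually_nhds] with z hz
        ext1 X
        rw [hf.D1_snd]
        exact hf.D1_height_eq_zero hn hI hnull hz X
    filter_upwards [h1] with z hz
    exact hz.trans hy'
  have huniv := hclopen.eq_univ ⟨x, rfl⟩
  obtain ⟨y, z, hyz⟩ := hne
  have hall : ∀ y, (f y).2 = (f x).2 := fun y => huniv.symm.subset (Set.mem_univ y)
  exact hyz ((hall y).trans (hall z).symm)

/-- The derivatives are `si(θ) / w²` and `co(θ) / w²` times `w w'' - w'² - c`. -/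
theorem IsWarping.hasDerivAt_shiftFactor_div {t₀ t : ℝ} (hI : IsWarping I w)
    (hIc : I.OrdConnected) (h₀ : t₀ ∈ I) (ht : t ∈ I)
    (hG : deriv (deriv w) t * w t - deriv w t ^ 2 - c = 0) :
    HasDerivAt (fun t => shiftFactor c w t₀ t / w t) 0 t ∧
      HasDerivAt (fun t => shiftCofactor c w t₀ t / w t) 0 t := by
  have hθ := hI.hasDerivAt_theta hIc h₀ ht
  have hw := (hI.differentiableAt ht).hasDerivAt
  have hw' := ((hI.contDiffAt_deriv ht).differentiableAt (by simp)).hasDerivAt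
  have h0 := (hI.pos t ht).ne'
  have hco := (hasDerivAt_co c (theta w t₀ t)).comp t hθ
  have hsi := (hasDerivAt_si c (theta w t₀ t)).comp t hθ
  constructor
  · refine ((hco.add (hw'.mul hsi)).div hw h0).congr_deriv ?_
    simp only [Function.comp_apply, Pi.add_apply, Pi.mul_apply]
    field_simp
    linear_combination si c (theta w t₀ t) * hG
  · refine (((hw'.mul hco).sub (hsi.const_mul (c : ℝ))).div hw h0).congr_deriv ?_
    simp only [Function.comp_apply, Pi.sub_apply, Pi.mul_apply]
    field_simp
    linear_combination co c (theta w t₀ t) * hG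

end nonconstant_height

/-! ### The converse: `nullShift` has null second fundamental form -/

section converse

variable {n : ℕ} {M : Type*} [TopologicalSpace M] [ChartedSpace (EuclideanSpace ℝ (Fin n)) M]
  {c : SignType} {w : ℝ → ℝ}

theorem SecondFFCollinearOn.hasNullSecondFF {f ξ : M → Flat n × ℝ}
    (h : SecondFFCollinearOn c w f ξ Set.univ) : HasNullSecondFF c w f := by
  intro x X Y
  obtain ⟨a, ha⟩ := h.collinear x (Set.mem_univ x) X Y
  refine ⟨_, ha, ?_⟩
  have h1 : w (f x).2 ^ 2 * flatInner c (ξ x).1 (ξ x).1 - (ξ x).2 * (ξ x).2 = 0 :=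
    h.null x (Set.mem_univ x)
  simp only [warpedMetric, Prod.smul_fst, Prod.smul_snd, smul_eq_mul, flatInner_smul_left,
    flatInner_smul_right]
  linear_combination a ^ 2 * h1

variable [IsManifold 𝓘(ℝ, EuclideanSpace ℝ (Fin n)) 2 M]
  {I : Set ℝ} {t₀ C₀ : ℝ} {φ ν : M → Flat n} {τ : M → ℝ}

/-- The Gauss map is only assumed `C¹`, but `dν = -C₀ dφ` is `C¹`; this is needed for `nullShift` to
be `C²`. -/
theorem IsUmbilicOn.contMDiffAt_normal (h : IsUmbilicOn c C₀ φ ν Set.univ) (x : M) :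
    ContMDiffAt 𝓘(ℝ, EuclideanSpace ℝ (Fin n)) 𝓘(ℝ, Flat n) 2 ν x := by
  have hx := mem_chart_source (EuclideanSpace ℝ (Fin n)) x
  have hφ : ∀ y, y ∈ (chartAt (EuclideanSpace ℝ (Fin n)) x).source →
      ContDiffAt ℝ 2 (inChart (n := n) φ x) (chartAt (EuclideanSpace ℝ (Fin n)) x y) :=
    fun y hy => (contMDiffAt_iff_inChart le_rfl hy).1
      (h.contMDiffOn.contMDiffAt Filter.univ_mem)
  have hν : ∀ y, y ∈ (chartAt (EuclideanSpace ℝ (Fin n)) x).source →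
      ContDiffAt ℝ 1 (inChart (n := n) ν x) (chartAt (EuclideanSpace ℝ (Fin n)) x y) :=
    fun y hy => (contMDiffAt_iff_inChart one_le_two hy).1
      (h.normal_contMDiffOn.contMDiffAt Filter.univ_mem)
  have hd : ∀ᶠ q in 𝓝 (chartAt (EuclideanSpace ℝ (Fin n)) x x),
      HasFDerivAt (inChart (n := n) ν x) (-(C₀ • fderiv ℝ (inChart (n := n) φ x) q)) q := by
    filter_upwards [eventually_mem_target hx] with q hq
    have hs := (chartAt (EuclideanSpace ℝ (Fin n)) x).map_target hq
    have h1 := (hφ _ hs).differentiableAt two_ne_zero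
    have h2 := (hν _ hs).differentiableAt one_ne_zero
    have h3 := h.shape _ (Set.mem_univ ((chartAt (EuclideanSpace ℝ (Fin n)) x).symm q))
    rw [D1_eq_comp_coordChange hs h1, D1_eq_comp_coordChange hs h2,
      OpenPartialHomeomorph.right_inv _ hq] at h3
    rw [OpenPartialHomeomorph.right_inv _ hq] at h2
    refine h2.hasFDerivAt.congr_fderiv (ContinuousLinearMap.ext fun X => ?_)
    obtain ⟨Y, rfl⟩ := (coordChange_bijective hs).2 X
    exact h3 Y
  rw [contMDiffAt_iff_inChart le_rfl hx]
  have h1 := (contDiffAt_succ_iff_hasFDerivAt (n := 1)).2 ⟨_, ⟨_, hd, fun q hq => hq⟩,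
    (((hφ x hx).fderiv_right (m := 1) (by norm_num)).const_smul C₀).neg⟩
  rwa [show ((1 : ℕ) : ℕ∞ω) + 1 = 2 by rw [Nat.cast_one, one_add_one_eq_two]] at h1

/-- The null normal direction of `nullShift`. -/
def shiftNormal (c : SignType) (w : ℝ → ℝ) (t₀ : ℝ) (φ ν : M → Flat n) (τ : M → ℝ) (x : M) :
    Flat n :=
  geodesicVelocity c (theta w t₀ (τ x)) (φ x) (ν x)

theorem contMDiffAt_nullShift (hI : IsWarping I w) (hIc : I.OrdConnected) (h₀ : t₀ ∈ I)
    (h : IsUmbilicOn c C₀ φ ν Set.univ)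
    (hτ : ContMDiff 𝓘(ℝ, EuclideanSpace ℝ (Fin n)) 𝓘(ℝ, ℝ) 2 τ) (hm : ∀ x, τ x ∈ I) (x : M) :
    ContMDiffAt 𝓘(ℝ, EuclideanSpace ℝ (Fin n)) 𝓘(ℝ, Flat n × ℝ) 2 (nullShift c w t₀ φ ν τ) x ∧
      ContMDiffAt 𝓘(ℝ, EuclideanSpace ℝ (Fin n)) 𝓘(ℝ, Flat n) 2 (shiftNormal c w t₀ φ ν τ) x := by
  have hx := mem_chart_source (EuclideanSpace ℝ (Fin n)) x
  have h1 := (contMDiffAt_iff_inChart le_rfl hx).1 (h.contMDiffOn.contMDiffAt Filter.univ_mem)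
  have h2 := (contMDiffAt_iff_inChart le_rfl hx).1 (h.contMDiffAt_normal x)
  have h3 := (contMDiffAt_iff_inChart le_rfl hx).1 hτ.contMDiffAt
  have h4 : ContDiffAt ℝ 2 (theta w t₀)
      (inChart (n := n) τ x (chartAt (EuclideanSpace ℝ (Fin n)) x x)) := by
    rw [inChart_apply τ hx]
    exact (hI.contDiffAt_theta hIc h₀ (hm x)).of_le ENat.LEInfty.out
  have h5 := h4.comp _ h3
  exact ⟨(contMDiffAt_iff_inChart le_rfl hx).2 ((contDiffAt_geodesic le_rfl h1 h2 h5).prodMk h3),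
    (contMDiffAt_iff_inChart le_rfl hx).2 (contDiffAt_geodesicVelocity le_rfl h1 h2 h5)⟩

theorem D1_nullShift (hI : IsWarping I w) (hIc : I.OrdConnected) (h₀ : t₀ ∈ I)
    (h : IsUmbilicOn c C₀ φ ν Set.univ)
    (hτ : ContMDiff 𝓘(ℝ, EuclideanSpace ℝ (Fin n)) 𝓘(ℝ, ℝ) 2 τ) (hm : ∀ x, τ x ∈ I) (x : M)
    (X : EuclideanSpace ℝ (Fin n)) :
    (D1 (nullShift c w t₀ φ ν τ) x X).1 =
        (co c (theta w t₀ (τ x)) - C₀ * si c (theta w t₀ (τ x))) • D1 φ x X +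
          (D1 τ x X / w (τ x)) • shiftNormal c w t₀ φ ν τ x ∧
      (D1 (nullShift c w t₀ φ ν τ) x X).2 = D1 τ x X ∧
      D1 (shiftNormal c w t₀ φ ν τ) x X =
        -((c : ℝ) * si c (theta w t₀ (τ x)) + C₀ * co c (theta w t₀ (τ x))) • D1 φ x X -
          ((c : ℝ) * (D1 τ x X / w (τ x))) • (nullShift c w t₀ φ ν τ x).1 := by
  have hx := mem_chart_source (EuclideanSpace ℝ (Fin n)) x
  have h1 : HasFDerivAt (inChart (n := n) φ x) (D1 φ x) (chartAt _ x x) :=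
    (((contMDiffAt_iff_inChart le_rfl hx).1
      (h.contMDiffOn.contMDiffAt Filter.univ_mem)).differentiableAt two_ne_zero).hasFDerivAt
  have h2 : HasFDerivAt (inChart (n := n) ν x) (D1 ν x) (chartAt _ x x) :=
    (((contMDiffAt_iff_inChart le_rfl hx).1
      (h.contMDiffAt_normal x)).differentiableAt two_ne_zero).hasFDerivAt
  have h3 : HasFDerivAt (inChart (n := n) τ x) (D1 τ x) (chartAt _ x x) :=
    (((contMDiffAt_iff_inChart le_rfl hx).1
      hτ.contMDiffAt).differentiableAt two_ne_zero).hasFDerivAt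
  have hθ : HasDerivAt (theta w t₀) (w (τ x))⁻¹
      (inChart (n := n) τ x (chartAt (EuclideanSpace ℝ (Fin n)) x x)) := by
    rw [inChart_apply τ hx]
    exact hI.hasDerivAt_theta hIc h₀ (hm x)
  have h5 := hθ.comp_hasFDerivAt _ h3
  have hf : HasFDerivAt (inChart (n := n) (nullShift c w t₀ φ ν τ) x)
      (D1 (nullShift c w t₀ φ ν τ) x) (chartAt _ x x) :=
    (((contMDiffAt_iff_inChart le_rfl hx).1
      (contMDiffAt_nullShift hI hIc h₀ h hτ hm x).1).differentiableAt two_ne_zero).hasFDerivAt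
  have e1 := fderiv_geodesic (c := c) h1 h2 h5 X
  have e2 : D1 (shiftNormal c w t₀ φ ν τ) x X = _ := fderiv_geodesicVelocity (c := c) h1 h2 h5 X
  have e3 := DFunLike.congr_fun hf.fst.fderiv X
  have e4 := DFunLike.congr_fun hf.snd.fderiv X
  have eφ := inChart_apply (n := n) φ hx
  have eν := inChart_apply (n := n) ν hx
  have eτ := inChart_apply (n := n) τ hx
  have hs := h.shape x (Set.mem_univ x) X
  refine ⟨e3.symm.trans (e1.trans ?_), e4.symm, e2.trans ?_⟩
  · simp only [Function.comp_apply, eφ, eν, eτ, smul_apply, smul_eq_mul, hs, geodesic,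
      shiftNormal]
    module
  · simp only [Function.comp_apply, eφ, eν, eτ, smul_apply, smul_eq_mul, hs, geodesic,
      nullShift, geodesicVelocity]
    module

/-- Replacing `C₀ P` by `R`, the product is `co(θ) P - si(θ) R = co(θ)² + c si(θ)²`. In particular
the coefficient of `dφ` in the differential of `nullShift` does not vanish. -/
theorem mul_shiftFactor_eq_one {t : ℝ}
    (hR : shiftCofactor c w t₀ t = C₀ * shiftFactor c w t₀ t) :
    (co c (theta w t₀ t) - C₀ * si c (theta w t₀ t)) * shiftFactor c w t₀ t = 1 := by
  have h1 := co_sq_add_si_sq c (theta w t₀ t)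
  rw [sub_mul, mul_right_comm, ← hR, shiftFactor, shiftCofactor]
  linear_combination h1

/-- This identity matches the coefficient of `dφ` in the derivative of `shiftNormal` with the one
that `nullShape` demands. -/
theorem deriv_mul_eq {t : ℝ} (hR : shiftCofactor c w t₀ t = C₀ * shiftFactor c w t₀ t) :
    deriv w t * (co c (theta w t₀ t) - C₀ * si c (theta w t₀ t)) =
      (c : ℝ) * si c (theta w t₀ t) + C₀ * co c (theta w t₀ t) := by
  have h1 := co_sq_add_si_sq c (theta w t₀ t)
  have h2 := mul_shiftFactor_eq_one hR
  have hP : shiftFactor c w t₀ t ≠ 0 := right_ne_zero_of_mul_eq_one h2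
  refine mul_right_cancel₀ hP ?_
  rw [mul_assoc, h2]
  simp only [shiftFactor, shiftCofactor] at hR ⊢
  linear_combination -deriv w t * h1 + co c (theta w t₀ t) * hR

/-- The terms in `dτ` point along the null vector, which is orthogonal to the remaining part, so
they do not contribute to the induced metric. That metric is `w² (co(θ) - C₀ si(θ))²` times the
metric of `φ`; this is why `τ` may be arbitrary. -/
theorem isSpacelikeImmersion_nullShift (hI : IsWarping I w) (hIc : I.OrdConnected) (h₀ : t₀ ∈ I)
    (h : IsUmbilicOn c C₀ φ ν Set.univ)
    (hτ : ContMDiff 𝓘(ℝ, EuclideanSpace ℝ (Fin n)) 𝓘(ℝ, ℝ) 2 τ) (hm : ∀ x, τ x ∈ I)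
    (hR : ∀ x, shiftCofactor c w t₀ (τ x) = C₀ * shiftFactor c w t₀ (τ x)) :
    IsSpacelikeImmersion c I w (nullShift c w t₀ φ ν τ) ∧
      ∀ x, IsNullDir c (w (τ x)) (nullShift c w t₀ φ ν τ x).1 (D1 (nullShift c w t₀ φ ν τ) x)
        (shiftNormal c w t₀ φ ν τ x) := by
  have horth : ∀ x (X : EuclideanSpace ℝ (Fin n)),
      flatInner c (D1 φ x X) (shiftNormal c w t₀ φ ν τ x) = 0 ∧
        D1 φ x X ∈ spaceFormTangent c (φ x) := by
    intro x X
    have hx := mem_chart_source (EuclideanSpace ℝ (Fin n)) x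
    have hd := ((contMDiffAt_iff_inChart le_rfl hx).1
      (h.contMDiffOn.contMDiffAt Filter.univ_mem)).differentiableAt two_ne_zero
    have h1 := flatInner_conormal_fderiv (c := c) hd
      (Filter.Eventually.of_forall fun q => h.mem _ (Set.mem_univ _)) X
    rw [inChart_apply φ hx] at h1
    have ht : D1 φ x X ∈ spaceFormTangent c (φ x) := mem_spaceFormTangent_iff.2 h1
    refine ⟨?_, ht⟩
    have h2 := flatInner_conormal_left ht
    rw [flatInner_comm] at h2
    simp only [shiftNormal, geodesicVelocity, flatInner_add_right, flatInner_smul_right,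
      h.normal_orthogonal x (Set.mem_univ x) X]
    linear_combination -si c (theta w t₀ (τ x)) * h2
  have hunit : ∀ x, flatInner c (shiftNormal c w t₀ φ ν τ x) (shiftNormal c w t₀ φ ν τ x) = 1 :=
    fun x => flatInner_rotate_self (h.mem x (Set.mem_univ x)) (h.normal_mem x (Set.mem_univ x))
      (h.normal_unit x (Set.mem_univ x)) _
  refine ⟨⟨fun x => (contMDiffAt_nullShift hI hIc h₀ h hτ hm x).1, fun x => ?_, hm,
    fun x X hX => ?_⟩, fun x => ⟨?_, hunit x, fun X => ?_⟩⟩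
  · exact rotate_mem_spaceForm (h.mem x (Set.mem_univ x)) (h.normal_mem x (Set.mem_univ x))
      (h.normal_unit x (Set.mem_univ x)) _
  · obtain ⟨e1, e2, -⟩ := D1_nullShift hI hIc h₀ h hτ hm x X
    obtain ⟨h1, h2⟩ := horth x X
    have h3 : D1 φ x X ≠ 0 := fun h3 =>
      hX (h.immersion x (Set.mem_univ x) (h3.trans (map_zero _).symm))
    have h4 := flatInner_self_pos (h.mem x (Set.mem_univ x)) h2 h3
    have h5 := left_ne_zero_of_mul_eq_one (mul_shiftFactor_eq_one (hR x))
    have hW := hI.pos _ (hm x)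
    have h6 : warpedMetric c w (nullShift c w t₀ φ ν τ x) (D1 (nullShift c w t₀ φ ν τ) x X)
        (D1 (nullShift c w t₀ φ ν τ) x X) = w (τ x) ^ 2 *
          ((co c (theta w t₀ (τ x)) - C₀ * si c (theta w t₀ (τ x))) ^ 2 *
            flatInner c (D1 φ x X) (D1 φ x X)) := by
      rw [warpedMetric, e1, e2]
      simp only [flatInner_add_left, flatInner_add_right, flatInner_smul_left,
        flatInner_smul_right, flatInner_comm c (shiftNormal c w t₀ φ ν τ x), h1, hunit]
      change w (τ x) ^ 2 * _ - _ = _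
      field_simp
      ring
    rw [h6]
    positivity
  · exact mem_spaceFormTangent_iff.1 (rotate_mem_spaceFormTangent (h.mem x (Set.mem_univ x))
      (h.normal_mem x (Set.mem_univ x)) (h.normal_unit x (Set.mem_univ x)) _)
  · obtain ⟨e1, e2, -⟩ := D1_nullShift hI hIc h₀ h hτ hm x X
    have hW := (hI.pos _ (hm x)).ne'
    rw [e1, e2]
    simp only [flatInner_add_left, flatInner_smul_left, (horth x X).1, hunit]
    field_simp
    ring

theorem nullAlong_nullShift (hI : IsWarping I w) (hIc : I.OrdConnected) (h₀ : t₀ ∈ I)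
    (h : IsUmbilicOn c C₀ φ ν Set.univ)
    (hτ : ContMDiff 𝓘(ℝ, EuclideanSpace ℝ (Fin n)) 𝓘(ℝ, ℝ) 2 τ) (hm : ∀ x, τ x ∈ I)
    (hR : ∀ x, shiftCofactor c w t₀ (τ x) = C₀ * shiftFactor c w t₀ (τ x)) (x : M) :
    NullAlong c w (nullShift c w t₀ φ ν τ) x (shiftNormal c w t₀ φ ν τ x) := by
  obtain ⟨hf, hN⟩ := isSpacelikeImmersion_nullShift hI hIc h₀ h hτ hm hR
  have hfield : NullFieldAt c w (nullShift c w t₀ φ ν τ) (shiftNormal c w t₀ φ ν τ) x :=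
    ⟨(contMDiffAt_nullShift hI hIc h₀ h hτ hm x).2.of_le one_le_two,
      Filter.Eventually.of_forall hN⟩
  refine (hfield.nullAlong_iff hf hI).2 (ContinuousLinearMap.ext fun X => ?_)
  obtain ⟨e1, e2, e3⟩ := D1_nullShift hI hIc h₀ h hτ hm x X
  have ef : (nullShift c w t₀ φ ν τ x).2 = τ x := rfl
  rw [nullShape_apply, e1, e2, e3, ← deriv_mul_eq (hR x), ef]
  module

theorem secondFFCollinearOn_nullShift (hI : IsWarping I w) (hIc : I.OrdConnected) (h₀ : t₀ ∈ I)
    (h : IsUmbilicOn c C₀ φ ν Set.univ)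
    (hτ : ContMDiff 𝓘(ℝ, EuclideanSpace ℝ (Fin n)) 𝓘(ℝ, ℝ) 2 τ) (hm : ∀ x, τ x ∈ I)
    (hR : ∀ x, shiftCofactor c w t₀ (τ x) = C₀ * shiftFactor c w t₀ (τ x)) :
    SecondFFCollinearOn c w (nullShift c w t₀ φ ν τ)
      (fun x => (shiftNormal c w t₀ φ ν τ x, w (τ x))) Set.univ := by
  obtain ⟨hf, hN⟩ := isSpacelikeImmersion_nullShift hI hIc h₀ h hτ hm hR
  refine ⟨?_, fun x _ hx => ?_, fun x _ => (hN x).mem_normalSpace, fun x _ => ?_,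
    fun x _ X Y => ?_⟩
  · refine Continuous.continuousOn (continuous_iff_continuousAt.2 fun x => ?_)
    exact (contMDiffAt_nullShift hI hIc h₀ h hτ hm x).2.continuousAt.prodMk
      (ContinuousAt.comp (g := w) (hI.differentiableAt (hm x)).continuousAt
        hτ.continuous.continuousAt)
  · exact (hI.pos _ (hm x)).ne' (congrArg Prod.snd hx)
  · rw [warpedMetric, (hN x).unit]
    change w (τ x) ^ 2 * 1 - _ = 0
    ring
  · exact (hf.spacelikeAt hI x).exists_isSecondFF (hI.differentiableAt (hm x)) (hN x)
      (nullAlong_nullShift hI hIc h₀ h hτ hm hR x) X Y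

end converse

/-! ### Constancy of `Ω` on the interval of heights -/

section structure_theorem

variable {n : ℕ} {M : Type*} [TopologicalSpace M] [ConnectedSpace M]
  [ChartedSpace (EuclideanSpace ℝ (Fin n)) M]
  [IsManifold 𝓘(ℝ, EuclideanSpace ℝ (Fin n)) 2 M]
  {c : SignType} {I : Set ℝ} {w : ℝ → ℝ} {f : M → Flat n × ℝ} {t₀ : ℝ}

/-- The heights form an interval because `M` is connected, and on it `P/w` and `R/w` are constant.
So `P` vanishes nowhere once it is nonzero at one height, and `C₀` is the ratio of the two
constants. -/
theorem IsSpacelikeImmersion.exists_shiftCofactor_eq (hf : IsSpacelikeImmersion c I w f)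
    (hn : 1 < n) (hI : IsWarping I w) (hIc : I.OrdConnected) (hnull : HasNullSecondFF c w f)
    (hne : ∃ x y, (f x).2 ≠ (f y).2) (h₀ : t₀ ∈ I) {x : M}
    (hx : shiftFactor c w t₀ (f x).2 ≠ 0) :
    ∃ C₀ : ℝ, ∀ y, shiftFactor c w t₀ (f y).2 ≠ 0 ∧
      shiftCofactor c w t₀ (f y).2 = C₀ * shiftFactor c w t₀ (f y).2 := by
  have hJ : (Set.range fun y => (f y).2).OrdConnected :=
    (isPreconnected_range hf.contMDiff.continuous.snd).ordConnected
  have hd : ∀ t ∈ Set.range fun y => (f y).2,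
      HasDerivAt (fun t => shiftFactor c w t₀ t / w t) 0 t ∧
        HasDerivAt (fun t => shiftCofactor c w t₀ t / w t) 0 t := by
    rintro _ ⟨y, rfl⟩
    exact hI.hasDerivAt_shiftFactor_div hIc h₀ (hf.mem_interval y)
      (hf.warping_equation hn hI hnull hne y)
  have hW : ∀ y, w (f y).2 ≠ 0 := fun y => (hI.pos _ (hf.mem_interval y)).ne'
  have hP : ∀ y, shiftFactor c w t₀ (f y).2 / w (f y).2 =
      shiftFactor c w t₀ (f x).2 / w (f x).2 := fun y =>
    eq_of_hasDerivAt_zero hJ (fun t ht => (hd t ht).1) ⟨y, rfl⟩ ⟨x, rfl⟩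
  have hR : ∀ y, shiftCofactor c w t₀ (f y).2 / w (f y).2 =
      shiftCofactor c w t₀ (f x).2 / w (f x).2 := fun y =>
    eq_of_hasDerivAt_zero hJ (fun t ht => (hd t ht).2) ⟨y, rfl⟩ ⟨x, rfl⟩
  refine ⟨shiftCofactor c w t₀ (f x).2 / shiftFactor c w t₀ (f x).2, fun y => ?_⟩
  have h1 := hP y
  have h2 := hR y
  have h3 := hW x
  have h4 := hW y
  have h5 : shiftFactor c w t₀ (f y).2 ≠ 0 := by
    intro h5
    rw [h5, zero_div, eq_comm, div_eq_zero_iff] at h1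
    exact h1.elim hx h3
  refine ⟨h5, ?_⟩
  rw [div_eq_div_iff h4 h3] at h1 h2
  field_simp
  refine mul_right_cancel₀ (mul_ne_zero h3 h4) ?_
  linear_combination w (f y).2 * shiftFactor c w t₀ (f x).2 * h2 -
    w (f y).2 * shiftCofactor c w t₀ (f x).2 * h1

end structure_theorem

end RW

end

/-! ### The theorem -/

theorem theorem1 (n : ℕ) (hn : 1 < n) (c : SignType) (I : Set ℝ) (hIo : IsOpen I)
    (hIc : I.OrdConnected) (w : ℝ → ℝ) (hw : ContDiffOn ℝ ∞ w I) (hpos : ∀ t ∈ I, 0 < w t) :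
    (∀ (M : Type*) [TopologicalSpace M] [ConnectedSpace M]
      [ChartedSpace (EuclideanSpace ℝ (Fin n)) M]
      [IsManifold 𝓘(ℝ, EuclideanSpace ℝ (Fin n)) 2 M] (f : M → RW.Flat n × ℝ),
      RW.IsSpacelikeImmersion c I w f → RW.HasNullSecondFF c w f →
        (∃ T ∈ I, (∀ x, (f x).2 = T) ∧
          ∃ ν : M → RW.Flat n,
            RW.IsUmbilicOn c (deriv w T) (fun x => (f x).1) ν Set.univ) ∨
        ((∃ x y, (f x).2 ≠ (f y).2) ∧
          ∀ t₀ ∈ I, (∃ x, RW.OmegaDen c w t₀ (f x).2 ≠ 0) →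
            ∃ C₀ : ℝ,
              (∀ x, RW.OmegaDen c w t₀ (f x).2 ≠ 0 ∧ RW.Omega c w t₀ (f x).2 = C₀) ∧
              Dense {x | RW.HasLocalForm c w t₀ C₀ f x} ∧
              ∀ x, (∃ U ∈ 𝓝 x, ∃ ξ : M → RW.Flat n × ℝ, RW.SecondFFCollinearOn c w f ξ U) →
                RW.HasLocalForm c w t₀ C₀ f x)) ∧
    (∀ (M : Type*) [TopologicalSpace M] [ChartedSpace (EuclideanSpace ℝ (Fin n)) M]
      [IsManifold 𝓘(ℝ, EuclideanSpace ℝ (Fin n)) 2 M] (t₀ C₀ : ℝ) (φ ν : M → RW.Flat n)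
      (τ : M → ℝ), t₀ ∈ I → RW.IsUmbilicOn c C₀ φ ν Set.univ →
      ContMDiff 𝓘(ℝ, EuclideanSpace ℝ (Fin n)) 𝓘(ℝ, ℝ) 2 τ →
      (∀ x, τ x ∈ I ∧ RW.OmegaDen c w t₀ (τ x) ≠ 0 ∧ RW.Omega c w t₀ (τ x) = C₀) →
        RW.IsSpacelikeImmersion c I w (RW.nullShift c w t₀ φ ν τ) ∧
        RW.HasNullSecondFF c w (RW.nullShift c w t₀ φ ν τ) ∧
        ∃ ξ : M → RW.Flat n × ℝ,
          RW.SecondFFCollinearOn c w (RW.nullShift c w t₀ φ ν τ) ξ Set.univ) := by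
  have hI : RW.IsWarping I w := ⟨hIo, hw, hpos⟩
  refine ⟨?_, ?_⟩
  · intro M _ _ _ _ f hf hnull
    by_cases hne : ∃ x y, (f x).2 ≠ (f y).2
    · refine Or.inr ⟨hne, fun t₀ h₀ ⟨x, hx⟩ => ?_⟩
      rw [hI.OmegaDen_ne_zero_iff hIc h₀ (hf.mem_interval x)] at hx
      obtain ⟨C₀, hC⟩ := hf.exists_shiftCofactor_eq hn hI hIc hnull hne h₀ hx
      have hform : ∀ {N : M → RW.Flat n} {y : M}, RW.NullFrameAt c w f N y →
          RW.HasLocalForm c w t₀ C₀ f y := fun h =>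
        h.hasLocalForm hf hI hIc h₀ (fun y => (hC y).1) fun y => (hC y).2
      refine ⟨C₀, fun y => ⟨?_, ?_⟩, ?_, ?_⟩
      · exact (hI.OmegaDen_ne_zero_iff hIc h₀ (hf.mem_interval y)).2 (hC y).1
      · rw [hI.Omega_eq hIc h₀ (hf.mem_interval y), (hC y).2, mul_div_cancel_right₀ _ (hC y).1]
      · rw [dense_iff_inter_open]
        rintro s hs ⟨y, hy⟩
        obtain ⟨z, hz, N, hN⟩ := hf.exists_nullFrameAt hI hnull y (hs.mem_nhds hy)
        exact ⟨z, hz, hform hN⟩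
      · rintro y ⟨U, hU, ξ, hξ⟩
        obtain ⟨N, hN⟩ := hξ.exists_nullFrameAt hU hf hI
        exact hform hN
    · push Not at hne
      obtain ⟨x₀⟩ : Nonempty M := inferInstance
      have hT : ∀ y, (f y).2 = (f x₀).2 := fun y => hne y x₀
      refine Or.inl ⟨(f x₀).2, hf.mem_interval x₀, hT, ?_⟩
      by_cases h0 : deriv w (f x₀).2 = 0
      · exact RW.exists_isUmbilicOn_of_deriv_eq_zero hf hI hT hnull h0
      · exact RW.exists_isUmbilicOn_of_deriv_ne_zero hn hf hI hT hnull h0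
  · intro M _ _ _ t₀ C₀ φ ν τ h₀ h hτ hC
    have hm : ∀ x, τ x ∈ I := fun x => (hC x).1
    have hR : ∀ x, RW.shiftCofactor c w t₀ (τ x) = C₀ * RW.shiftFactor c w t₀ (τ x) := by
      intro x
      obtain ⟨-, h1, h2⟩ := hC x
      rw [hI.OmegaDen_ne_zero_iff hIc h₀ (hm x)] at h1
      rw [hI.Omega_eq hIc h₀ (hm x), div_eq_iff h1] at h2
      exact h2
    have hξ := RW.secondFFCollinearOn_nullShift hI hIc h₀ h hτ hm hR
    exact ⟨(RW.isSpacelikeImmersion_nullShift hI hIc h₀ h hτ hm hR).1, hξ.hasNullSecondFF, _, hξ⟩
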